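/- \textbf{Model.} In $\mathcal{CAMP}_{n,t}$ there are $n$ asynchronous sequential processes, each of which can send messages to every process (itself included) over reliable, asynchronous, not necessarily FIFO channels: no message is lost, created, corrupted or duplicated, and a message sent to a process that never crashes is eventually received. At most $t$ processes crash; a process that crashes in the middle of a step may have sent only a part of the messages of that step. A process that never crashes is \emph{correct}; it starts, and each of its threads takes infinitely many steps. \textbf{Tasks and algorithms.} A decision task for $n'$ processes is a relation $\Delta\subseteq\mathcal I\times\mathcal O$ between input and output vectors. An algorithm $A$ for processes $p_1,\dots,p_{n'}$ is given by initial states (depending on the input), deterministic transition functions $\delta_j$, where $\delta_j(s,\emptyset)$, resp. $\delta_j(s,m)$, runs $p_j$ from its initial state, resp. from the reception of $m$, until its next reception and returns the new state and the messages sent, and a partial function telling which value a state allows to decide; $p_j$ decides the value allowed by its first state that allows one. $A$ solves $\Delta$ in $\mathcal{CAMP}_{n',t}$ if in every execution with input vector $I\in\mathcal I$ every correct process decides and there is $O$ with $(I,O)\in\Delta$ and $O[j]=v$ whenever $p_j$ decides $v$. \textbf{Safe agreement.} The $n$ simulators $q_1,\dots,q_n$ use objects $SA[j,sn]$ ($1\le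 j\le n'$, $sn\ge 0$) over a totally ordered set of values. For each object $q_i$ keeps arrays $values_i$, $all\_views_i$, initially $\bot$. When \textsc{value}$(x,v)$ is received for the first time, $q_i$ sets $values_i[x]\gets v$ and broadcasts \textsc{value}$(x,v)$; when \textsc{view}$(x,w)$ is received for the first time, it sets $all\_views_i[x]\gets w$ and broadcasts \textsc{view}$(x,w)$; when \textsc{read}$(k,x)$ is received for the first time, it sends \textsc{answer}$(k,x,values_i[x])$ to $q_k$. Operation $\mathsf{propose}(v)$ by $q_i$: broadcast \textsc{value}$(i,v)$ and wait until it is received from more than $n/2$ simulators; broadcast \textsc{read}$(i,x)$ for all $x$; for $x=1,\dots,n$ in turn, wait until \textsc{answer}$(i,x,\bot)$, or \textsc{value}$(x,u)$ for some $u$, is received from more than $n/2$ simulators, and set $view[x]\gets u$ if the second holds, $view[x]\gets\bot$ otherwise; broadcast \textsc{view}$(i,view)$ and wait until it is received from more than $n/2$ simulators. Operation $\mathsf{decide}()$: wait until there is a non-empty set $\sigma$ of simulators such that for all $y\in\sigma$: $values_i[y]\ne\bot$, $all\_views_i[y]\neq\bot$, and $all\_views_i[y][z]\ne\bot$ implies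 $z\in\sigma$; take such a $\sigma$ of smallest size and return $\min\{values_i[y]:y\in\sigma\}$. \textbf{Simulation.} $q_i$ has an input vector $input_i[1..n']$, sequences $sent_i[j]$ and $received_i[j]$ ($1\le j\le n'$) of messages, initially empty, a first-in first-out mutual exclusion lock, and one thread per simulated process. A simulated message carries its sender and its rank among the messages of that sender to the same destination. The thread for $p_j$ executes $SA[j,0].\mathsf{propose}(input_i[j])$ while holding the lock, then $input_i[j]\gets SA[j,0].\mathsf{decide}()$, and applies $\delta_j(\cdot,\emptyset)$ to the initial state of $p_j$ with this input. Then, for $sn=1,2,\dots$: it waits until some message of $sent_i[j]$ is not in $received_i[j]$; it executes $SA[j,sn].\mathsf{propose}(m)$ with the oldest such message $m$ while holding the lock; it obtains a message from $SA[j,sn].\mathsf{decide}()$, appends it to $received_i[j]$, and applies $\delta_j$ to the current state of $p_j$ and this message. After each application of $\delta_j$ the messages sent to $p_x$ are appended to $sent_i[x]$ for every $x$ and, if no decision of $p_j$ has been recorded yet and the new state allows a decision $v$, then $q_i$ records $v$ as the decision of $p_j$. \textbf{Theorem.} Let $2t<n$ and $t<n'$, and let $A$ solve a decision task $\Delta\subseteq\mathcal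 I\times\mathcal O$ in $\mathcal{CAMP}_{n',t}$. Consider any execution of the simulation of $A$ in $\mathcal{CAMP}_{n,t}$ in which the inputs are such that every vector $I$ with $I[j]\in\{input_1[j],\dots,input_n[j]\}$ for all $j$ is in $\mathcal I$. Then: \begin{enumerate} \item There are such a vector $I$ and an execution $E$ of $A$ in $\mathcal{CAMP}_{n',t}$ with input vector $I$ such that: for every simulator $q_i$ (crashed or not), every $p_j$ and every time, the state of $p_j$ and the sequence of messages received by $p_j$ at $q_i$ are those of $p_j$ at some time of $E$; conversely, each pair (state of $p_j$, sequence of messages received by $p_j$) of $E$ occurs at some time at every correct simulator; the processes that crash in $E$ are exactly those whose simulation is blocked at some correct simulator (from some time on, the thread never completes its current access to a safe agreement object); every decision recorded for $p_j$ by any simulator is the decision of $p_j$ in $E$; and there is $O$ with $(I,O)\in\Delta$ such that $O[j]=v$ for every decision $v$ of $p_j$ recorded by a simulator. \item The crash of a simulator blocks at most one simulated process: there is a function $f$ from simulators to simulated processes such that every simulated process whose simulation is blocked at some correct simulator is $f(q)$ for some crashed simulator $q$. \item All simulators see the same message sequences: for every $j$ and $k$, any two simulators that simulate the $k$-th reception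 of $p_j$ obtain the same message. \item Each correct simulator records the decisions of at least $n'-t$ simulated processes. \end{enumerate} -/

import Mathlib

noncomputable section

open scoped Classical

namespace BG

/-! ### The crash-prone asynchronous message-passing model -/

/-- A message-passing protocol for `n` sequential processes.  Every transition returns the new
local state and, for each destination, the sequence of messages sent to it.
`start` is executed once, `recv` on each reception (local state, sender, content),
and `tick` is one step of one of the internal threads of the process. -/
structure Protocol (n : ℕ) (In M S Thr : Type*) where
  start : Fin n → In → S × (Fin n → List M)
  recv : Fin n → S → Fin n → M → S × (Fin n → List M)
  tick : Fin n → Thr → S → S × (Fin n → List M)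

/-- A global configuration.  `loc p = none` means that `p` has not started yet;
`chan p q` lists all messages sent so far by `p` to `q`, and `got p q` is the set of the positions
in that list that `q` has already received. -/
structure Config (n : ℕ) (M S : Type*) where
  loc : Fin n → Option S
  chan : Fin n → Fin n → List M
  got : Fin n → Fin n → Set ℕ
  crashed : Set (Fin n)

/-- The steps of a process; `recv q k` is the reception of the message number `k` sent by `q`. -/
inductive Event (n : ℕ) (Thr : Type*) where
  | start
  | recv (q : Fin n) (k : ℕ)
  | tick (θ : Thr)

def Config.initial (n : ℕ) (M S : Type*) : Config n M S where
  loc := fun _ => none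
  chan := fun _ _ => []
  got := fun _ _ => ∅
  crashed := ∅

/-- Result of the step `ev` of `p` in configuration `c`; `none` if the step is not possible.
Channels are not FIFO, and do not lose, create, corrupt or duplicate messages. -/
def Protocol.effect {n : ℕ} {In M S Thr : Type*} (P : Protocol n In M S Thr) (inp : Fin n → In)
    (c : Config n M S) (p : Fin n) : Event n Thr → Option (S × (Fin n → List M))
  | .start => if c.loc p = none then some (P.start p (inp p)) else none
  | .recv q k =>
      if k ∈ c.got q p then none
      else (c.loc p).bind fun s => (c.chan q p)[k]?.map fun m => P.recv p s q m
  | .tick θ => (c.loc p).map (P.tick p θ)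

/-- Append the messages `out` sent by `p` to its outgoing channels. -/
def Config.send {n : ℕ} {M S : Type*} (c : Config n M S) (p : Fin n) (out : Fin n → List M) :
    Config n M S :=
  { c with chan := fun a b => if a = p then c.chan a b ++ out b else c.chan a b }

/-- Record that `p` has received the message referred to by `ev`, if any. -/
def Config.mark {n : ℕ} {M S Thr : Type*} (c : Config n M S) (p : Fin n) :
    Event n Thr → Config n M S
  | .recv q k => { c with got := fun a b => if a = q ∧ b = p then insert k (c.got a b)
                                            else c.got a b }
  | _ => c

/-- One global step; the label is the complete process step that is executed, if any. -/
inductive Step {n : ℕ} {In M S Thr : Type*} (P : Protocol n In M S Thr) (inp : Fin n → In) :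
    Config n M S → Option (Fin n × Event n Thr) → Config n M S → Prop
  /-- nothing happens -/
  | idle (c : Config n M S) : Step P inp c none c
  /-- a non-crashed process executes a complete step -/
  | run (c : Config n M S) (p : Fin n) (ev : Event n Thr) (s : S) (out : Fin n → List M) :
      p ∉ c.crashed → P.effect inp c p ev = some (s, out) →
      Step P inp c (some (p, ev))
        { (c.send p out).mark p ev with loc := Function.update c.loc p (some s) }
  /-- a process crashes between two steps -/
  | crash (c : Config n M S) (p : Fin n) : p ∉ c.crashed →
      Step P inp c none { c with crashed := insert p c.crashed }
  /-- a process crashes in the middle of a step, having sent only a part of the messages -/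
  | crashInside (c : Config n M S) (p : Fin n) (ev : Event n Thr) (s : S)
      (out out' : Fin n → List M) :
      p ∉ c.crashed → P.effect inp c p ev = some (s, out) → (∀ q, out' q <+: out q) →
      Step P inp c none { c.send p out' with crashed := insert p c.crashed }

/-- A discrete-time trace: configurations, and complete process steps executed between them. -/
structure Trace (n : ℕ) (M S Thr : Type*) where
  cfg : ℕ → Config n M S
  act : ℕ → Option (Fin n × Event n Thr)

/-- `p` never crashes. -/
def Trace.Correct {n : ℕ} {M S Thr : Type*} (e : Trace n M S Thr) (p : Fin n) : Prop :=
  ∀ τ, p ∉ (e.cfg τ).crashed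

/-- `e` is an execution of `P` with inputs `inp` in the asynchronous message-passing model where
at most `t` of the `n` processes crash. -/
structure IsExecution {n : ℕ} {In M S Thr : Type*} (P : Protocol n In M S Thr) (inp : Fin n → In)
    (t : ℕ) (e : Trace n M S Thr) : Prop where
  init : e.cfg 0 = Config.initial n M S
  step : ∀ τ, Step P inp (e.cfg τ) (e.act τ) (e.cfg (τ + 1))
  resilient : {p | ¬ e.Correct p}.ncard ≤ t
  starts : ∀ p, e.Correct p → ∃ τ, (e.cfg τ).loc p ≠ none
  delivers : ∀ p, e.Correct p → ∀ q τ k, k < ((e.cfg τ).chan q p).length →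
    ∃ τ', k ∈ (e.cfg τ').got q p
  fair : ∀ p, e.Correct p → ∀ θ τ, ∃ τ', τ ≤ τ' ∧ e.act τ' = some (p, .tick θ)

/-- The sequence of messages (sender, rank among the messages from that sender to `p`, content)
received by `p` before time `τ`. -/
def Trace.received {n : ℕ} {M S Thr : Type*} (e : Trace n M S Thr) (p : Fin n) (τ : ℕ) :
    List (Fin n × ℕ × M) :=
  (List.range τ).filterMap fun u =>
    match e.act u with
    | some (p', .recv q k) =>
        if p' = p then ((e.cfg u).chan q p)[k]?.map fun m => (q, k, m) else none
    | _ => none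

/-! ### Decision tasks and algorithms -/

/-- A decision task: a binary relation from allowed input vectors into output vectors. -/
structure Task (n : ℕ) (In Out : Type*) where
  inputs : Set (Fin n → In)
  outputs : Set (Fin n → Out)
  rel : (Fin n → In) → (Fin n → Out) → Prop
  rel_mem : ∀ I O, rel I O → I ∈ inputs ∧ O ∈ outputs

/-- A deterministic message-passing algorithm.  `init j v` is the initial local state of `p_j` with
input `v`; `δ j s none` runs `p_j` from its initial state until its first reception, and
`δ j s (some (q, m))` runs it from the reception of `m` from `p_q` until its next reception.
`dec j s` is the value that the state `s` allows `p_j` to decide, if any. -/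
structure Algorithm (n : ℕ) (In Out M S : Type*) where
  init : Fin n → In → S
  δ : Fin n → S → Option (Fin n × M) → S × (Fin n → List M)
  dec : Fin n → S → Option Out

def Algorithm.toProtocol {n : ℕ} {In Out M S : Type*} (A : Algorithm n In Out M S) :
    Protocol n In M S Empty where
  start := fun j v => A.δ j (A.init j v) none
  recv := fun j s q m => A.δ j s (some (q, m))
  tick := fun _ θ _ => θ.elim

/-- In `e`, process `p` decides `v`: this is the value allowed by the first state of `p` that
allows a decision. -/
def Algorithm.Decides {n : ℕ} {In Out M S : Type*} (A : Algorithm n In Out M S)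
    (e : Trace n M S Empty) (p : Fin n) (v : Out) : Prop :=
  ∃ τ, ((e.cfg τ).loc p).bind (A.dec p) = some v ∧
    ∀ τ' < τ, ((e.cfg τ').loc p).bind (A.dec p) = none

/-- `A` solves the task `T` in the presence of at most `t` crashes. -/
def Algorithm.Solves {n : ℕ} {In Out M S : Type*} (A : Algorithm n In Out M S)
    (T : Task n In Out) (t : ℕ) : Prop :=
  ∀ I ∈ T.inputs, ∀ e, IsExecution A.toProtocol I t e →
    (∀ p, e.Correct p → ∃ v, A.Decides e p v) ∧
    ∃ O, T.rel I O ∧ ∀ p v, A.Decides e p v → O p = v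

/-! ### Safe agreement: messages and server side -/

/-- Messages of a safe agreement object shared by `n` simulators; `V` is the type of the
values that can be proposed, and `none` stands for the default value `⊥`. -/
inductive SAMsg (n : ℕ) (V : Type*) where
  | value (x : Fin n) (v : V)
  | read (j x : Fin n)
  | answer (j x : Fin n) (w : Option V)
  | view (x : Fin n) (w : Fin n → Option V)

/-- Local data of a simulator for one safe agreement object: the messages received so far (with
their senders), and the arrays `values` and `all_views`. -/
structure SAState (n : ℕ) (V : Type*) where
  log : Set (Fin n × SAMsg n V)
  values : Fin n → Option V
  allViews : Fin n → Option (Fin n → Option V)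

def SAState.initial (n : ℕ) (V : Type*) : SAState n V where
  log := ∅
  values := fun _ => none
  allViews := fun _ => none

/-- Reception of the message `m` from `src`.  A message already received (from any simulator)
is only recorded. -/
def SAState.recv {n : ℕ} {V : Type*} (s : SAState n V) (src : Fin n) (m : SAMsg n V) :
    SAState n V × (Fin n → List (SAMsg n V)) :=
  let s' : SAState n V := { s with log := insert (src, m) s.log }
  if ∃ q, (q, m) ∈ s.log then (s', fun _ => [])
  else match m with
    | .value x v =>
        ({ s' with values := Function.update s.values x (some v) }, fun _ => [.value x v])
    | .read j x => (s', fun q => if q = j then [.answer j x (s.values x)] else [])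
    | .answer _ _ _ => (s', fun _ => [])
    | .view x w =>
        ({ s' with allViews := Function.update s.allViews x (some w) }, fun _ => [.view x w])

/-- The message `m` was received from strictly more than `n / 2` different simulators. -/
def SAState.Majority {n : ℕ} {V : Type*} (s : SAState n V) (m : SAMsg n V) : Prop :=
  n < 2 * {q : Fin n | (q, m) ∈ s.log}.ncard

/-- `σ` is a non-empty set of simulators whose values and views are known, and which contains
all the simulators whose values appear in these views. -/
def SAState.Closed {n : ℕ} {V : Type*} (s : SAState n V) (σ : Finset (Fin n)) : Prop :=
  σ.Nonempty ∧ ∀ y ∈ σ, s.values y ≠ none ∧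
    ∃ w, s.allViews y = some w ∧ ∀ z, w z ≠ none → z ∈ σ

/-- `decide()` can return `r`: the smallest of the values proposed by the members of a closed set
of smallest size. -/
def SAState.Returns {n : ℕ} {V : Type*} [LinearOrder V] (s : SAState n V) (r : V) : Prop :=
  ∃ σ, s.Closed σ ∧ (∀ σ', s.Closed σ' → σ.card ≤ σ'.card) ∧
    IsLeast {v | ∃ y ∈ σ, s.values y = some v} r

/-- The value returned by `decide()`, or `none` while it has to wait. -/
def SAState.result {n : ℕ} {V : Type*} [LinearOrder V] (s : SAState n V) : Option V :=
  if h : ∃ r, s.Returns r then some h.choose else none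

/-! ### The simulation algorithm -/

/-- A simulated message to a given destination: sender, rank among the messages sent by that sender
to that destination, content.  The first two components identify the message. -/
abbrev SimMsg (n' : ℕ) (M : Type*) := Fin n' × ℕ × M

/-- Values proposed to the safe agreement objects: inputs or simulated messages. -/
inductive SAVal (n' : ℕ) (In M : Type*) where
  | input (v : In)
  | msg (m : SimMsg n' M)

/-- Program counter of the thread of a simulator that simulates `p_j`, where `SA` is the current
safe agreement object `SA[j, sn]`. -/
inductive PC (n : ℕ) (V : Type*) where
  /-- initially -/
  | begin
  /-- waiting for a message that can be received by `p_j` -/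
  | waitMsg
  /-- `mutex_in` invoked, in order to execute `SA.propose(v)` -/
  | lock (v : V)
  /-- in `SA.propose(v)`: the value was broadcast, waiting for a majority of copies -/
  | waitValue (v : V)
  /-- in `SA.propose`: building the view, entries `< k` are done -/
  | reading (k : ℕ) (w : Fin n → Option V)
  /-- in `SA.propose`: the view was broadcast, waiting for a majority of copies -/
  | waitView (w : Fin n → Option V)
  /-- in `SA.decide()` -/
  | deciding

/-- Local state of a simulator.  The safe agreement object `SA[j, sn]` is identified by `(j, sn)`.
`queue` is the queue of the starvation-free (first-in first-out) lock; its head owns the lock.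
`received j` lists the messages received by `p_j`, in order; `state j = none` as long as `p_j` has
not executed its first statements. -/
structure SimState (n n' : ℕ) (In Out M S : Type*) where
  input : Fin n' → In
  sa : Fin n' × ℕ → SAState n (SAVal n' In M)
  queue : List (Fin n')
  pc : Fin n' → PC n (SAVal n' In M)
  sn : Fin n' → ℕ
  sent : Fin n' → List (SimMsg n' M)
  received : Fin n' → List (SimMsg n' M)
  state : Fin n' → Option S
  decided : Fin n' → Option Out

/-- Messages exchanged by the simulators: messages of the safe agreement objects `SA[j, sn]`. -/
abbrev NetMsg (n n' : ℕ) (In M : Type*) := (Fin n' × ℕ) × SAMsg n (SAVal n' In M)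

section Simulator

variable {n n' : ℕ} {In Out M S : Type*}

def SimState.initial (input : Fin n' → In) : SimState n n' In Out M S where
  input := input
  sa := fun _ => SAState.initial n _
  queue := []
  pc := fun _ => .begin
  sn := fun _ => 0
  sent := fun _ => []
  received := fun _ => []
  state := fun _ => none
  decided := fun _ => none

/-- Change of the program counter of the thread `j`. -/
def SimState.goto (s : SimState n n' In Out M S) (j : Fin n') (pc : PC n (SAVal n' In M)) :
    SimState n n' In Out M S :=
  { s with pc := Function.update s.pc j pc }

/-- The thread `j` invokes `mutex_in` in order to propose `v`. -/
def SimState.mutexIn (s : SimState n n' In Out M S) (j : Fin n') (v : SAVal n' In M) :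
    SimState n n' In Out M S :=
  { s.goto j (.lock v) with queue := s.queue ++ [j] }

/-- Oldest message in `sent[j] \ received[j]`. -/
def SimState.oldest (s : SimState n n' In Out M S) (j : Fin n') : Option (SimMsg n' M) :=
  (s.sent j).find? fun m => decide (m ∉ s.received j)

/-- The result `r = (new state, messages)` of `δ_j` is recorded: the messages, with their
identities, are added at the end of the sequences `sent[x]`, and `p_j` decides if it has not decided
yet and its new state allows it to do so.  The thread then waits for the next message. -/
def SimState.advance (A : Algorithm n' In Out M S) (s : SimState n n' In Out M S) (j : Fin n')
    (r : S × (Fin n' → List M)) : SimState n n' In Out M S :=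
  { s.goto j .waitMsg with
    state := Function.update s.state j (some r.1)
    sent := fun x => s.sent x ++
      (r.2 x).mapIdx fun k m => (j, (s.sent x).countP (fun a => decide (a.1 = j)) + k, m)
    decided := Function.update s.decided j ((s.decided j).or (A.dec j r.1))
    sn := Function.update s.sn j (s.sn j + 1) }

/-- The thread `j` obtains the value `v` from `SA[j, sn].decide()`: the input of `p_j` from
`SA[j, 0]`, the next message received by `p_j` from `SA[j, sn]` with `sn ≥ 1`. -/
def SimState.obtain (A : Algorithm n' In Out M S) (s : SimState n n' In Out M S) (j : Fin n') :
    SAVal n' In M → SimState n n' In Out M S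
  | .input v =>
      { s with input := Function.update s.input j v }.advance A j (A.δ j (A.init j v) none)
  | .msg m =>
      match s.state j with
      | some st =>
          { s with received := Function.update s.received j (s.received j ++ [m]) }.advance A j
            (A.δ j st (some (m.1, m.2.2)))
      | none => s

/-- One step of the thread of the simulator `i` that simulates `p_j`. -/
def threadStep [LinearOrder (SAVal n' In M)] (A : Algorithm n' In Out M S) (i : Fin n)
    (j : Fin n') (s : SimState n n' In Out M S) :
    SimState n n' In Out M S × (Fin n → List (NetMsg n n' In M)) :=
  let o : Fin n' × ℕ := (j, s.sn j)
  let silent : Fin n → List (NetMsg n n' In M) := fun _ => []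
  match s.pc j with
  | .begin => (s.mutexIn j (.input (s.input j)), silent)
  | .waitMsg =>
      match s.oldest j with
      | some m => (s.mutexIn j (.msg m), silent)
      | none => (s, silent)
  | .lock v =>
      if s.queue.head? = some j then (s.goto j (.waitValue v), fun _ => [(o, .value i v)])
      else (s, silent)
  | .waitValue v =>
      if (s.sa o).Majority (.value i v) then
        (s.goto j (.reading 0 fun _ => none),
          fun _ => (List.finRange n).map fun x => (o, .read i x))
      else (s, silent)
  | .reading k w =>
      if hk : k < n then
        if h : ∃ v, (s.sa o).Majority (.value ⟨k, hk⟩ v) then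
          (s.goto j (.reading (k + 1) (Function.update w ⟨k, hk⟩ (some h.choose))), silent)
        else if (s.sa o).Majority (.answer i ⟨k, hk⟩ none) then
          (s.goto j (.reading (k + 1) (Function.update w ⟨k, hk⟩ none)), silent)
        else (s, silent)
      else (s.goto j (.waitView w), fun _ => [(o, .view i w)])
  | .waitView w =>
      if (s.sa o).Majority (.view i w) then
        ({ s.goto j .deciding with queue := s.queue.tail }, silent)
      else (s, silent)
  | .deciding =>
      match (s.sa o).result with
      | some v => (s.obtain A j v, silent)
      | none => (s, silent)

/-- The simulation of the algorithm `A` of `n'` processes by `n` simulators.  The input of a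
simulator is a vector of inputs for the simulated processes; it has one thread for each of them. -/
def simulation (n : ℕ) [LinearOrder (SAVal n' In M)] (A : Algorithm n' In Out M S) :
    Protocol n (Fin n' → In) (NetMsg n n' In M) (SimState n n' In Out M S) (Fin n') where
  start := fun _ input => (SimState.initial input, fun _ => [])
  recv := fun _ s src m =>
    let r := (s.sa m.1).recv src m.2
    ({ s with sa := Function.update s.sa m.1 r.1 }, fun q => (r.2 q).map fun a => (m.1, a))
  tick := fun i j s => threadStep A i j s

/-- Executions of the simulators. -/
abbrev SimTrace (n n' : ℕ) (In Out M S : Type*) :=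
  Trace n (NetMsg n n' In M) (SimState n n' In Out M S) (Fin n')

/-- `s` is the local state of the simulator `i` at some time of `e`. -/
def Reaches (e : SimTrace n n' In Out M S) (i : Fin n) (s : SimState n n' In Out M S) : Prop :=
  ∃ τ, (e.cfg τ).loc i = some s

/-- The simulation of `p_j` is blocked at the simulator `i`: from some time on, the thread never
again completes its current access to a safe agreement object. -/
def Blocked (e : SimTrace n n' In Out M S) (i : Fin n) (j : Fin n') : Prop :=
  ∃ τ₀, ∀ τ ≥ τ₀, ∀ s, (e.cfg τ).loc i = some s →
    match s.pc j with
    | .waitMsg => False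
    | _ => True

/-- The simulator `i` computes the decision `v` of the simulated process `p_j`. -/
def Computes (e : SimTrace n n' In Out M S) (i : Fin n) (j : Fin n') (v : Out) : Prop :=
  ∃ s, Reaches e i s ∧ s.decided j = some v

/-- The execution `e` of the simulators, with inputs `inp`, simulates the execution `e'` of `A` with
inputs `I`, in which at most `t` processes crash. -/
structure Simulates (A : Algorithm n' In Out M S) (t : ℕ) (inp : Fin n → Fin n' → In)
    (e : SimTrace n n' In Out M S) (I : Fin n' → In) (e' : Trace n' M S Empty) : Prop where
  /-- the input of each simulated process was proposed by a simulator -/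
  input : ∀ j, ∃ i, I j = inp i j
  /-- `e'` is an execution of `A` -/
  execution : IsExecution A.toProtocol I t e'
  /-- what a simulator simulates is what happens in `e'` -/
  sound : ∀ i s, Reaches e i s → ∀ j, ∃ τ,
    (e'.cfg τ).loc j = s.state j ∧ e'.received j τ = s.received j
  /-- what happens in `e'` is simulated by each correct simulator -/
  complete : ∀ i, e.Correct i → ∀ j τ, ∃ s, Reaches e i s ∧
    s.state j = (e'.cfg τ).loc j ∧ s.received j = e'.received j τ
  /-- the simulated processes that crash are those whose simulation is blocked -/
  crash : ∀ j, ¬ e'.Correct j ↔ ∃ i, e.Correct i ∧ Blocked e i j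
  /-- decisions computed by the simulators are decisions of `e'` -/
  decision : ∀ i j v, Computes e i j v → A.Decides e' j v

end Simulator

end BG

end

/-!
A simulator that proposes to a safe agreement object lets a majority receive its value before it
reads, and a majority receive its view before its access is over. Two majorities intersect, so of
two proposers whose views are known one sees the other. Hence any two closed sets of the same
object, even at different simulators, intersect in a closed set, so that the smallest closed set,
and with it the result, is the same at all simulators. The state of `p_j` and the messages that it
has sent are therefore determined by the number of results obtained for `p_j`: the simulators run
through the same history of `p_j`, and differ only in how far they have got.

The simulated execution lets `p_j` take its `k`-th step when the first simulator obtains the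
`k`-th result for `p_j`. That result is a message proposed by some simulator, hence one that `p_j`
has been sent earlier in the simulated execution and that it has not received yet.

A majority of the simulators is correct, so no proposal waits forever for an answer, and a thread
can be blocked only if some simulator has crashed while its thread for the same `p_j` was
executing a proposal. Since a proposal is executed while holding the lock, a simulator crashes in
at most one of them, and at most `t` simulated processes are blocked. A blocked process is crashed
in the simulated execution once the last of its steps that any simulator simulates has been taken.
A message sent to a process that is not blocked is eventually received: the simulators propose the
oldest message first, and only finitely many messages are older than a given one at some correct
simulator.
-/

noncomputable section

namespace BG

/-! ### Executions of a protocol -/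

theorem getElem?_eq_some_of_isPrefix {α : Type*} {l l' : List α} (h : l <+: l') {k : ℕ} {a : α}
    (ha : l[k]? = some a) : l'[k]? = some a := by
  obtain ⟨hk, rfl⟩ := List.getElem?_eq_some_iff.1 ha
  exact List.prefix_iff_getElem?.1 h k hk

theorem eq_of_getElem?_of_isPrefix {α : Type*} {l l₁ l₂ : List α} (h₁ : l₁ <+: l) (h₂ : l₂ <+: l)
    {k : ℕ} {a₁ a₂ : α} (ha₁ : l₁[k]? = some a₁) (ha₂ : l₂[k]? = some a₂) : a₁ = a₂ :=
  Option.some.inj <| (getElem?_eq_some_of_isPrefix h₁ ha₁).symm.trans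
    (getElem?_eq_some_of_isPrefix h₂ ha₂)

section Model

variable {n t : ℕ} {In M S Thr : Type*} {P : Protocol n In M S Thr} {inp : Fin n → In}
  {c c' : Config n M S} {label : Option (Fin n × Event n Thr)}

theorem Protocol.effect_recv_eq_some {p q : Fin n} {k : ℕ} {r : S × (Fin n → List M)} :
    P.effect inp c p (.recv q k) = some r ↔
      k ∉ c.got q p ∧ ∃ s m, c.loc p = some s ∧ (c.chan q p)[k]? = some m ∧
        P.recv p s q m = r := by
  simp only [Protocol.effect, Option.ite_none_left_eq_some, Option.bind_eq_some_iff,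
    Option.map_eq_some_iff]
  grind

theorem Protocol.effect_tick_eq_some {p : Fin n} {θ : Thr} {r : S × (Fin n → List M)} :
    P.effect inp c p (.tick θ) = some r ↔ ∃ s, c.loc p = some s ∧ P.tick p θ s = r := by
  simp [Protocol.effect]

theorem Protocol.effect_start_eq_some {p : Fin n} {r : S × (Fin n → List M)} :
    P.effect inp c p .start = some r ↔ c.loc p = none ∧ P.start p (inp p) = r := by
  simp [Protocol.effect]

theorem Step.crashed_subset (h : Step P inp c label c') : c.crashed ⊆ c'.crashed := by
  cases h with
  | idle => exact subset_rfl
  | run p ev s out _ _ => cases ev <;> exact subset_rfl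
  | crash p _ => exact Set.subset_insert _ _
  | crashInside p => exact Set.subset_insert _ _

theorem Step.chan_prefix (h : Step P inp c label c') (p q : Fin n) :
    c.chan p q <+: c'.chan p q := by
  cases h with
  | idle => exact List.prefix_rfl
  | run _ ev => cases ev <;> simp only [Config.mark, Config.send] <;> split_ifs <;> simp
  | crash => exact List.prefix_rfl
  | crashInside => simp only [Config.send]; split_ifs <;> simp

theorem Step.loc_eq_or_exists_effect (h : Step P inp c label c') (p : Fin n) :
    c'.loc p = c.loc p ∨
      ∃ ev s out, label = some (p, ev) ∧ P.effect inp c p ev = some (s, out) ∧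
        c'.loc p = some s ∧ ∀ q, c'.chan p q = c.chan p q ++ out q := by
  cases h with
  | idle => exact .inl rfl
  | run p' ev s out _ heff =>
    by_cases hp : p = p'
    · subst hp
      refine .inr ⟨ev, s, out, rfl, heff, by simp, fun q => ?_⟩
      cases ev <;> simp [Config.mark, Config.send]
    · exact .inl (by simp [hp])
  | crash => exact .inl rfl
  | crashInside => exact .inl rfl

/- A message may come from an interrupted step; its sender has then crashed, and its state does not
record that step. -/
theorem Step.mem_chan_or_exists_effect (h : Step P inp c label c') {p q : Fin n} {m : M}
    (hm : m ∈ c'.chan p q) :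
    m ∈ c.chan p q ∨
      ∃ ev s out, p ∉ c.crashed ∧ P.effect inp c p ev = some (s, out) ∧ m ∈ out q ∧
        (p ∈ c'.crashed ∨ c'.loc p = some s) := by
  cases h with
  | idle => exact .inl hm
  | run p' ev s out halive heff =>
    have hsend : m ∈ (c.send p' out).chan p q := by cases ev <;> exact hm
    simp only [Config.send] at hsend
    split_ifs at hsend with hp
    · subst hp
      exact (List.mem_append.1 hsend).imp_right
        fun hout => ⟨ev, s, out, halive, heff, hout, .inr (by simp)⟩
    · exact .inl hsend
  | crash => exact .inl hm
  | crashInside p' ev s out out' halive heff hprefix =>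
    simp only [Config.send] at hm
    split_ifs at hm with hp
    · subst hp
      exact (List.mem_append.1 hm).imp_right
        fun hout => ⟨ev, s, out, halive, heff, (hprefix q).subset hout, .inl (by simp)⟩
    · exact .inl hm

theorem Step.mem_got_or_label_eq_recv (h : Step P inp c label c') {p q : Fin n} {k : ℕ}
    (hk : k ∈ c'.got q p) : k ∈ c.got q p ∨ label = some (p, .recv q k) := by
  cases h with
  | idle => exact .inl hk
  | crash => exact .inl hk
  | crashInside => exact .inl hk
  | run _ ev =>
    cases ev with
    | start => exact .inl hk
    | tick => exact .inl hk
    | recv q' k' =>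
      simp only [Config.mark, Config.send] at hk
      split_ifs at hk with hpq
      · obtain ⟨rfl, rfl⟩ := hpq
        rcases hk with rfl | hk
        · exact .inr rfl
        · exact .inl hk
      · exact .inl hk

theorem Step.exists_effect_of_label {p : Fin n} {ev : Event n Thr}
    (h : Step P inp c (some (p, ev)) c') :
    ∃ s out, p ∉ c.crashed ∧ P.effect inp c p ev = some (s, out) ∧ c'.loc p = some s := by
  cases h with
  | run _ _ s out halive heff => exact ⟨s, out, halive, heff, by simp⟩

theorem Step.loc_eq_of_mem_crashed (h : Step P inp c label c') {p : Fin n} (hp : p ∈ c.crashed) :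
    c'.loc p = c.loc p := by
  rcases h.loc_eq_or_exists_effect p with hloc | ⟨ev, _, _, rfl, -⟩
  · exact hloc
  · obtain ⟨_, _, halive, -⟩ := h.exists_effect_of_label
    exact absurd hp halive

variable {e : Trace n M S Thr} {p q : Fin n} {τ τ' : ℕ}

namespace IsExecution

theorem crashed_subset (he : IsExecution P inp t e) (h : τ ≤ τ') :
    (e.cfg τ).crashed ⊆ (e.cfg τ').crashed :=
  monotone_nat_of_le_succ (f := fun τ => (e.cfg τ).crashed)
    (fun τ => (he.step τ).crashed_subset) h

theorem loc_eq_of_mem_crashed (he : IsExecution P inp t e) (h : τ ≤ τ')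
    (hp : p ∈ (e.cfg τ).crashed) : (e.cfg τ').loc p = (e.cfg τ).loc p := by
  induction τ', h using Nat.le_induction with
  | base => rfl
  | succ u hu ih => rw [(he.step u).loc_eq_of_mem_crashed (he.crashed_subset hu hp), ih]

theorem exists_correct (he : IsExecution P inp t e) (htn : t < n) : ∃ p, e.Correct p := by
  by_contra! h
  have hcrash : {p | ¬ e.Correct p} = Set.univ := Set.eq_univ_of_forall h
  have hle := he.resilient
  rw [hcrash, Set.ncard_univ, Nat.card_fin] at hle
  omega

theorem loc_eq_of_ne (he : IsExecution P inp t e) (hp : (e.cfg (τ + 1)).loc p ≠ (e.cfg τ).loc p)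
    (hq : q ≠ p) : (e.cfg (τ + 1)).loc q = (e.cfg τ).loc q := by
  rcases (he.step τ).loc_eq_or_exists_effect p with h | ⟨_, _, _, hlabel, -⟩
  · exact absurd h hp
  rcases (he.step τ).loc_eq_or_exists_effect q with h | ⟨_, _, _, hlabel', -⟩
  · exact h
  · rw [hlabel] at hlabel'
    exact absurd (congrArg Prod.fst (Option.some.inj hlabel')).symm hq

theorem chan_prefix (he : IsExecution P inp t e) (h : τ ≤ τ') (p q : Fin n) :
    (e.cfg τ).chan p q <+: (e.cfg τ').chan p q := by
  induction τ', h using Nat.le_induction with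
  | base => exact List.prefix_rfl
  | succ u _ ih => exact ih.trans ((he.step u).chan_prefix p q)

theorem exists_effect_of_mem_chan (he : IsExecution P inp t e) {m : M}
    (hm : m ∈ (e.cfg τ).chan p q) :
    ∃ u < τ, ∃ ev s out, p ∉ (e.cfg u).crashed ∧ P.effect inp (e.cfg u) p ev = some (s, out) ∧
      m ∈ out q ∧ (p ∈ (e.cfg (u + 1)).crashed ∨ (e.cfg (u + 1)).loc p = some s) := by
  induction τ with
  | zero => simp [he.init, Config.initial] at hm
  | succ τ ih =>
    rcases (he.step τ).mem_chan_or_exists_effect hm with h | ⟨ev, s, out, h⟩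
    · obtain ⟨u, hu, h⟩ := ih h
      exact ⟨u, by omega, h⟩
    · exact ⟨τ, by omega, ev, s, out, h⟩

theorem exists_act_eq_recv (he : IsExecution P inp t e) {k : ℕ} (hk : k ∈ (e.cfg τ).got q p) :
    ∃ u, e.act u = some (p, .recv q k) := by
  induction τ with
  | zero => simp [he.init, Config.initial] at hk
  | succ τ ih => exact ((he.step τ).mem_got_or_label_eq_recv hk).elim ih fun h => ⟨τ, h⟩

theorem exists_recv_of_mem_chan (he : IsExecution P inp t e) (hp : e.Correct p) {m : M}
    (hm : m ∈ (e.cfg τ).chan q p) :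
    ∃ u s, (e.cfg u).loc p = some s ∧ (e.cfg (u + 1)).loc p = some (P.recv p s q m).1 := by
  obtain ⟨k, hk⟩ := List.mem_iff_getElem?.1 hm
  obtain ⟨τ', hgot⟩ := he.delivers p hp q τ k (List.getElem?_eq_some_iff.1 hk).1
  obtain ⟨u, hu⟩ := he.exists_act_eq_recv hgot
  obtain ⟨s', out, -, heff, hloc⟩ := (hu ▸ he.step u).exists_effect_of_label
  obtain ⟨-, s, m', hs, hm', hr⟩ := Protocol.effect_recv_eq_some.1 heff
  obtain rfl : m = m' := eq_of_getElem?_of_isPrefix (he.chan_prefix (le_max_left τ u) q p)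
    (he.chan_prefix (le_max_right τ u) q p) hk hm'
  exact ⟨u, s, hs, by rw [hloc, hr]⟩

theorem exists_tick_ge (he : IsExecution P inp t e) (hp : e.Correct p) (θ : Thr) (τ : ℕ) :
    ∃ u ≥ τ, ∃ s, (e.cfg u).loc p = some s ∧ (e.cfg (u + 1)).loc p = some (P.tick p θ s).1 := by
  obtain ⟨u, hu, hact⟩ := he.fair p hp θ τ
  obtain ⟨_, _, -, heff, hloc⟩ := (hact ▸ he.step u).exists_effect_of_label
  obtain ⟨s, hs, hr⟩ := Protocol.effect_tick_eq_some.1 heff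
  exact ⟨u, hu, s, hs, by rw [hloc, hr]⟩

end IsExecution

end Model

/-! ### Steps of a simulator -/

section SafeAgreement

variable {n : ℕ} {V : Type*} {a b : SAState n V} {m m' : SAMsg n V}

namespace SAState

theorem recv_log (a : SAState n V) (src : Fin n) (m : SAMsg n V) :
    (a.recv src m).1.log = insert (src, m) a.log := by
  simp only [recv]
  split_ifs <;> cases m <;> rfl

/-- The arrays `values` and `allViews` record exactly for which simulators a value, respectively a
view, has been received, and hold such a value or view. -/
structure Consistent (a : SAState n V) : Prop where
  exists_value_mem : ∀ x v, a.values x = some v → ∃ q, (q, .value x v) ∈ a.log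
  values_ne_none : ∀ q x v, (q, .value x v) ∈ a.log → a.values x ≠ none
  exists_view_mem : ∀ x w, a.allViews x = some w → ∃ q, (q, .view x w) ∈ a.log
  allViews_ne_none : ∀ q x w, (q, .view x w) ∈ a.log → a.allViews x ≠ none

theorem consistent_initial : (SAState.initial n V).Consistent := by
  constructor <;> simp [SAState.initial]

theorem Consistent.recv (h : a.Consistent) (src : Fin n) (m : SAMsg n V) :
    (a.recv src m).1.Consistent := by
  obtain ⟨hval, hval', hview, hview'⟩ := h
  by_cases hold : ∃ q, (q, m) ∈ a.log
  · simp only [SAState.recv, if_pos hold]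
    obtain ⟨q₀, hq₀⟩ := hold
    constructor <;> grind
  · simp only [SAState.recv, if_neg hold]
    cases m <;> constructor <;> grind

theorem Majority.mono (h : a.log ⊆ b.log) (hm : a.Majority m) : b.Majority m :=
  lt_of_lt_of_le hm <| Nat.mul_le_mul_left 2 <| Set.ncard_le_ncard (fun _ hq => h hq)

theorem Majority.exists_common (hm : a.Majority m) (hm' : b.Majority m') :
    ∃ q, (q, m) ∈ a.log ∧ (q, m') ∈ b.log := by
  by_contra! hdisj
  have hunion : ({q | (q, m) ∈ a.log} ∪ {q | (q, m') ∈ b.log}).ncard = _ :=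
    Set.ncard_union_eq (Set.disjoint_left.2 hdisj)
  have hcard := Set.ncard_le_card ({q | (q, m) ∈ a.log} ∪ {q | (q, m') ∈ b.log})
  rw [Nat.card_fin] at hcard
  unfold Majority at hm hm'
  omega

theorem Majority.exists_mem (hm : a.Majority m) : ∃ q, (q, m) ∈ a.log :=
  (hm.exists_common hm).imp fun _ => And.left

end SAState

end SafeAgreement

section Lock

variable {n : ℕ} {V ι : Type*}

namespace PC

/-- Position of a program counter within the current access to a safe agreement object. -/
def rank : PC n V → ℕ
  | .begin => 0
  | .waitMsg => 0
  | .lock _ => 1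
  | .waitValue _ => 2
  | .reading k _ => 3 + min k n
  | .waitView _ => 4 + n
  | .deciding => 5 + n

/-- The thread is executing `propose`, which it does while it owns the lock. -/
def Proposing (p : PC n V) : Prop := 2 ≤ p.rank ∧ p.rank ≤ 4 + n

/-- The thread owns the lock or is waiting for it. -/
def Queued (p : PC n V) : Prop := 1 ≤ p.rank ∧ p.rank ≤ 4 + n

theorem Proposing.queued {p : PC n V} (h : p.Proposing) : p.Queued :=
  ⟨one_le_two.trans h.1, h.2⟩

end PC

/-- The queue of the lock lists the threads that own the lock or are waiting for it, and only its
head can be executing `propose`. -/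
structure LockInv (queue : List ι) (pc : ι → PC n V) : Prop where
  nodup : queue.Nodup
  mem_iff : ∀ j, j ∈ queue ↔ (pc j).Queued
  head_of_proposing : ∀ j, (pc j).Proposing → queue.head? = some j

namespace LockInv

variable [DecidableEq ι] {queue : List ι} {pc : ι → PC n V} {j : ι} {p : PC n V}

theorem update_head (h : LockInv queue pc) (hj : queue.head? = some j) (hp : p.Queued) :
    LockInv queue (Function.update pc j p) where
  nodup := h.nodup
  mem_iff a := by
    rcases eq_or_ne a j with rfl | ha
    · simpa [hp] using List.mem_of_head? hj
    · simpa [ha] using h.mem_iff a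
  head_of_proposing a := by
    rcases eq_or_ne a j with rfl | ha
    · exact fun _ => hj
    · simpa [ha] using h.head_of_proposing a

theorem update_of_not_queued (h : LockInv queue pc) (hj : ¬ (pc j).Queued) (hp : ¬ p.Queued) :
    LockInv queue (Function.update pc j p) where
  nodup := h.nodup
  mem_iff a := by
    rcases eq_or_ne a j with rfl | ha
    · simpa [hp, h.mem_iff] using hj
    · simpa [ha] using h.mem_iff a
  head_of_proposing a := by
    rcases eq_or_ne a j with rfl | ha
    · simpa using fun ha => absurd (PC.Proposing.queued ha) hp
    · simpa [ha] using h.head_of_proposing a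

theorem append (h : LockInv queue pc) (hj : ¬ (pc j).Queued) (hp : p.Queued)
    (hp' : ¬ p.Proposing) : LockInv (queue ++ [j]) (Function.update pc j p) where
  nodup := List.nodup_append.2
    ⟨h.nodup, List.nodup_singleton j, by
      simpa using fun a ha (haj : a = j) => hj ((h.mem_iff j).1 (haj ▸ ha))⟩
  mem_iff a := by
    rcases eq_or_ne a j with rfl | ha
    · simpa using hp
    · simpa [ha] using h.mem_iff a
  head_of_proposing a := by
    rcases eq_or_ne a j with rfl | ha
    · simp [hp']
    · intro hprop
      simp [h.head_of_proposing a (by simpa [ha] using hprop)]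

theorem tail (h : LockInv queue pc) (hj : queue.head? = some j) (hp : ¬ p.Queued) :
    LockInv queue.tail (Function.update pc j p) := by
  obtain ⟨tail, rfl⟩ := List.head?_eq_some_iff.1 hj
  obtain ⟨hnotmem, hnodup⟩ := List.nodup_cons.1 h.nodup
  refine ⟨hnodup, fun a => ?_, fun a hprop => ?_⟩ <;> rcases eq_or_ne a j with rfl | ha
  · simpa [hp] using hnotmem
  · simpa [ha] using h.mem_iff a
  · exact absurd (PC.Proposing.queued (by simpa using hprop)) hp
  · have hhead := h.head_of_proposing a (by simpa [ha] using hprop)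
    exact absurd (Option.some.inj (hhead.symm.trans hj)) ha

end LockInv

end Lock

section Simulator

variable {n n' : ℕ} {In Out M S : Type*} {s s' s'' : SimState n n' In Out M S} {j : Fin n'}
  {A : Algorithm n' In Out M S} {v : SAVal n' In M}

/-- From `s` to `s'`, the thread `j` has only gone forward: to a later safe agreement object, or to
a later statement of the access to the same object. -/
def SimState.ThreadLE (s s' : SimState n n' In Out M S) (j : Fin n') : Prop :=
  s.sn j < s'.sn j ∨ s.sn j = s'.sn j ∧ (s'.pc j = s.pc j ∨ (s.pc j).rank < (s'.pc j).rank)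

theorem SimState.ThreadLE.refl (s : SimState n n' In Out M S) (j : Fin n') : s.ThreadLE s j :=
  .inr ⟨rfl, .inl rfl⟩

theorem SimState.ThreadLE.trans (h : s.ThreadLE s' j) (h' : s'.ThreadLE s'' j) :
    s.ThreadLE s'' j := by
  unfold SimState.ThreadLE at *
  grind

theorem SimState.ThreadLE.sn_le (h : s.ThreadLE s' j) : s.sn j ≤ s'.sn j := by
  rcases h with h | ⟨h, -⟩ <;> omega

/-- The thread `j` is about to request the lock in order to propose a value: the input of `p_j`, or
the oldest message that `p_j` has not received. -/
inductive SimState.Ready (s : SimState n n' In Out M S) (j : Fin n') : SAVal n' In M → Prop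
  | input : s.pc j = .begin → s.Ready j (.input (s.input j))
  | msg (m : SimMsg n' M) : s.pc j = .waitMsg → s.oldest j = some m → s.Ready j (.msg m)

theorem SimState.Ready.rank_eq_zero (h : s.Ready j v) : (s.pc j).rank = 0 := by
  cases h <;> simp [*, PC.rank]

theorem SimState.Ready.not_queued (h : s.Ready j v) : ¬ (s.pc j).Queued := by
  simp [PC.Queued, h.rank_eq_zero]

/-- `SimState.obtain` has an effect on this value: a message cannot be received by a simulated
process that has not started. -/
def SimState.Accepts (s : SimState n n' In Out M S) (j : Fin n') : SAVal n' In M → Prop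
  | .input _ => True
  | .msg _ => s.state j ≠ none

namespace SimState

theorem obtain_of_not_accepts (A : Algorithm n' In Out M S) (h : ¬ s.Accepts j v) :
    s.obtain A j v = s := by
  cases v with
  | input => exact absurd trivial h
  | msg m => simp [SimState.obtain, not_not.1 h]

theorem obtain_sa : (s.obtain A j v).sa = s.sa := by
  cases v <;> simp only [SimState.obtain] <;> grind [SimState.advance, SimState.goto]

theorem obtain_queue : (s.obtain A j v).queue = s.queue := by
  cases v <;> simp only [SimState.obtain] <;> grind [SimState.advance, SimState.goto]

theorem sent_prefix_obtain (x : Fin n') : s.sent x <+: (s.obtain A j v).sent x := by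
  cases v with
  | input => exact List.prefix_append _ _
  | msg m =>
    cases hst : s.state j <;> simp [SimState.obtain, SimState.advance, hst]

theorem obtain_pc (h : s.Accepts j v) :
    (s.obtain A j v).pc = Function.update s.pc j .waitMsg := by
  cases v with
  | input => rfl
  | msg m =>
    obtain ⟨st, hst⟩ := Option.ne_none_iff_exists'.1 h
    simp [SimState.obtain, SimState.advance, SimState.goto, hst]

theorem obtain_sn (h : s.Accepts j v) :
    (s.obtain A j v).sn = Function.update s.sn j (s.sn j + 1) := by
  cases v with
  | input => rfl
  | msg m =>
    obtain ⟨st, hst⟩ := Option.ne_none_iff_exists'.1 h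
    simp [SimState.obtain, SimState.advance, SimState.goto, hst]

theorem obtain_state_ne_none (h : s.Accepts j v) : (s.obtain A j v).state j ≠ none := by
  cases v with
  | input => simp [SimState.obtain, SimState.advance]
  | msg m =>
    obtain ⟨st, hst⟩ := Option.ne_none_iff_exists'.1 h
    simp [SimState.obtain, SimState.advance, hst]

theorem obtain_of_ne {x : Fin n'} (hx : x ≠ j) :
    (s.obtain A j v).sn x = s.sn x ∧ (s.obtain A j v).input x = s.input x ∧
      (s.obtain A j v).state x = s.state x ∧ (s.obtain A j v).received x = s.received x := by
  cases v with
  | input => simp [SimState.obtain, SimState.advance, SimState.goto, hx]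
  | msg m => cases hst : s.state j <;>
      simp [SimState.obtain, SimState.advance, SimState.goto, hx, hst]

end SimState

/-- A local step of a simulator `i` that has started, and the messages that it sends: the reception
of a message, where `inbox src` is the set of the messages sent to `i` by `src`, or a step of the
thread of some simulated process. -/
inductive LocalStep [LinearOrder (SAVal n' In M)] (A : Algorithm n' In Out M S) (i : Fin n)
    (inbox : Fin n → Set (NetMsg n n' In M)) (s : SimState n n' In Out M S) :
    SimState n n' In Out M S → (Fin n → List (NetMsg n n' In M)) → Prop
  | recv (src : Fin n) (o : Fin n' × ℕ) (m : SAMsg n (SAVal n' In M)) : (o, m) ∈ inbox src →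
      LocalStep A i inbox s { s with sa := Function.update s.sa o ((s.sa o).recv src m).1 }
        (fun q => (((s.sa o).recv src m).2 q).map fun a => (o, a))
  | stay : LocalStep A i inbox s s (fun _ => [])
  | enter (j : Fin n') (v : SAVal n' In M) : s.Ready j v →
      LocalStep A i inbox s (s.mutexIn j v) (fun _ => [])
  | lock (j : Fin n') (v : SAVal n' In M) : s.pc j = .lock v → s.queue.head? = some j →
      LocalStep A i inbox s (s.goto j (.waitValue v)) (fun _ => [((j, s.sn j), .value i v)])
  | waitValue (j : Fin n') (v : SAVal n' In M) : s.pc j = .waitValue v →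
      (s.sa (j, s.sn j)).Majority (.value i v) →
      LocalStep A i inbox s (s.goto j (.reading 0 fun _ => none))
        (fun _ => (List.finRange n).map fun x => ((j, s.sn j), .read i x))
  | read (j : Fin n') (x : Fin n) (w : Fin n → Option (SAVal n' In M))
      (r : Option (SAVal n' In M)) : s.pc j = .reading x w →
      (s.sa (j, s.sn j)).Majority (r.elim (.answer i x none) (.value x)) →
      LocalStep A i inbox s (s.goto j (.reading (x + 1) (Function.update w x r))) (fun _ => [])
  | readDone (j : Fin n') (k : ℕ) (w : Fin n → Option (SAVal n' In M)) : n ≤ k →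
      s.pc j = .reading k w →
      LocalStep A i inbox s (s.goto j (.waitView w)) (fun _ => [((j, s.sn j), .view i w)])
  | waitView (j : Fin n') (w : Fin n → Option (SAVal n' In M)) : s.pc j = .waitView w →
      (s.sa (j, s.sn j)).Majority (.view i w) →
      LocalStep A i inbox s { s.goto j .deciding with queue := s.queue.tail } (fun _ => [])
  | obtain (j : Fin n') (v : SAVal n' In M) : s.pc j = .deciding →
      (s.sa (j, s.sn j)).result = some v → s.Accepts j v →
      LocalStep A i inbox s (s.obtain A j v) (fun _ => [])

variable [LinearOrder (SAVal n' In M)] {i : Fin n}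
  {inbox : Fin n → Set (NetMsg n n' In M)} {out : Fin n → List (NetMsg n n' In M)}

theorem localStep_threadStep (A : Algorithm n' In Out M S) (i : Fin n) (j : Fin n')
    (inbox : Fin n → Set (NetMsg n n' In M)) (s : SimState n n' In Out M S) :
    LocalStep A i inbox s (threadStep A i j s).1 (threadStep A i j s).2 := by
  cases hpc : s.pc j with
  | begin => simp only [threadStep, hpc]; exact .enter j _ (.input hpc)
  | waitMsg =>
    cases hm : s.oldest j with
    | none => simp only [threadStep, hpc, hm]; exact .stay
    | some m => simp only [threadStep, hpc, hm]; exact .enter j _ (.msg m hpc hm)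
  | lock v =>
    simp only [threadStep, hpc]
    split_ifs with h
    exacts [.lock j v hpc h, .stay]
  | waitValue v =>
    simp only [threadStep, hpc]
    split_ifs with h
    exacts [.waitValue j v hpc h, .stay]
  | reading k w =>
    simp only [threadStep, hpc]
    split_ifs with hk hvalue hanswer
    exacts [.read j ⟨k, hk⟩ w (some _) hpc hvalue.choose_spec, .read j ⟨k, hk⟩ w none hpc hanswer,
      .stay, .readDone j k w (not_lt.1 hk) hpc]
  | waitView w =>
    simp only [threadStep, hpc]
    split_ifs with h
    exacts [.waitView j w hpc h, .stay]
  | deciding =>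
    cases hr : (s.sa (j, s.sn j)).result with
    | none => simp only [threadStep, hpc, hr]; exact .stay
    | some v =>
      simp only [threadStep, hpc, hr]
      by_cases hv : s.Accepts j v
      · exact .obtain j v hpc hr hv
      · rw [SimState.obtain_of_not_accepts A hv]; exact .stay

namespace LocalStep

theorem threadLE (h : LocalStep A i inbox s s' out) (a : Fin n') : s.ThreadLE s' a := by
  cases h with
  | recv | stay => exact .refl _ _
  | enter j _ hj =>
    refine .inr ⟨rfl, ?_⟩
    rcases eq_or_ne a j with rfl | ha
    · right; rw [hj.rank_eq_zero]; simp [SimState.mutexIn, SimState.goto, PC.rank]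
    · simp [SimState.mutexIn, SimState.goto, ha]
  | lock j _ hj | waitValue j _ hj | read j _ _ _ hj | readDone j _ _ _ hj | waitView j _ hj =>
    refine .inr ⟨rfl, ?_⟩
    rcases eq_or_ne a j with rfl | ha
    · right; simp [SimState.goto, hj, PC.rank] <;> omega
    · simp [SimState.goto, ha]
  | obtain j v hj _ hv =>
    rcases eq_or_ne a j with rfl | ha
    · left; simp [SimState.obtain_sn hv]
    · right; simp [SimState.obtain_sn hv, SimState.obtain_pc hv, ha]

theorem sn_le_succ (h : LocalStep A i inbox s s' out) (a : Fin n') : s'.sn a ≤ s.sn a + 1 := by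
  cases h with
  | obtain j v _ _ hv =>
    rcases eq_or_ne a j with rfl | ha <;> simp [SimState.obtain_sn hv, *]
  | _ => exact Nat.le_succ _

theorem pc_eq_waitMsg_of_sn_lt (h : LocalStep A i inbox s s' out) (hj : s.sn j < s'.sn j) :
    s'.pc j = .waitMsg := by
  cases h with
  | obtain a v _ _ hv =>
    rcases eq_or_ne j a with rfl | ha
    · simp [SimState.obtain_pc hv]
    · simp [SimState.obtain_sn hv, ha] at hj
  | _ => exact absurd hj (lt_irrefl _)

theorem sent_prefix (h : LocalStep A i inbox s s' out) (x : Fin n') :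
    s.sent x <+: s'.sent x := by
  cases h with
  | obtain => exact SimState.sent_prefix_obtain x
  | _ => exact List.prefix_rfl

theorem sa_eq_or_exists_recv (h : LocalStep A i inbox s s' out) :
    s'.sa = s.sa ∨ ∃ src o m, (o, m) ∈ inbox src ∧
      s'.sa = Function.update s.sa o ((s.sa o).recv src m).1 ∧
      out = fun q => (((s.sa o).recv src m).2 q).map fun a => (o, a) := by
  cases h with
  | recv src o m hm => exact .inr ⟨src, o, m, hm, rfl, rfl⟩
  | obtain => exact .inl SimState.obtain_sa
  | _ => exact .inl rfl

theorem log_subset (h : LocalStep A i inbox s s' out) (o : Fin n' × ℕ) :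
    (s.sa o).log ⊆ (s'.sa o).log := by
  rcases h.sa_eq_or_exists_recv with h | ⟨src, o', m, -, h, -⟩ <;> rw [h]
  rcases eq_or_ne o o' with rfl | ho
  · simp [SAState.recv_log]
  · simp [ho]

theorem consistent (h : LocalStep A i inbox s s' out) (hs : ∀ o, (s.sa o).Consistent)
    (o : Fin n' × ℕ) : (s'.sa o).Consistent := by
  rcases h.sa_eq_or_exists_recv with h | ⟨src, o', m, -, h, -⟩ <;> rw [h]
  · exact hs o
  · rcases eq_or_ne o o' with rfl | ho
    · simpa using (hs o).recv src m
    · simpa [ho] using hs o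

theorem lockInv (h : LocalStep A i inbox s s' out) (hs : LockInv s.queue s.pc) :
    LockInv s'.queue s'.pc := by
  cases h with
  | recv | stay => exact hs
  | enter j _ hj =>
    exact hs.append hj.not_queued (by simp [PC.Queued, PC.rank]; omega)
      (by simp [PC.Proposing, PC.rank])
  | lock j _ _ hhead => exact hs.update_head hhead (by simp [PC.Queued, PC.rank]; omega)
  | waitValue j _ hj | read j _ _ _ hj | readDone j _ _ _ hj =>
    have hhead := hs.head_of_proposing j (by simp [hj, PC.Proposing, PC.rank]; try omega)
    exact hs.update_head hhead (by simp [PC.Queued, PC.rank]; try omega)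
  | waitView j _ hj =>
    have hhead := hs.head_of_proposing j (by simp [hj, PC.Proposing, PC.rank]; omega)
    exact hs.tail hhead (by simp [PC.Queued, PC.rank])
  | obtain j v hj _ hv =>
    rw [SimState.obtain_queue, SimState.obtain_pc hv]
    exact hs.update_of_not_queued (by simp [hj, PC.Queued, PC.rank]) (by simp [PC.Queued, PC.rank])

end LocalStep

end Simulator

/-! ### Local invariants of a simulator -/

section LocalInvariants

variable {n n' : ℕ} {In Out M S : Type*} {s s' : SimState n n' In Out M S} {j : Fin n'}
  {i : Fin n} {input : Fin n' → In}

namespace SimState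

theorem goto_sn (s : SimState n n' In Out M S) (j : Fin n') (p : PC n (SAVal n' In M)) :
    (s.goto j p).sn = s.sn := rfl

theorem goto_pc (s : SimState n n' In Out M S) (j a : Fin n') (p : PC n (SAVal n' In M)) :
    (s.goto j p).pc a = if a = j then p else s.pc a :=
  Function.update_apply ..

theorem mutexIn_sn (s : SimState n n' In Out M S) (j : Fin n') (v : SAVal n' In M) :
    (s.mutexIn j v).sn = s.sn := rfl

theorem mutexIn_pc (s : SimState n n' In Out M S) (j a : Fin n') (v : SAVal n' In M) :
    (s.mutexIn j v).pc a = if a = j then .lock v else s.pc a :=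
  Function.update_apply ..

theorem obtain_pc_apply {A : Algorithm n' In Out M S} {v : SAVal n' In M} (a : Fin n')
    (h : s.Accepts j v) : (s.obtain A j v).pc a = if a = j then .waitMsg else s.pc a := by
  rw [obtain_pc h, Function.update_apply]

theorem obtain_sn_apply {A : Algorithm n' In Out M S} {v : SAVal n' In M} (a : Fin n')
    (h : s.Accepts j v) : (s.obtain A j v).sn a = if a = j then s.sn j + 1 else s.sn a := by
  rw [obtain_sn h, Function.update_apply]

theorem oldest_eq_some_of_isPrefix {m : SimMsg n' M} (hsent : s.sent j <+: s'.sent j)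
    (hreceived : s'.received j = s.received j) (h : s.oldest j = some m) :
    s'.oldest j = some m := by
  obtain ⟨l, hl⟩ := hsent
  simp only [SimState.oldest] at h ⊢
  rw [← hl, hreceived, List.find?_append, h, Option.some_or]

theorem mem_sent_of_oldest {m : SimMsg n' M} (h : s.oldest j = some m) : m ∈ s.sent j :=
  List.mem_of_find?_eq_some h

theorem not_mem_received_of_oldest {m : SimMsg n' M} (h : s.oldest j = some m) :
    m ∉ s.received j := by
  simpa using List.find?_some h

end SimState

/-- Invariants of the thread `j` of the simulator `i` with input vector `input`: what it proposes,
how the view under construction was obtained, and the safe agreement objects for which its value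
was received from a majority. -/
structure ThreadInv (input : Fin n' → In) (i : Fin n) (s : SimState n n' In Out M S)
    (j : Fin n') : Prop where
  sn_eq_zero : s.pc j = .begin → s.sn j = 0
  sn_pos : s.pc j = .waitMsg → 0 < s.sn j
  input_eq : s.sn j = 0 → s.input j = input j
  state_eq_none : s.sn j = 0 ↔ s.state j = none
  lock : ∀ v, s.pc j = .lock v → (s.sn j = 0 ∧ v = .input (input j)) ∨
    (0 < s.sn j ∧ ∃ m, v = .msg m ∧ s.oldest j = some m)
  reading : ∀ k w, s.pc j = .reading k w → ∀ x : Fin n, x.val < k →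
    (s.sa (j, s.sn j)).Majority ((w x).elim (.answer i x none) (.value x))
  value_majority : ∀ k, (k < s.sn j ∨ k = s.sn j ∧ 3 ≤ (s.pc j).rank) →
    ∃ v, (s.sa (j, k)).Majority (.value i v)

namespace ThreadInv

theorem initial (input : Fin n' → In) (i : Fin n) (j : Fin n') :
    ThreadInv input i (SimState.initial input : SimState n n' In Out M S) j := by
  constructor <;> simp [SimState.initial, PC.rank]

theorem congr (h : ThreadInv input i s j) (hpc : s'.pc j = s.pc j) (hsn : s'.sn j = s.sn j)
    (hinput : s'.input j = s.input j) (hstate : s'.state j = s.state j)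
    (hreceived : s'.received j = s.received j) (hsent : s.sent j <+: s'.sent j)
    (hlog : ∀ o, (s.sa o).log ⊆ (s'.sa o).log) : ThreadInv input i s' j where
  sn_eq_zero := by rw [hpc, hsn]; exact h.sn_eq_zero
  sn_pos := by rw [hpc, hsn]; exact h.sn_pos
  input_eq := by rw [hinput, hsn]; exact h.input_eq
  state_eq_none := by rw [hstate, hsn]; exact h.state_eq_none
  lock v hv := by
    rw [hsn]
    exact (h.lock v (hpc ▸ hv)).imp_right fun ⟨hpos, m, hm, hold⟩ =>
      ⟨hpos, m, hm, SimState.oldest_eq_some_of_isPrefix hsent hreceived hold⟩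
  reading k w hw x hx := by
    rw [hsn]
    exact (h.reading k w (hpc ▸ hw) x hx).mono (hlog _)
  value_majority k hk := by
    rw [hpc, hsn] at hk
    exact (h.value_majority k hk).imp fun _ hv => hv.mono (hlog _)

theorem mutexIn {v : SAVal n' In M} (h : ThreadInv input i s j) (hv : s.Ready j v) :
    ThreadInv input i (s.mutexIn j v) j where
  sn_eq_zero := by simp [SimState.mutexIn, SimState.goto]
  sn_pos := by simp [SimState.mutexIn, SimState.goto]
  input_eq := h.input_eq
  state_eq_none := h.state_eq_none
  lock u hu := by
    obtain rfl : v = u := by simpa [SimState.mutexIn, SimState.goto] using hu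
    cases hv with
    | input hpc =>
      have hsn := h.sn_eq_zero hpc
      exact .inl ⟨hsn, by rw [h.input_eq hsn]⟩
    | msg m hpc hold => exact .inr ⟨h.sn_pos hpc, m, rfl, hold⟩
  reading := by simp [SimState.mutexIn, SimState.goto]
  value_majority k hk := h.value_majority k
    (hk.imp_right fun hk => by simp [SimState.mutexIn, SimState.goto, PC.rank] at hk)

theorem goto {p : PC n (SAVal n' In M)} (h : ThreadInv input i s j) (hp : 2 ≤ p.rank)
    (hreading : ∀ k w, p = .reading k w → ∀ x : Fin n, x.val < k →
      (s.sa (j, s.sn j)).Majority ((w x).elim (.answer i x none) (.value x)))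
    (hvalue : 3 ≤ p.rank → ∃ v, (s.sa (j, s.sn j)).Majority (.value i v)) :
    ThreadInv input i (s.goto j p) j where
  sn_eq_zero hpc := by
    obtain rfl : p = .begin := by simpa [SimState.goto] using hpc
    simp [PC.rank] at hp
  sn_pos hpc := by
    obtain rfl : p = .waitMsg := by simpa [SimState.goto] using hpc
    simp [PC.rank] at hp
  input_eq := h.input_eq
  state_eq_none := h.state_eq_none
  lock v hpc := by
    obtain rfl : p = .lock v := by simpa [SimState.goto] using hpc
    simp [PC.rank] at hp
  reading k w hpc := hreading k w (by simpa [SimState.goto] using hpc)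
  value_majority k hk := by
    rcases hk with hk | ⟨rfl, hk⟩
    · exact h.value_majority k (.inl hk)
    · exact hvalue (by simpa [SimState.goto] using hk)

theorem obtain {A : Algorithm n' In Out M S} {v : SAVal n' In M} (h : ThreadInv input i s j)
    (hpc : s.pc j = .deciding) (hv : s.Accepts j v) : ThreadInv input i (s.obtain A j v) j where
  sn_eq_zero := by simp [SimState.obtain_pc hv]
  sn_pos := by simp [SimState.obtain_sn hv]
  input_eq := by simp [SimState.obtain_sn hv]
  state_eq_none := by simp [SimState.obtain_sn hv, SimState.obtain_state_ne_none hv]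
  lock := by simp [SimState.obtain_pc hv]
  reading := by simp [SimState.obtain_pc hv]
  value_majority k hk := by
    rw [SimState.obtain_sa]
    refine h.value_majority k ?_
    simp only [SimState.obtain_pc hv, SimState.obtain_sn hv, Function.update_self, PC.rank] at hk
    simp only [hpc, PC.rank]
    omega

end ThreadInv

variable [LinearOrder (SAVal n' In M)] {A : Algorithm n' In Out M S}
  {inbox : Fin n → Set (NetMsg n n' In M)} {out : Fin n → List (NetMsg n n' In M)}

namespace LocalStep

theorem threadInv_of_move (h : LocalStep A i inbox s s' out) (hs : ThreadInv input i s j)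
    (hmove : s'.pc j ≠ s.pc j) : ThreadInv input i s' j := by
  cases h with
  | recv | stay => exact absurd rfl hmove
  | enter a v hready =>
    obtain rfl : j = a := by by_contra ha; simp [SimState.mutexIn, SimState.goto, ha] at hmove
    exact hs.mutexIn hready
  | obtain a v ha _ hv =>
    obtain rfl : j = a := by by_contra ha; simp [SimState.obtain_pc hv, ha] at hmove
    exact hs.obtain ha hv
  | lock a v ha =>
    obtain rfl : j = a := by by_contra ha; simp [SimState.goto, ha] at hmove
    exact hs.goto (by simp [PC.rank]) (by simp) (by simp [PC.rank])
  | waitValue a v ha hmaj =>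
    obtain rfl : j = a := by by_contra ha; simp [SimState.goto, ha] at hmove
    exact hs.goto (by simp [PC.rank]) (by simp) fun _ => ⟨v, hmaj⟩
  | read a x w r ha hmaj =>
    obtain rfl : j = a := by by_contra ha; simp [SimState.goto, ha] at hmove
    refine hs.goto (by simp [PC.rank]; omega) (fun k w' hp y hy => ?_)
      fun _ => hs.value_majority _ (.inr ⟨rfl, by simp [ha, PC.rank]⟩)
    obtain ⟨rfl, rfl⟩ := PC.reading.inj hp
    rcases eq_or_ne y x with rfl | hyx
    · simpa using hmaj
    · simpa [hyx] using hs.reading x w ha y (by omega)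
  | readDone a _ _ _ ha =>
    obtain rfl : j = a := by by_contra ha; simp [SimState.goto, ha] at hmove
    exact hs.goto (by simp [PC.rank]; omega) (by simp)
      fun _ => hs.value_majority _ (.inr ⟨rfl, by simp [ha, PC.rank]⟩)
  | waitView a _ ha =>
    obtain rfl : j = a := by by_contra ha; simp [SimState.goto, ha] at hmove
    exact (hs.goto (p := .deciding) (by simp [PC.rank]; omega) (by simp)
      fun _ => hs.value_majority _ (.inr ⟨rfl, by simp [ha, PC.rank]; omega⟩)).congr
        rfl rfl rfl rfl rfl List.prefix_rfl fun _ => subset_rfl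

theorem threadInv (h : LocalStep A i inbox s s' out) (hs : ThreadInv input i s j) :
    ThreadInv input i s' j := by
  by_cases hmove : s'.pc j = s.pc j
  · obtain ⟨hsn, hinput, hstate, hreceived⟩ : s'.sn j = s.sn j ∧ s'.input j = s.input j ∧
        s'.state j = s.state j ∧ s'.received j = s.received j := by
      cases h with
      | obtain a v ha _ hv =>
        obtain hja : j ≠ a := by rintro rfl; simp [SimState.obtain_pc hv, ha] at hmove
        exact SimState.obtain_of_ne hja
      | _ => exact ⟨rfl, rfl, rfl, rfl⟩
    exact hs.congr hmove hsn hinput hstate hreceived (h.sent_prefix j) h.log_subset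
  · exact h.threadInv_of_move hs hmove

theorem value_mem_out_of_pc (h : LocalStep A i inbox s s' out) {v : SAVal n' In M}
    (hj : s'.pc j = .waitValue v) :
    (s.pc j = .waitValue v ∧ s'.sn j = s.sn j) ∨ ∀ p, ((j, s'.sn j), .value i v) ∈ out p := by
  cases h <;> grind [SimState.mutexIn_pc, SimState.mutexIn_sn, SimState.goto_pc, SimState.goto_sn,
    SimState.obtain_pc_apply, SimState.obtain_sn_apply]

theorem read_mem_out_of_pc (h : LocalStep A i inbox s s' out) {k : ℕ}
    {w : Fin n → Option (SAVal n' In M)} (hj : s'.pc j = .reading k w) :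
    ((∃ k' w', s.pc j = .reading k' w') ∧ s'.sn j = s.sn j) ∨
      ∀ x p, ((j, s'.sn j), .read i x) ∈ out p := by
  cases h <;> grind [SimState.mutexIn_pc, SimState.mutexIn_sn, SimState.goto_pc, SimState.goto_sn,
    SimState.obtain_pc_apply, SimState.obtain_sn_apply]

theorem view_mem_out_of_pc (h : LocalStep A i inbox s s' out)
    {w : Fin n → Option (SAVal n' In M)} (hj : s'.pc j = .waitView w) :
    (s.pc j = .waitView w ∧ s'.sn j = s.sn j) ∨ ∀ p, ((j, s'.sn j), .view i w) ∈ out p := by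
  cases h <;> grind [SimState.mutexIn_pc, SimState.mutexIn_sn, SimState.goto_pc, SimState.goto_sn,
    SimState.obtain_pc_apply, SimState.obtain_sn_apply]

end LocalStep

/-- In the state `s` the view for the object `o` has been broadcast. -/
def SimState.Viewed (s : SimState n n' In Out M S) (o : Fin n' × ℕ) : Prop :=
  o.2 < s.sn o.1 ∨ o.2 = s.sn o.1 ∧ 4 + n ≤ (s.pc o.1).rank

namespace LocalStep

theorem view_mem_out_of_viewed (h : LocalStep A i inbox s s' out) {o : Fin n' × ℕ}
    (ho : s'.Viewed o) : s.Viewed o ∨ ∃ w, ∀ p, (o, .view i w) ∈ out p := by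
  unfold SimState.Viewed at *
  cases h with
  | readDone j _ w =>
    by_cases hmem : o = (j, s.sn j)
    · exact .inr ⟨w, fun _ => by simp [hmem]⟩
    · grind [SimState.goto_pc, SimState.goto_sn]
  | _ => grind [SimState.mutexIn_pc, SimState.mutexIn_sn, SimState.goto_pc, SimState.goto_sn,
      SimState.obtain_pc_apply, SimState.obtain_sn_apply, PC.rank]

theorem mem_log_or_exists_recv (h : LocalStep A i inbox s s' out) {o : Fin n' × ℕ} {q : Fin n}
    {m : SAMsg n (SAVal n' In M)} (hm : (q, m) ∈ (s'.sa o).log) :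
    (q, m) ∈ (s.sa o).log ∨ (o, m) ∈ inbox q ∧
      out = fun p => (((s.sa o).recv q m).2 p).map fun a => (o, a) := by
  rcases h.sa_eq_or_exists_recv with h | ⟨src, o', m', hmem, h, hout⟩
  · exact .inl (h ▸ hm)
  rw [h] at hm
  rcases eq_or_ne o o' with rfl | ho
  · simp only [Function.update_self, SAState.recv_log, Set.mem_insert_iff, Prod.mk.injEq] at hm
    rcases hm with ⟨rfl, rfl⟩ | hm
    exacts [.inr ⟨hmem, hout⟩, .inl hm]
  · exact .inl (by simpa [ho] using hm)

theorem mem_log_or_value_mem_out (h : LocalStep A i inbox s s' out) {o : Fin n' × ℕ}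
    {q x : Fin n} {v : SAVal n' In M} (hm : (q, .value x v) ∈ (s'.sa o).log) :
    (∃ q', (q', .value x v) ∈ (s.sa o).log) ∨ ∀ p, (o, .value x v) ∈ out p := by
  by_cases hold : ∃ q', (q', .value x v) ∈ (s.sa o).log
  · exact .inl hold
  · rcases h.mem_log_or_exists_recv hm with hm | ⟨-, rfl⟩
    exacts [.inl ⟨q, hm⟩, .inr fun p => by simp [SAState.recv, hold]]

theorem mem_log_or_view_mem_out (h : LocalStep A i inbox s s' out) {o : Fin n' × ℕ}
    {q x : Fin n} {w : Fin n → Option (SAVal n' In M)} (hm : (q, .view x w) ∈ (s'.sa o).log) :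
    (∃ q', (q', .view x w) ∈ (s.sa o).log) ∨ ∀ p, (o, .view x w) ∈ out p := by
  by_cases hold : ∃ q', (q', .view x w) ∈ (s.sa o).log
  · exact .inl hold
  · rcases h.mem_log_or_exists_recv hm with hm | ⟨-, rfl⟩
    exacts [.inl ⟨q, hm⟩, .inr fun p => by simp [SAState.recv, hold]]

theorem mem_log_or_answer_mem_out (h : LocalStep A i inbox s s' out) {o : Fin n' × ℕ}
    {q x y : Fin n} (hm : (q, .read y x) ∈ (s'.sa o).log) :
    (∃ q', (q', .read y x) ∈ (s.sa o).log) ∨ (o, .answer y x ((s.sa o).values x)) ∈ out y := by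
  by_cases hold : ∃ q', (q', .read y x) ∈ (s.sa o).log
  · exact .inl hold
  · rcases h.mem_log_or_exists_recv hm with hm | ⟨-, rfl⟩
    exacts [.inl ⟨q, hm⟩, .inr (by simp [SAState.recv, hold])]

variable {o : Fin n' × ℕ} {p x y : Fin n}

theorem of_value_mem_out (h : LocalStep A i inbox s s' out) {v : SAVal n' In M}
    (hm : (o, .value x v) ∈ out p) :
    (x = i ∧ s.sn o.1 = o.2 ∧ s.pc o.1 = .lock v ∧ s.queue.head? = some o.1) ∨
      ∃ src, (o, .value x v) ∈ inbox src ∧ (src, .value x v) ∈ (s'.sa o).log := by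
  cases h with
  | recv src o' m hmem =>
    simp only [List.mem_map, Prod.mk.injEq] at hm
    obtain ⟨a, ha, rfl, rfl⟩ := hm
    simp only [SAState.recv] at ha
    have hlog := (s.sa o').recv_log src m
    split_ifs at ha <;> cases m <;> grind
  | lock j v hj hhead => grind
  | _ => simp at hm

theorem of_view_mem_out (h : LocalStep A i inbox s s' out)
    {w : Fin n → Option (SAVal n' In M)} (hm : (o, .view x w) ∈ out p) :
    (x = i ∧ s.sn o.1 = o.2 ∧ ∃ k, n ≤ k ∧ s.pc o.1 = .reading k w) ∨
      ∃ src, (o, .view x w) ∈ inbox src := by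
  cases h with
  | recv src o' m hmem =>
    simp only [List.mem_map, Prod.mk.injEq] at hm
    obtain ⟨a, ha, rfl, rfl⟩ := hm
    simp only [SAState.recv] at ha
    split_ifs at ha <;> cases m <;> grind
  | readDone j k w hk hj => grind
  | _ => simp at hm

theorem of_read_mem_out (h : LocalStep A i inbox s s' out) (hm : (o, .read y x) ∈ out p) :
    y = i ∧ ∃ v, (s.sa o).Majority (.value i v) := by
  cases h with
  | recv src o' m hmem =>
    simp only [List.mem_map, Prod.mk.injEq] at hm
    obtain ⟨a, ha, rfl, rfl⟩ := hm
    simp only [SAState.recv] at ha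
    split_ifs at ha <;> cases m <;> grind
  | waitValue j v hj hmaj => grind
  | _ => simp at hm

theorem of_answer_mem_out (h : LocalStep A i inbox s s' out) {r : Option (SAVal n' In M)}
    (hm : (o, .answer y x r) ∈ out p) :
    (s.sa o).values x = r ∧ ∃ src, (o, .read y x) ∈ inbox src := by
  cases h with
  | recv src o' m hmem =>
    simp only [List.mem_map, Prod.mk.injEq] at hm
    obtain ⟨a, ha, rfl, rfl⟩ := hm
    simp only [SAState.recv] at ha
    split_ifs at ha <;> cases m <;> grind
  | _ => simp at hm

end LocalStep

end LocalInvariants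

/-! ### Executions of the simulation -/

/-- The messages sent to `p` so far, by sender. -/
def Config.inbox {n : ℕ} {M S : Type*} (c : Config n M S) (p : Fin n) (src : Fin n) : Set M :=
  {m | m ∈ c.chan src p}

/-- The messages sent by `p` so far, by destination. -/
def Config.outbox {n : ℕ} {M S : Type*} (c : Config n M S) (p : Fin n) (dst : Fin n) : Set M :=
  {m | m ∈ c.chan p dst}

/-- A simulator in the state `s` can be in the state `s'` later on: its threads have only gone
forward, and its simulated messages and its logs have only grown. -/
structure SimState.Later {n n' : ℕ} {In Out M S : Type*} (s s' : SimState n n' In Out M S) :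
    Prop where
  threadLE : ∀ j, s.ThreadLE s' j
  sent : ∀ x, s.sent x <+: s'.sent x
  log : ∀ o, (s.sa o).log ⊆ (s'.sa o).log

namespace SimState.Later

variable {n n' : ℕ} {In Out M S : Type*} {s s' s'' : SimState n n' In Out M S}

theorem refl (s : SimState n n' In Out M S) : s.Later s :=
  ⟨fun j => .refl s j, fun _ => List.prefix_rfl, fun _ => subset_rfl⟩

theorem trans (h : s.Later s') (h' : s'.Later s'') : s.Later s'' :=
  ⟨fun j => (h.threadLE j).trans (h'.threadLE j), fun x => (h.sent x).trans (h'.sent x),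
    fun o => (h.log o).trans (h'.log o)⟩

theorem pc_eq_of_rank_eq (h : s.Later s') {j : Fin n'} (hsn : s.sn j = s'.sn j)
    (hrank : (s.pc j).rank = (s'.pc j).rank) : s'.pc j = s.pc j := by
  rcases h.threadLE j with h | ⟨-, h | h⟩
  exacts [absurd hsn h.ne, h, absurd hrank h.ne]

end SimState.Later

section SimulatorExecutions

variable {n n' t : ℕ} {In Out M S : Type*} [LinearOrder (SAVal n' In M)]
  {A : Algorithm n' In Out M S} {inp : Fin n → Fin n' → In} {e : SimTrace n n' In Out M S}
  {i : Fin n} {τ τ' : ℕ} {s s' : SimState n n' In Out M S}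

theorem LocalStep.later {inbox : Fin n → Set (NetMsg n n' In M)}
    {out : Fin n → List (NetMsg n n' In M)} (h : LocalStep A i inbox s s' out) : s.Later s' :=
  ⟨h.threadLE, h.sent_prefix, h.log_subset⟩

theorem initial_or_localStep_of_effect {c : Config n (NetMsg n n' In M) (SimState n n' In Out M S)}
    {p : Fin n} {ev : Event n (Fin n')} {out : Fin n → List (NetMsg n n' In M)}
    (h : (simulation n A).effect inp c p ev = some (s', out)) :
    (c.loc p = none ∧ s' = SimState.initial (inp p) ∧ out = fun _ => []) ∨
      ∃ s, c.loc p = some s ∧ LocalStep A p (c.inbox p) s s' out := by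
  cases ev with
  | start =>
    obtain ⟨hnone, h⟩ := Protocol.effect_start_eq_some.1 h
    exact .inl ⟨hnone, (Prod.mk.inj h).1.symm, (Prod.mk.inj h).2.symm⟩
  | recv q k =>
    obtain ⟨-, s, m, hs, hm, h⟩ := Protocol.effect_recv_eq_some.1 h
    obtain ⟨rfl, rfl⟩ := Prod.mk.inj h
    exact .inr ⟨s, hs, .recv q m.1 m.2 (List.mem_of_getElem? hm)⟩
  | tick θ =>
    obtain ⟨s, hs, h⟩ := Protocol.effect_tick_eq_some.1 h
    have hstep := localStep_threadStep A p θ (c.inbox p) s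
    exact .inr ⟨s, hs, by rwa [show threadStep A p θ s = (s', out) from h] at hstep⟩

namespace IsExecution

theorem loc_succ_cases (he : IsExecution (simulation n A) inp t e) (τ : ℕ) (i : Fin n) :
    (e.cfg (τ + 1)).loc i = (e.cfg τ).loc i ∨
    ((e.cfg τ).loc i = none ∧ (e.cfg (τ + 1)).loc i = some (SimState.initial (inp i))) ∨
    ∃ s s' out, (e.cfg τ).loc i = some s ∧ (e.cfg (τ + 1)).loc i = some s' ∧
      LocalStep A i ((e.cfg τ).inbox i) s s' out ∧
      ∀ p, (e.cfg (τ + 1)).chan i p = (e.cfg τ).chan i p ++ out p := by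
  rcases (he.step τ).loc_eq_or_exists_effect i with h | ⟨ev, s', out, -, heff, hs', hchan⟩
  · exact .inl h
  · rcases initial_or_localStep_of_effect heff with ⟨hnone, rfl, rfl⟩ | ⟨s, hs, hstep⟩
    · exact .inr (.inl ⟨hnone, hs'⟩)
    · exact .inr (.inr ⟨s, s', out, hs, hs', hstep, hchan⟩)

theorem exists_localStep_of_mem_chan (he : IsExecution (simulation n A) inp t e) {q p : Fin n}
    {m : NetMsg n n' In M} (hm : m ∈ (e.cfg τ).chan q p) :
    ∃ u < τ, ∃ s s' out, q ∉ (e.cfg u).crashed ∧ (e.cfg u).loc q = some s ∧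
      LocalStep A q ((e.cfg u).inbox q) s s' out ∧ m ∈ out p ∧
      (q ∈ (e.cfg (u + 1)).crashed ∨ (e.cfg (u + 1)).loc q = some s') := by
  obtain ⟨u, hu, ev, s', out, halive, heff, hmem, hend⟩ := he.exists_effect_of_mem_chan hm
  rcases initial_or_localStep_of_effect heff with ⟨-, -, rfl⟩ | ⟨s, hs, hstep⟩
  · simp at hmem
  · exact ⟨u, hu, s, s', out, halive, hs, hstep, hmem, hend⟩

theorem exists_later (he : IsExecution (simulation n A) inp t e) (h : τ ≤ τ')
    (hs : (e.cfg τ).loc i = some s) : ∃ s', (e.cfg τ').loc i = some s' ∧ s.Later s' := by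
  induction h with
  | refl => exact ⟨s, hs, .refl s⟩
  | @step u _ ih =>
    obtain ⟨s₁, hs₁, hlater⟩ := ih
    rcases he.loc_succ_cases u i with h | ⟨h, -⟩ | ⟨a, b, out, ha, hb, hstep, -⟩
    · exact ⟨s₁, h.trans hs₁, hlater⟩
    · simp [h] at hs₁
    · obtain rfl : a = s₁ := by simpa [ha] using hs₁
      exact ⟨b, hb, hlater.trans hstep.later⟩

theorem later (he : IsExecution (simulation n A) inp t e) (h : τ ≤ τ')
    (hs : (e.cfg τ).loc i = some s) (hs' : (e.cfg τ').loc i = some s') : s.Later s' := by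
  obtain ⟨s₁, hs₁, hlater⟩ := he.exists_later h hs
  obtain rfl : s₁ = s' := by simpa [hs₁] using hs'
  exact hlater

theorem later_total (he : IsExecution (simulation n A) inp t e)
    (hs : (e.cfg τ).loc i = some s) (hs' : (e.cfg τ').loc i = some s') :
    s.Later s' ∨ s'.Later s :=
  (le_total τ τ').imp (he.later · hs hs') (he.later · hs' hs)

theorem loc_induction (he : IsExecution (simulation n A) inp t e)
    (Φ : SimState n n' In Out M S → (Fin n → Set (NetMsg n n' In M)) →
      (Fin n → Set (NetMsg n n' In M)) → Prop)
    (init : ∀ C D, Φ (SimState.initial (inp i)) C D)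
    (step : ∀ s s' C C' D D' out, Φ s C D → LocalStep A i C s s' out → (∀ p, C p ⊆ C' p) →
      (∀ p, D p ⊆ D' p) → (∀ p, ∀ m ∈ out p, m ∈ D' p) → Φ s' C' D')
    (hs : (e.cfg τ).loc i = some s) : Φ s ((e.cfg τ).inbox i) ((e.cfg τ).outbox i) := by
  induction τ generalizing s with
  | zero => simp [he.init, Config.initial] at hs
  | succ τ ih =>
    have hC : ∀ p, (e.cfg τ).inbox i p ⊆ (e.cfg (τ + 1)).inbox i p :=
      fun p m hm => ((he.step τ).chan_prefix p i).subset hm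
    have hD : ∀ p, (e.cfg τ).outbox i p ⊆ (e.cfg (τ + 1)).outbox i p :=
      fun p m hm => ((he.step τ).chan_prefix i p).subset hm
    rcases he.loc_succ_cases τ i with h | ⟨-, h⟩ | ⟨a, b, out, ha, hb, hstep, hchan⟩
    · exact step s s _ _ _ _ _ (ih (h ▸ hs)) .stay hC hD (by simp)
    · obtain rfl : SimState.initial (inp i) = s := by simpa [h] using hs
      exact init _ _
    · obtain rfl : b = s := by simpa [hb] using hs
      exact step a b _ _ _ _ out (ih ha) hstep hC hD fun p m hm => by
        simp [Config.outbox, hchan p, hm]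

theorem consistent (he : IsExecution (simulation n A) inp t e) (hs : (e.cfg τ).loc i = some s)
    (o : Fin n' × ℕ) : (s.sa o).Consistent :=
  he.loc_induction (fun s _ _ => ∀ o, (s.sa o).Consistent)
    (fun _ _ _ => SAState.consistent_initial) (fun _ _ _ _ _ _ _ h hl _ _ _ => hl.consistent h) hs o

theorem lockInv (he : IsExecution (simulation n A) inp t e) (hs : (e.cfg τ).loc i = some s) :
    LockInv s.queue s.pc :=
  he.loc_induction (fun s _ _ => LockInv s.queue s.pc)
    (fun _ _ => by
      constructor <;> simp [SimState.initial, PC.Queued, PC.Proposing, PC.rank])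
    (fun _ _ _ _ _ _ _ h hl _ _ _ => hl.lockInv h) hs

theorem threadInv (he : IsExecution (simulation n A) inp t e) (hs : (e.cfg τ).loc i = some s)
    (j : Fin n') : ThreadInv (inp i) i s j :=
  he.loc_induction (fun s _ _ => ThreadInv (inp i) i s j) (fun _ _ => ThreadInv.initial _ _ j)
    (fun _ _ _ _ _ _ _ h hl _ _ _ => hl.threadInv h) hs

variable {o : Fin n' × ℕ} {j : Fin n'} {q x y : Fin n}

theorem mem_chan_of_mem_log (he : IsExecution (simulation n A) inp t e)
    (hs : (e.cfg τ).loc i = some s) {m : SAMsg n (SAVal n' In M)} (hm : (q, m) ∈ (s.sa o).log) :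
    (o, m) ∈ (e.cfg τ).chan q i := by
  refine he.loc_induction (fun s C _ => (q, m) ∈ (s.sa o).log → (o, m) ∈ C q) ?_ ?_ hs hm
  · intro _ _ h
    simp [SimState.initial, SAState.initial] at h
  · intro s s' C C' D D' out h hl hC _ _ hm
    rcases hl.mem_log_or_exists_recv hm with hm | ⟨hm, -⟩
    exacts [hC _ (h hm), hC _ hm]

theorem value_mem_chan_of_mem_log (he : IsExecution (simulation n A) inp t e)
    (hs : (e.cfg τ).loc i = some s) {v : SAVal n' In M} (hm : (q, .value x v) ∈ (s.sa o).log)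
    (p : Fin n) : (o, .value x v) ∈ (e.cfg τ).chan i p := by
  refine he.loc_induction (fun s _ D => ∀ q, (q, .value x v) ∈ (s.sa o).log →
    ∀ p, (o, .value x v) ∈ D p) ?_ ?_ hs q hm p
  · intro _ _ q h
    simp [SimState.initial, SAState.initial] at h
  · intro s s' C C' D D' out h hl _ hD hout q hm p
    rcases hl.mem_log_or_value_mem_out hm with ⟨q', hm⟩ | hm
    exacts [hD _ (h q' hm p), hout _ _ (hm p)]

theorem view_mem_chan_of_mem_log (he : IsExecution (simulation n A) inp t e)
    (hs : (e.cfg τ).loc i = some s) {w : Fin n → Option (SAVal n' In M)}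
    (hm : (q, .view x w) ∈ (s.sa o).log) (p : Fin n) : (o, .view x w) ∈ (e.cfg τ).chan i p := by
  refine he.loc_induction (fun s _ D => ∀ q, (q, .view x w) ∈ (s.sa o).log →
    ∀ p, (o, .view x w) ∈ D p) ?_ ?_ hs q hm p
  · intro _ _ q h
    simp [SimState.initial, SAState.initial] at h
  · intro s s' C C' D D' out h hl _ hD hout q hm p
    rcases hl.mem_log_or_view_mem_out hm with ⟨q', hm⟩ | hm
    exacts [hD _ (h q' hm p), hout _ _ (hm p)]

theorem answer_mem_chan_or_exists_value (he : IsExecution (simulation n A) inp t e)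
    (hs : (e.cfg τ).loc i = some s) (hm : (q, .read y x) ∈ (s.sa o).log) :
    (o, .answer y x none) ∈ (e.cfg τ).chan i y ∨ ∃ q v, (q, .value x v) ∈ (s.sa o).log := by
  refine (he.loc_induction (fun s _ D => (∀ o, (s.sa o).Consistent) ∧
    ∀ q, (q, .read y x) ∈ (s.sa o).log →
      (o, .answer y x none) ∈ D y ∨ ∃ q v, (q, .value x v) ∈ (s.sa o).log) ?_ ?_ hs).2 q hm
  · refine fun _ _ => ⟨fun _ => SAState.consistent_initial, fun q h => ?_⟩
    simp [SimState.initial, SAState.initial] at h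
  · intro s s' C C' D D' out h hl _ hD hout
    refine ⟨hl.consistent h.1, fun q hm => ?_⟩
    rcases hl.mem_log_or_answer_mem_out hm with ⟨q', hm⟩ | hm
    · exact (h.2 q' hm).imp (@hD _ _) fun ⟨q, v, hv⟩ => ⟨q, v, hl.log_subset o hv⟩
    · cases hv : (s.sa o).values x with
      | none => exact .inl (hout _ _ (hv ▸ hm))
      | some v =>
        obtain ⟨q, hq⟩ := (h.1 o).exists_value_mem x v hv
        exact .inr ⟨q, v, hl.log_subset o hq⟩

theorem value_mem_chan_of_pc (he : IsExecution (simulation n A) inp t e)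
    (hs : (e.cfg τ).loc i = some s) {v : SAVal n' In M} (hj : s.pc j = .waitValue v)
    (p : Fin n) : ((j, s.sn j), .value i v) ∈ (e.cfg τ).chan i p := by
  refine he.loc_induction (fun s _ D => s.pc j = .waitValue v →
    ∀ p, ((j, s.sn j), .value i v) ∈ D p) ?_ ?_ hs hj p
  · intro _ _ h
    simp [SimState.initial] at h
  · intro s s' C C' D D' out h hl _ hD hout hj p
    rcases hl.value_mem_out_of_pc hj with ⟨hj', hsn⟩ | hm
    exacts [hsn ▸ hD _ (h hj' p), hout _ _ (hm p)]

theorem read_mem_chan_of_pc (he : IsExecution (simulation n A) inp t e)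
    (hs : (e.cfg τ).loc i = some s) {k : ℕ} {w : Fin n → Option (SAVal n' In M)}
    (hj : s.pc j = .reading k w) (x p : Fin n) :
    ((j, s.sn j), .read i x) ∈ (e.cfg τ).chan i p := by
  refine he.loc_induction (fun s _ D => ∀ k w, s.pc j = .reading k w →
    ∀ x p, ((j, s.sn j), .read i x) ∈ D p) ?_ ?_ hs k w hj x p
  · intro _ _ k w h
    simp [SimState.initial] at h
  · intro s s' C C' D D' out h hl _ hD hout k w hj x p
    rcases hl.read_mem_out_of_pc hj with ⟨⟨k', w', hj'⟩, hsn⟩ | hm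
    exacts [hsn ▸ hD _ (h k' w' hj' x p), hout _ _ (hm x p)]

theorem view_mem_chan_of_pc (he : IsExecution (simulation n A) inp t e)
    (hs : (e.cfg τ).loc i = some s) {w : Fin n → Option (SAVal n' In M)}
    (hj : s.pc j = .waitView w) (p : Fin n) :
    ((j, s.sn j), .view i w) ∈ (e.cfg τ).chan i p := by
  refine he.loc_induction (fun s _ D => s.pc j = .waitView w →
    ∀ p, ((j, s.sn j), .view i w) ∈ D p) ?_ ?_ hs hj p
  · intro _ _ h
    simp [SimState.initial] at h
  · intro s s' C C' D D' out h hl _ hD hout hj p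
    rcases hl.view_mem_out_of_pc hj with ⟨hj', hsn⟩ | hm
    exacts [hsn ▸ hD _ (h hj' p), hout _ _ (hm p)]

theorem exists_view_mem_chan_of_viewed (he : IsExecution (simulation n A) inp t e)
    (hs : (e.cfg τ).loc i = some s) (ho : s.Viewed o) :
    ∃ w, ∀ p, (o, .view i w) ∈ (e.cfg τ).chan i p := by
  refine he.loc_induction (fun s _ D => s.Viewed o → ∃ w, ∀ p, (o, .view i w) ∈ D p) ?_ ?_ hs ho
  · intro _ _ h
    simp [SimState.initial, SimState.Viewed, PC.rank] at h
  · intro s s' C C' D D' out h hl _ hD hout ho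
    rcases hl.view_mem_out_of_viewed ho with ho' | ⟨w, hm⟩
    · exact (h ho').imp fun w hm p => hD _ (hm p)
    · exact ⟨w, fun p => hout _ _ (hm p)⟩

end IsExecution

end SimulatorExecutions

/-! ### Agreement and validity of the safe agreement objects -/

section Agreement

namespace SAState

variable {n : ℕ} {V : Type*} [LinearOrder V] {a : SAState n V} {r : V}

theorem returns_of_result_eq_some (h : a.result = some r) : a.Returns r := by
  unfold result at h
  split_ifs at h with hr
  exact Option.some.inj h ▸ hr.choose_spec

theorem exists_returns_of_closed {σ : Finset (Fin n)} (h : a.Closed σ) : ∃ r, a.Returns r := by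
  classical
  obtain ⟨σ', hσ', hmin⟩ := Finset.exists_min_image (Finset.univ.filter a.Closed) Finset.card
    ⟨σ, by simpa using h⟩
  simp only [Finset.mem_filter, Finset.mem_univ, true_and] at hσ' hmin
  obtain ⟨y, hy⟩ := hσ'.1
  obtain ⟨v, hv⟩ := Option.ne_none_iff_exists'.1 (hσ'.2 y hy).1
  have hfin : {v | ∃ y ∈ σ', a.values y = some v}.Finite :=
    (Finset.finite_toSet (σ'.image a.values).eraseNone).subset fun v ⟨y, hy, hv⟩ => by
      simpa using ⟨y, hy, hv⟩
  obtain ⟨r, hr, hle⟩ := Set.exists_min_image _ id hfin ⟨v, y, hy, hv⟩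
  exact ⟨r, σ', hσ', hmin, hr, fun b hb => hle b hb⟩

theorem result_ne_none_of_closed {σ : Finset (Fin n)} (h : a.Closed σ) : a.result ≠ none := by
  simp [result, exists_returns_of_closed h]

end SAState

/-- Before time `τ`, the simulator `x` was about to broadcast the value `v` that it proposes to the
safe agreement object `o`. -/
def SimTrace.Proposed {n n' : ℕ} {In Out M S : Type*} (e : SimTrace n n' In Out M S)
    (o : Fin n' × ℕ) (x : Fin n) (v : SAVal n' In M) (τ : ℕ) : Prop :=
  ∃ u < τ, ∃ s, (e.cfg u).loc x = some s ∧ s.sn o.1 = o.2 ∧ s.pc o.1 = .lock v ∧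
    s.queue.head? = some o.1

/-- Before time `τ`, the simulator `x` was about to broadcast its view `w` of the safe agreement
object `o`. -/
def SimTrace.ProposedView {n n' : ℕ} {In Out M S : Type*} (e : SimTrace n n' In Out M S)
    (o : Fin n' × ℕ) (x : Fin n) (w : Fin n → Option (SAVal n' In M)) (τ : ℕ) : Prop :=
  ∃ u < τ, ∃ s k, (e.cfg u).loc x = some s ∧ s.sn o.1 = o.2 ∧ n ≤ k ∧ s.pc o.1 = .reading k w

variable {n n' t : ℕ} {In Out M S : Type*} [LinearOrder (SAVal n' In M)]
  {A : Algorithm n' In Out M S} {inp : Fin n → Fin n' → In} {e : SimTrace n n' In Out M S}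
  {i : Fin n} {τ τ' : ℕ} {s s' : SimState n n' In Out M S} {o : Fin n' × ℕ} {x y p q : Fin n}
  {v v' : SAVal n' In M} {w w' : Fin n → Option (SAVal n' In M)}

namespace SimTrace

theorem Proposed.unique (he : IsExecution (simulation n A) inp t e) (h : e.Proposed o x v τ)
    (h' : e.Proposed o x v' τ') : v = v' := by
  obtain ⟨u, -, s, hs, hsn, hpc, -⟩ := h
  obtain ⟨u', -, s', hs', hsn', hpc', -⟩ := h'
  have hrank : (s.pc o.1).rank = (s'.pc o.1).rank := by simp [hpc, hpc', PC.rank]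
  have hpcs : s.pc o.1 = s'.pc o.1 := (he.later_total hs hs').elim
    (fun h => (h.pc_eq_of_rank_eq (hsn.trans hsn'.symm) hrank).symm)
    (fun h => h.pc_eq_of_rank_eq (hsn'.trans hsn.symm) hrank.symm)
  exact PC.lock.inj (hpc.symm.trans (hpcs.trans hpc'))

theorem ProposedView.unique (he : IsExecution (simulation n A) inp t e)
    (h : e.ProposedView o x w τ) (h' : e.ProposedView o x w' τ') : w = w' := by
  obtain ⟨u, -, s, k, hs, hsn, hk, hpc⟩ := h
  obtain ⟨u', -, s', k', hs', hsn', hk', hpc'⟩ := h'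
  have hrank : (s.pc o.1).rank = (s'.pc o.1).rank := by simp [hpc, hpc', PC.rank, hk, hk']
  have hpcs : s.pc o.1 = s'.pc o.1 := (he.later_total hs hs').elim
    (fun h => (h.pc_eq_of_rank_eq (hsn.trans hsn'.symm) hrank).symm)
    (fun h => h.pc_eq_of_rank_eq (hsn'.trans hsn.symm) hrank.symm)
  exact (PC.reading.inj (hpc.symm.trans (hpcs.trans hpc'))).2

end SimTrace

namespace IsExecution

theorem proposed_of_mem_chan (he : IsExecution (simulation n A) inp t e)
    (hm : (o, .value x v) ∈ (e.cfg τ).chan q p) : e.Proposed o x v τ := by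
  induction τ using Nat.strong_induction_on generalizing q p with
  | _ τ ih =>
    obtain ⟨u, hu, s, s', out, -, hs, hl, hout, -⟩ := he.exists_localStep_of_mem_chan hm
    rcases hl.of_value_mem_out hout with ⟨rfl, h⟩ | ⟨src, h, -⟩
    · exact ⟨u, hu, s, hs, h⟩
    · obtain ⟨u', hu', h⟩ := ih u hu h
      exact ⟨u', hu'.trans hu, h⟩

theorem proposedView_of_mem_chan (he : IsExecution (simulation n A) inp t e)
    (hm : (o, .view x w) ∈ (e.cfg τ).chan q p) : e.ProposedView o x w τ := by
  induction τ using Nat.strong_induction_on generalizing q p with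
  | _ τ ih =>
    obtain ⟨u, hu, s, s', out, -, hs, hl, hout, -⟩ := he.exists_localStep_of_mem_chan hm
    rcases hl.of_view_mem_out hout with ⟨rfl, hsn, k, hk, hpc⟩ | ⟨src, h⟩
    · exact ⟨u, hu, s, k, hs, hsn, hk, hpc⟩
    · obtain ⟨u', hu', h⟩ := ih u hu h
      exact ⟨u', hu'.trans hu, h⟩

theorem proposed_of_mem_log (he : IsExecution (simulation n A) inp t e)
    (hs : (e.cfg τ).loc i = some s) (h : (q, .value x v) ∈ (s.sa o).log) : e.Proposed o x v τ :=
  he.proposed_of_mem_chan (he.mem_chan_of_mem_log hs h)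

theorem proposed_of_values_eq_some (he : IsExecution (simulation n A) inp t e)
    (hs : (e.cfg τ).loc i = some s) (h : (s.sa o).values x = some v) : e.Proposed o x v τ :=
  let ⟨_, hq⟩ := (he.consistent hs o).exists_value_mem x v h
  he.proposed_of_mem_log hs hq

theorem proposedView_of_allViews_eq_some (he : IsExecution (simulation n A) inp t e)
    (hs : (e.cfg τ).loc i = some s) (h : (s.sa o).allViews x = some w) :
    e.ProposedView o x w τ :=
  let ⟨_, hq⟩ := (he.consistent hs o).exists_view_mem x w h
  he.proposedView_of_mem_chan (he.mem_chan_of_mem_log hs hq)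

theorem exists_majority_of_read_mem_chan (he : IsExecution (simulation n A) inp t e)
    (hm : (o, .read y x) ∈ (e.cfg τ).chan q p) :
    ∃ u < τ, ∃ s v, (e.cfg u).loc y = some s ∧ (s.sa o).Majority (.value y v) := by
  obtain ⟨u, hu, s, s', out, -, hs, hl, hout, -⟩ := he.exists_localStep_of_mem_chan hm
  obtain ⟨rfl, v, hv⟩ := hl.of_read_mem_out hout
  exact ⟨u, hu, s, v, hs, hv⟩

theorem exists_read_of_answer_mem_chan (he : IsExecution (simulation n A) inp t e)
    {r : Option (SAVal n' In M)} (hm : (o, .answer y x r) ∈ (e.cfg τ).chan q p) :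
    ∃ u < τ, ∃ s, q ∉ (e.cfg u).crashed ∧ (e.cfg u).loc q = some s ∧ (s.sa o).values x = r ∧
      ∃ src, (o, .read y x) ∈ (e.cfg u).chan src q := by
  obtain ⟨u, hu, s, s', out, halive, hs, hl, hout, -⟩ := he.exists_localStep_of_mem_chan hm
  obtain ⟨hr, src, hread⟩ := hl.of_answer_mem_out hout
  exact ⟨u, hu, s, halive, hs, hr, src, hread⟩

theorem exists_mem_log_of_value_mem_chan (he : IsExecution (simulation n A) inp t e)
    (hm : (o, .value x v) ∈ (e.cfg τ).chan q p) (hq : q ∉ (e.cfg τ).crashed) (hqx : q ≠ x) :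
    ∃ s src, (e.cfg τ).loc q = some s ∧ (src, .value x v) ∈ (s.sa o).log := by
  obtain ⟨u, hu, s, s', out, -, hs, hl, hout, hcr | hs'⟩ := he.exists_localStep_of_mem_chan hm
  · exact absurd (he.crashed_subset hu hcr) hq
  · rcases hl.of_value_mem_out hout with ⟨rfl, -⟩ | ⟨src, -, h⟩
    · exact absurd rfl hqx
    · obtain ⟨s₁, hs₁, hlater⟩ := he.exists_later hu hs'
      exact ⟨s₁, src, hs₁, hlater.log o h⟩

-- Some `q` forwarded the value of `x` to `x` and told `y` that it had not received that value;
-- so `y` sent its read requests to `q` before `x` had its majority.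
theorem exists_majority_lt_of_majority_answer (he : IsExecution (simulation n A) inp t e)
    (hs : (e.cfg τ).loc x = some s) (hx : (s.sa o).Majority (.value x v))
    (hs' : (e.cfg τ').loc y = some s') (hy : (s'.sa o).Majority (.answer y x none)) :
    ∃ u < τ, ∃ s v, (e.cfg u).loc y = some s ∧ (s.sa o).Majority (.value y v) := by
  obtain ⟨q, hqx, hqy⟩ := hx.exists_common hy
  obtain ⟨u, -, s₁, halive, hs₁, hnone, src, hread⟩ :=
    he.exists_read_of_answer_mem_chan (he.mem_chan_of_mem_log hs' hqy)
  obtain ⟨u', hu', hmaj⟩ := he.exists_majority_of_read_mem_chan hread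
  refine ⟨u', lt_of_not_ge fun hτ => ?_, hmaj⟩
  have hτu : τ ≤ u := hτ.trans hu'.le
  obtain ⟨s₀, src, hs₀, hmem⟩ :
      ∃ s₀ src, (e.cfg τ).loc q = some s₀ ∧ (src, .value x v) ∈ (s₀.sa o).log := by
    rcases eq_or_ne q x with rfl | hne
    · exact ⟨s, q, hs, hqx⟩
    · exact he.exists_mem_log_of_value_mem_chan (he.mem_chan_of_mem_log hs hqx)
        (fun h => halive (he.crashed_subset hτu h)) hne
  exact (he.consistent hs₁ o).values_ne_none src x v ((he.later hτu hs₀ hs₁).log o hmem) hnone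

end IsExecution

namespace SimTrace.ProposedView

theorem exists_majority_value (he : IsExecution (simulation n A) inp t e)
    (h : e.ProposedView o x w τ) :
    ∃ u s v, (e.cfg u).loc x = some s ∧ (s.sa o).Majority (.value x v) := by
  obtain ⟨u, -, s, k, hs, hsn, -, hpc⟩ := h
  obtain ⟨v, hv⟩ := (he.threadInv hs o.1).value_majority o.2
    (.inr ⟨hsn.symm, by simp [hpc, PC.rank]⟩)
  exact ⟨u, s, v, hs, hv⟩

theorem exists_majority_answer (he : IsExecution (simulation n A) inp t e)
    (h : e.ProposedView o x w τ) (hy : w y = none) :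
    ∃ u s, (e.cfg u).loc x = some s ∧ (s.sa o).Majority (.answer x y none) := by
  obtain ⟨u, -, s, k, hs, hsn, hk, hpc⟩ := h
  have hmaj := (he.threadInv hs o.1).reading k w hpc y (y.isLt.trans_le hk)
  rw [hy, hsn] at hmaj
  exact ⟨u, s, hs, hmaj⟩

theorem ne_none_or_ne_none (he : IsExecution (simulation n A) inp t e)
    (h : e.ProposedView o x w τ) (h' : e.ProposedView o y w' τ') :
    w y ≠ none ∨ w' x ≠ none := by
  by_contra! hc
  obtain ⟨_, _, hsx, hx⟩ := h.exists_majority_answer he hc.1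
  obtain ⟨_, _, hsy, hy⟩ := h'.exists_majority_answer he hc.2
  have hex := h.exists_majority_value he
  classical
  -- The first majority for `x` would be preceded by one for `y`, itself preceded by one for `x`.
  obtain ⟨s₁, v₁, hs₁, hm₁⟩ := Nat.find_spec hex
  obtain ⟨u₂, hu₂, s₂, v₂, hs₂, hm₂⟩ :=
    he.exists_majority_lt_of_majority_answer hs₁ hm₁ hsy hy
  obtain ⟨u₃, hu₃, hm₃⟩ := he.exists_majority_lt_of_majority_answer hs₂ hm₂ hsx hx
  exact Nat.find_min hex (hu₃.trans hu₂) hm₃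

end SimTrace.ProposedView

namespace IsExecution

variable {i₁ i₂ : Fin n} {τ₁ τ₂ : ℕ} {s₁ s₂ : SimState n n' In Out M S}
  {σ₁ σ₂ : Finset (Fin n)}

theorem closed_inter (he : IsExecution (simulation n A) inp t e)
    (h₁ : (e.cfg τ₁).loc i₁ = some s₁) (h₂ : (e.cfg τ₂).loc i₂ = some s₂)
    (hσ₁ : (s₁.sa o).Closed σ₁) (hσ₂ : (s₂.sa o).Closed σ₂) : (s₁.sa o).Closed (σ₁ ∩ σ₂) := by
  refine ⟨?_, fun z hz => ?_⟩
  · obtain ⟨x, hx⟩ := hσ₁.1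
    obtain ⟨y, hy⟩ := hσ₂.1
    obtain ⟨-, w, hw, hwσ⟩ := hσ₁.2 x hx
    obtain ⟨-, w', hw', hwσ'⟩ := hσ₂.2 y hy
    rcases (he.proposedView_of_allViews_eq_some h₁ hw).ne_none_or_ne_none he
      (he.proposedView_of_allViews_eq_some h₂ hw') with h | h
    · exact ⟨y, Finset.mem_inter.2 ⟨hwσ y h, hy⟩⟩
    · exact ⟨x, Finset.mem_inter.2 ⟨hx, hwσ' x h⟩⟩
  · obtain ⟨hz₁, hz₂⟩ := Finset.mem_inter.1 hz
    obtain ⟨hval, w, hw, hwσ⟩ := hσ₁.2 z hz₁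
    obtain ⟨-, w', hw', hwσ'⟩ := hσ₂.2 z hz₂
    obtain rfl : w = w' := (he.proposedView_of_allViews_eq_some h₁ hw).unique he
      (he.proposedView_of_allViews_eq_some h₂ hw')
    exact ⟨hval, w, hw, fun a ha => Finset.mem_inter.2 ⟨hwσ a ha, hwσ' a ha⟩⟩

theorem values_eq_of_closed (he : IsExecution (simulation n A) inp t e)
    (h₁ : (e.cfg τ₁).loc i₁ = some s₁) (h₂ : (e.cfg τ₂).loc i₂ = some s₂)
    (hσ₁ : (s₁.sa o).Closed σ₁) (hσ₂ : (s₂.sa o).Closed σ₁) (hy : y ∈ σ₁) :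
    (s₁.sa o).values y = (s₂.sa o).values y := by
  obtain ⟨a, ha⟩ := Option.ne_none_iff_exists'.1 (hσ₁.2 y hy).1
  obtain ⟨b, hb⟩ := Option.ne_none_iff_exists'.1 (hσ₂.2 y hy).1
  rw [ha, hb, (he.proposed_of_values_eq_some h₁ ha).unique he (he.proposed_of_values_eq_some h₂ hb)]

theorem eq_of_returns (he : IsExecution (simulation n A) inp t e)
    (h₁ : (e.cfg τ₁).loc i₁ = some s₁) (h₂ : (e.cfg τ₂).loc i₂ = some s₂)
    (hr₁ : (s₁.sa o).Returns v) (hr₂ : (s₂.sa o).Returns v') : v = v' := by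
  obtain ⟨σ₁, hσ₁, hmin₁, hleast₁⟩ := hr₁
  obtain ⟨σ₂, hσ₂, hmin₂, hleast₂⟩ := hr₂
  have hinter₁ : σ₁ ∩ σ₂ = σ₁ := Finset.eq_of_subset_of_card_le Finset.inter_subset_left
    (hmin₁ _ (he.closed_inter h₁ h₂ hσ₁ hσ₂))
  have hinter₂ : σ₂ ∩ σ₁ = σ₂ := Finset.eq_of_subset_of_card_le Finset.inter_subset_left
    (hmin₂ _ (he.closed_inter h₂ h₁ hσ₂ hσ₁))
  obtain rfl : σ₁ = σ₂ := by rw [← hinter₁, Finset.inter_comm, hinter₂]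
  have hset : {v | ∃ y ∈ σ₁, (s₁.sa o).values y = some v} =
      {v | ∃ y ∈ σ₁, (s₂.sa o).values y = some v} := by
    ext a
    exact exists_congr fun y =>
      and_congr_right fun hy => by rw [he.values_eq_of_closed h₁ h₂ hσ₁ hσ₂ hy]
  exact (hset ▸ hleast₁).unique hleast₂

theorem eq_of_result_eq_some (he : IsExecution (simulation n A) inp t e)
    (h₁ : (e.cfg τ₁).loc i₁ = some s₁) (h₂ : (e.cfg τ₂).loc i₂ = some s₂)
    (hr₁ : (s₁.sa o).result = some v) (hr₂ : (s₂.sa o).result = some v') : v = v' :=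
  he.eq_of_returns h₁ h₂ (SAState.returns_of_result_eq_some hr₁)
    (SAState.returns_of_result_eq_some hr₂)

theorem exists_proposed_of_result_eq_some (he : IsExecution (simulation n A) inp t e)
    (hs : (e.cfg τ).loc i = some s) (hr : (s.sa o).result = some v) :
    ∃ x, e.Proposed o x v τ := by
  obtain ⟨σ, -, -, ⟨y, -, hy⟩, -⟩ := SAState.returns_of_result_eq_some hr
  exact ⟨y, he.proposed_of_values_eq_some hs hy⟩

end IsExecution

end Agreement

/-! ### Termination of `propose` and `decide` -/

section Liveness

open Filter

variable {n n' t : ℕ} {In Out M S : Type*}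

theorem PC.eq_deciding_of_lt_rank {V : Type*} {pc : PC n V} (h : 4 + n < pc.rank) :
    pc = .deciding := by
  cases pc <;> simp only [PC.rank] at h <;> first | rfl | omega

namespace SimState

/-- A bound on the number of statements that the owners of the lock still have to execute before
the thread `j`, which owns the lock or waits for it, releases it. -/
def lockDelay (s : SimState n n' In Out M S) (j : Fin n') : ℕ :=
  s.queue.idxOf j * (6 + n) + s.queue.head?.elim 0 fun a => 5 + n - (s.pc a).rank

/-- From `s` to `s'`, the thread `j` has got closer to releasing the lock, or the owner of the lock
has not moved. -/
def LockLE (s s' : SimState n n' In Out M S) (j : Fin n') : Prop :=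
  s'.lockDelay j < s.lockDelay j ∨ s'.lockDelay j = s.lockDelay j ∧
    ∀ a, s.queue.head? = some a →
      s'.queue.head? = some a ∧ s'.pc a = s.pc a ∧ s'.sn a = s.sn a

variable {s s' s'' : SimState n n' In Out M S} {j : Fin n'}

theorem LockLE.refl (s : SimState n n' In Out M S) (j : Fin n') : s.LockLE s j :=
  .inr ⟨rfl, fun _ ha => ⟨ha, rfl, rfl⟩⟩

theorem LockLE.trans (h : s.LockLE s' j) (h' : s'.LockLE s'' j) : s.LockLE s'' j := by
  unfold LockLE at *
  grind

theorem ThreadLE.rank_lt (h : s.ThreadLE s' j) (hmove : ¬ (s'.pc j = s.pc j ∧ s'.sn j = s.sn j))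
    (hsn : s.sn j = s'.sn j) : (s.pc j).rank < (s'.pc j).rank := by
  unfold ThreadLE at h
  grind

/-- The thread `j` has completed `SA[j, k].propose`. -/
def ProposeDone (s : SimState n n' In Out M S) (j : Fin n') (k : ℕ) : Prop :=
  k < s.sn j ∨ k = s.sn j ∧ s.pc j = .deciding

variable [LinearOrder (SAVal n' In M)]

/-- The wait condition of the statement that the thread `j` of the simulator `i` has to execute
holds. -/
def Enabled (s : SimState n n' In Out M S) (i : Fin n) (j : Fin n') : Prop :=
  match s.pc j with
  | .begin => True
  | .waitMsg => s.oldest j ≠ none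
  | .lock _ => s.queue.head? = some j
  | .waitValue v => (s.sa (j, s.sn j)).Majority (.value i v)
  | .reading k _ => ∀ hk : k < n, (∃ v, (s.sa (j, s.sn j)).Majority (.value ⟨k, hk⟩ v)) ∨
      (s.sa (j, s.sn j)).Majority (.answer i ⟨k, hk⟩ none)
  | .waitView w => (s.sa (j, s.sn j)).Majority (.view i w)
  | .deciding => ∃ v, (s.sa (j, s.sn j)).result = some v ∧ s.Accepts j v

theorem Enabled.threadStep_pc_ne (A : Algorithm n' In Out M S) {i : Fin n} (h : s.Enabled i j) :
    (threadStep A i j s).1.pc j ≠ s.pc j := by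
  unfold Enabled at h
  cases hpc : s.pc j with
  | begin => simp [threadStep, hpc, mutexIn_pc]
  | waitMsg =>
    simp only [hpc] at h
    obtain ⟨m, hm⟩ := Option.ne_none_iff_exists'.1 h
    simp [threadStep, hpc, hm, mutexIn_pc]
  | lock v =>
    simp only [hpc] at h
    simp [threadStep, hpc, h, goto]
  | waitValue v | waitView w =>
    simp only [hpc] at h
    simp [threadStep, hpc, h, goto]
  | reading k w =>
    simp only [hpc] at h
    simp only [threadStep, hpc]
    split_ifs <;> grind [goto_pc]
  | deciding =>
    simp only [hpc] at h
    obtain ⟨v, hv, hacc⟩ := h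
    simp [threadStep, hpc, hv, obtain_pc hacc]

end SimState

variable [LinearOrder (SAVal n' In M)] {A : Algorithm n' In Out M S}

namespace LocalStep

variable {i : Fin n} {inbox : Fin n → Set (NetMsg n n' In M)} {s s' : SimState n n' In Out M S}
  {out : Fin n → List (NetMsg n n' In M)} {a j : Fin n'}

theorem head_cases (h : LocalStep A i inbox s s' out) (hinv : LockInv s.queue s.pc)
    (ha : s.queue.head? = some a) :
    (s.queue <+: s'.queue ∧ s'.pc a = s.pc a ∧ s'.sn a = s.sn a) ∨
      (s'.queue = s.queue ∧ (s.pc a).rank < (s'.pc a).rank) ∨ s'.queue = s.queue.tail := by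
  have hqueued := (hinv.mem_iff a).1 (List.mem_of_head? ha)
  cases h with
  | recv | stay => exact .inl ⟨List.prefix_rfl, rfl, rfl⟩
  | enter j v hready =>
    have hne : a ≠ j := fun h => hready.not_queued (h ▸ hqueued)
    exact .inl ⟨List.prefix_append _ _, by simp [SimState.mutexIn_pc, hne], rfl⟩
  | lock j _ hj | waitValue j _ hj | read j _ _ _ hj | readDone j _ _ _ hj =>
    rcases eq_or_ne a j with rfl | hne
    · refine .inr (.inl ⟨rfl, ?_⟩)
      simp [SimState.goto, hj, PC.rank] <;> omega
    · exact .inl ⟨List.prefix_rfl, by simp [SimState.goto, hne], rfl⟩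
  | waitView j _ hj =>
    exact .inr (.inr rfl)
  | obtain j v hj _ hv =>
    have hne : a ≠ j := by
      rintro rfl
      simp [PC.Queued, hj, PC.rank] at hqueued
    exact .inl ⟨by rw [SimState.obtain_queue], by simp [SimState.obtain_pc hv, hne],
      by simp [SimState.obtain_sn hv, hne]⟩

theorem lockLE (h : LocalStep A i inbox s s' out) (hinv : LockInv s.queue s.pc)
    (hj : j ∈ s.queue) (hj' : j ∈ s'.queue) : s.LockLE s' j := by
  obtain ⟨a, r, hqueue⟩ := List.exists_cons_of_ne_nil (List.ne_nil_of_mem hj)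
  have hhead : s.queue.head? = some a := by simp [hqueue]
  obtain ⟨-, hrank⟩ := (hinv.mem_iff a).1 (List.mem_of_head? hhead)
  rcases h.head_cases hinv hhead with ⟨⟨l, hl⟩, hpc, hsn⟩ | ⟨hsame, hlt⟩ | htail
  · have hhead' : s'.queue.head? = some a := by simp [← hl, List.head?_append, hhead]
    refine .inr ⟨?_, by grind⟩
    simp only [SimState.lockDelay, hhead, hhead', Option.elim_some, hpc]
    rw [← hl, List.idxOf_append_of_mem hj]
  · left
    simp only [SimState.lockDelay, hsame, hhead, Option.elim_some]
    omega
  · left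
    rw [hqueue, List.tail_cons] at htail
    have haj : a ≠ j := by
      rintro rfl
      exact (List.nodup_cons.1 (hqueue ▸ hinv.nodup)).1 (htail ▸ hj')
    have hbound : (s'.queue.head?.elim 0 fun b => 5 + n - (s'.pc b).rank) ≤ 5 + n := by
      cases s'.queue.head? <;> simp
    simp only [SimState.lockDelay, htail, hqueue, List.idxOf_cons_ne _ haj, Nat.succ_mul] at *
    omega

end LocalStep

variable {inp : Fin n → Fin n' → In} {e : SimTrace n n' In Out M S} {i : Fin n} {τ τ' : ℕ}
  {s s' : SimState n n' In Out M S} {o : Fin n' × ℕ} {j : Fin n'} {x y p q : Fin n}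

namespace IsExecution

theorem eventually_mem_log (he : IsExecution (simulation n A) inp t e) (hp : e.Correct p)
    {m : SAMsg n (SAVal n' In M)} (hm : (o, m) ∈ (e.cfg τ).chan q p) :
    ∀ᶠ u in atTop, ∀ s, (e.cfg u).loc p = some s → (q, m) ∈ (s.sa o).log := by
  obtain ⟨u, s, -, hs⟩ := he.exists_recv_of_mem_chan hp hm
  filter_upwards [eventually_ge_atTop (u + 1)] with u' hu' s' hs'
  refine (he.later hu' hs hs').log o ?_
  simp [simulation, SAState.recv_log]

theorem eventually_exists_loc (he : IsExecution (simulation n A) inp t e) (hi : e.Correct i) :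
    ∀ᶠ u in atTop, ∃ s, (e.cfg u).loc i = some s := by
  obtain ⟨τ, h⟩ := he.starts i hi
  obtain ⟨s, hs⟩ := Option.ne_none_iff_exists'.1 h
  filter_upwards [eventually_ge_atTop τ] with u hu
  exact (he.exists_later hu hs).imp fun _ => And.left

theorem exists_mem_log (he : IsExecution (simulation n A) inp t e) (hp : e.Correct p)
    {m : SAMsg n (SAVal n' In M)} (hm : (o, m) ∈ (e.cfg τ).chan q p) :
    ∃ u s, (e.cfg u).loc p = some s ∧ (q, m) ∈ (s.sa o).log :=
  let ⟨u, hlog, s, hs⟩ := ((he.eventually_mem_log hp hm).and (he.eventually_exists_loc hp)).exists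
  ⟨u, s, hs, hlog s hs⟩

theorem eventually_majority (he : IsExecution (simulation n A) inp t e) (htn : 2 * t < n)
    {m : SAMsg n (SAVal n' In M)}
    (h : ∀ q, e.Correct q → ∀ᶠ u in atTop, ∀ s, (e.cfg u).loc p = some s → (q, m) ∈ (s.sa o).log) :
    ∀ᶠ u in atTop, ∀ s, (e.cfg u).loc p = some s → (s.sa o).Majority m := by
  have hall : ∀ᶠ u in atTop, ∀ q, e.Correct q → ∀ s, (e.cfg u).loc p = some s →
      (q, m) ∈ (s.sa o).log := by
    simpa only [eventually_all, eventually_imp_distrib_left] using h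
  filter_upwards [hall] with u hu s hs
  have hle : {q | e.Correct q}.ncard ≤ {q | (q, m) ∈ (s.sa o).log}.ncard :=
    Set.ncard_le_ncard (fun q hq => hu q hq s hs) (Set.toFinite _)
  have hcompl := Set.ncard_add_ncard_compl {q | e.Correct q} (Set.toFinite _) (Set.toFinite _)
  have hfaulty : {q | e.Correct q}ᶜ.ncard ≤ t := he.resilient
  rw [Nat.card_fin] at hcompl
  unfold SAState.Majority
  omega

theorem eventually_value_mem_log (he : IsExecution (simulation n A) inp t e)
    (hs : (e.cfg τ).loc i = some s) {v : SAVal n' In M} (hv : (y, .value x v) ∈ (s.sa o).log)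
    (hp : e.Correct p) (hq : e.Correct q) :
    ∀ᶠ u in atTop, ∀ s, (e.cfg u).loc p = some s → (q, .value x v) ∈ (s.sa o).log :=
  let ⟨_, _, hs', hv'⟩ := he.exists_mem_log hq (he.value_mem_chan_of_mem_log hs hv q)
  he.eventually_mem_log hp (he.value_mem_chan_of_mem_log hs' hv' p)

theorem eventually_view_mem_log (he : IsExecution (simulation n A) inp t e)
    (hs : (e.cfg τ).loc i = some s) {w : Fin n → Option (SAVal n' In M)}
    (hw : (y, .view x w) ∈ (s.sa o).log) (hp : e.Correct p) (hq : e.Correct q) :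
    ∀ᶠ u in atTop, ∀ s, (e.cfg u).loc p = some s → (q, .view x w) ∈ (s.sa o).log :=
  let ⟨_, _, hs', hw'⟩ := he.exists_mem_log hq (he.view_mem_chan_of_mem_log hs hw q)
  he.eventually_mem_log hp (he.view_mem_chan_of_mem_log hs' hw' p)

theorem eventually_majority_value (he : IsExecution (simulation n A) inp t e) (htn : 2 * t < n)
    (hi : e.Correct i) {v : SAVal n' In M}
    (h : ∀ p, (o, .value x v) ∈ (e.cfg τ).chan i p) :
    ∀ᶠ u in atTop, ∀ s, (e.cfg u).loc i = some s → (s.sa o).Majority (.value x v) :=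
  he.eventually_majority htn fun q hq =>
    let ⟨_, _, hs, hv⟩ := he.exists_mem_log hq (h q)
    he.eventually_value_mem_log hs hv hi hq

theorem eventually_majority_view (he : IsExecution (simulation n A) inp t e) (htn : 2 * t < n)
    (hi : e.Correct i) {w : Fin n → Option (SAVal n' In M)}
    (h : ∀ p, (o, .view x w) ∈ (e.cfg τ).chan i p) :
    ∀ᶠ u in atTop, ∀ s, (e.cfg u).loc i = some s → (s.sa o).Majority (.view x w) :=
  he.eventually_majority htn fun q hq =>
    let ⟨_, _, hs, hw⟩ := he.exists_mem_log hq (h q)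
    he.eventually_view_mem_log hs hw hi hq

theorem eventually_majority_of_read (he : IsExecution (simulation n A) inp t e) (htn : 2 * t < n)
    (hi : e.Correct i) (hread : ∀ p, (o, .read i x) ∈ (e.cfg τ).chan i p) :
    ∀ᶠ u in atTop, ∀ s, (e.cfg u).loc i = some s →
      (∃ v, (s.sa o).Majority (.value x v)) ∨ (s.sa o).Majority (.answer i x none) := by
  by_cases h : ∃ p τ s q v, (e.cfg τ).loc p = some s ∧
      (q, .value x v) ∈ (s.sa o).log
  · obtain ⟨p, τ, s, q, v, hs, hv⟩ := h
    filter_upwards [he.eventually_majority htn fun q hq =>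
      he.eventually_value_mem_log hs hv hi hq] with u hu s hs
    exact .inl ⟨v, hu s hs⟩
  · have hanswer q (hq : e.Correct q) : ∀ᶠ u in atTop, ∀ s, (e.cfg u).loc i = some s →
        (q, .answer i x none) ∈ (s.sa o).log := by
      obtain ⟨u, s', hs', hmem⟩ := he.exists_mem_log hq (hread q)
      rcases he.answer_mem_chan_or_exists_value hs' hmem with hans | ⟨q', v, hv⟩
      · exact he.eventually_mem_log hi hans
      · exact absurd ⟨q, u, s', q', v, hs', hv⟩ h
    filter_upwards [he.eventually_majority htn hanswer] with u hu s hs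
    exact .inr (hu s hs)

theorem exists_move (he : IsExecution (simulation n A) inp t e) (hi : e.Correct i)
    (hs : (e.cfg τ).loc i = some s)
    (henabled : ∀ᶠ u in atTop, ∀ s', (e.cfg u).loc i = some s' → s'.pc j = s.pc j →
      s'.sn j = s.sn j → s'.Enabled i j) :
    ∃ u ≥ τ, ∃ s', (e.cfg u).loc i = some s' ∧ s.Later s' ∧
      ¬ (s'.pc j = s.pc j ∧ s'.sn j = s.sn j) := by
  by_contra! hstuck
  replace hstuck u (hu : τ ≤ u) s' (hs' : (e.cfg u).loc i = some s') :=
    hstuck u hu s' hs' (he.later hu hs hs')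
  obtain ⟨T, hT⟩ := eventually_atTop.1 henabled
  obtain ⟨u, hu, s₁, hs₁, hs₂⟩ := he.exists_tick_ge hi j (max τ T)
  obtain ⟨hpc, hsn⟩ := hstuck u (by omega) s₁ hs₁
  exact (hT u (by omega) s₁ hs₁ hpc hsn).threadStep_pc_ne A
    ((hstuck (u + 1) (by omega) _ hs₂).1.trans hpc.symm)

theorem eventually_enabled_of_proposing (he : IsExecution (simulation n A) inp t e)
    (htn : 2 * t < n) (hi : e.Correct i) (hs : (e.cfg τ).loc i = some s)
    (hj : (s.pc j).Proposing) :
    ∀ᶠ u in atTop, ∀ s', (e.cfg u).loc i = some s' → s'.pc j = s.pc j → s'.sn j = s.sn j →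
      s'.Enabled i j := by
  cases hpc : s.pc j with
  | begin | waitMsg | lock | deciding => simp [PC.Proposing, hpc, PC.rank] at hj
  | waitValue v =>
    filter_upwards [he.eventually_majority_value htn hi (he.value_mem_chan_of_pc hs hpc)]
      with u hu s' hs' hpc' hsn
    simpa [SimState.Enabled, hpc', hsn] using hu s' hs'
  | waitView w =>
    filter_upwards [he.eventually_majority_view htn hi (he.view_mem_chan_of_pc hs hpc)]
      with u hu s' hs' hpc' hsn
    simpa [SimState.Enabled, hpc', hsn] using hu s' hs'
  | reading k w =>
    by_cases hk : k < n
    · filter_upwards [he.eventually_majority_of_read htn hi (he.read_mem_chan_of_pc hs hpc ⟨k, hk⟩)]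
        with u hu s' hs' hpc' hsn
      simpa [SimState.Enabled, hpc', hsn, hk] using hu s' hs'
    · simp +contextual [SimState.Enabled, hk]

theorem lockLE (he : IsExecution (simulation n A) inp t e) (h : τ ≤ τ')
    (hs : (e.cfg τ).loc i = some s) (hs' : (e.cfg τ').loc i = some s')
    (hj : ∀ u ≥ τ, ∀ s', (e.cfg u).loc i = some s' → j ∈ s'.queue) : s.LockLE s' j := by
  induction h generalizing s' with
  | refl =>
    obtain rfl : s = s' := by simpa [hs] using hs'
    exact .refl s j
  | @step u hle ih =>
    have hle : τ ≤ u := hle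
    obtain ⟨s₁, hs₁, -⟩ := he.exists_later hle hs
    refine (ih hs₁).trans ?_
    rcases he.loc_succ_cases u i with h | ⟨h, -⟩ | ⟨a, b, out, ha, hb, hstep, -⟩
    · obtain rfl : s₁ = s' := by simpa [← h, hs'] using hs₁.symm
      exact .refl _ _
    · simp [h] at hs₁
    · obtain rfl : a = s₁ := by simpa [ha] using hs₁
      obtain rfl : b = s' := by simpa [hb] using hs'
      exact hstep.lockLE (he.lockInv ha) (hj u hle _ ha) (hj (u + 1) (by omega) _ hb)

theorem exists_lockDelay_lt (he : IsExecution (simulation n A) inp t e) (htn : 2 * t < n)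
    (hi : e.Correct i) (hs : (e.cfg τ).loc i = some s)
    (hj : ∀ u ≥ τ, ∀ s', (e.cfg u).loc i = some s' → j ∈ s'.queue) :
    ∃ u ≥ τ, ∃ s', (e.cfg u).loc i = some s' ∧ s'.lockDelay j < s.lockDelay j := by
  by_contra! hge
  obtain ⟨a, r, hqueue⟩ := List.exists_cons_of_ne_nil (List.ne_nil_of_mem (hj τ le_rfl s hs))
  have hhead : s.queue.head? = some a := by simp [hqueue]
  have hstuck u (hu : τ ≤ u) s' (hs' : (e.cfg u).loc i = some s') :=
    (((he.lockLE hu hs hs' hj).resolve_left (hge u hu s' hs').not_gt).2 a hhead)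
  obtain ⟨hle, hle'⟩ := ((he.lockInv hs).mem_iff a).1 (List.mem_of_head? hhead)
  obtain ⟨u, hu, s', hs', -, hmove⟩ := he.exists_move (j := a) hi hs <| by
    by_cases hrank : 2 ≤ (s.pc a).rank
    · exact he.eventually_enabled_of_proposing htn hi hs ⟨hrank, hle'⟩
    · obtain ⟨v, hv⟩ : ∃ v, s.pc a = .lock v := by
        cases hpc : s.pc a <;> simp_all [PC.rank] <;> omega
      filter_upwards [eventually_ge_atTop τ] with u hu s' hs' hpc _
      simpa [SimState.Enabled, hpc, hv] using (hstuck u hu s' hs').1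
  exact hmove (hstuck u hu s' hs').2

theorem exists_not_mem_queue (he : IsExecution (simulation n A) inp t e) (htn : 2 * t < n)
    (hi : e.Correct i) (hs : (e.cfg τ).loc i = some s) (j : Fin n') :
    ∃ u ≥ τ, ∃ s', (e.cfg u).loc i = some s' ∧ j ∉ s'.queue := by
  by_contra! hj
  induction hN : s.lockDelay j using Nat.strong_induction_on generalizing τ s with
  | _ N ih =>
    obtain ⟨u, hu, s', hs', hlt⟩ := he.exists_lockDelay_lt htn hi hs hj
    exact ih _ (hN ▸ hlt) hs' (fun u' hu' => hj u' (hu.le.trans hu')) rfl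

theorem exists_proposeDone_of_rank_pos (he : IsExecution (simulation n A) inp t e)
    (htn : 2 * t < n) (hi : e.Correct i) (hs : (e.cfg τ).loc i = some s)
    (hrank : 1 ≤ (s.pc j).rank) :
    ∃ u ≥ τ, ∃ s', (e.cfg u).loc i = some s' ∧ s'.ProposeDone j (s.sn j) := by
  obtain ⟨u, hu, s', hs', hj⟩ := he.exists_not_mem_queue htn hi hs j
  refine ⟨u, hu, s', hs', ?_⟩
  rcases (he.later hu hs hs').threadLE j with hsn | ⟨hsn, hpc⟩
  · exact .inl hsn
  · have hrank' : 1 ≤ (s'.pc j).rank := by grind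
    rw [(he.lockInv hs').mem_iff, PC.Queued, not_and] at hj
    exact .inr ⟨hsn, PC.eq_deciding_of_lt_rank (not_le.1 (hj hrank'))⟩

theorem exists_proposeDone (he : IsExecution (simulation n A) inp t e) (htn : 2 * t < n)
    (hi : e.Correct i) (hs : (e.cfg τ).loc i = some s)
    (hwait : ∀ u ≥ τ, ∀ s', (e.cfg u).loc i = some s' → s'.sn j = s.sn j → s'.pc j = .waitMsg →
      s'.oldest j ≠ none) :
    ∃ u ≥ τ, ∃ s', (e.cfg u).loc i = some s' ∧ s'.ProposeDone j (s.sn j) := by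
  by_cases hrank : 1 ≤ (s.pc j).rank
  · exact he.exists_proposeDone_of_rank_pos htn hi hs hrank
  have henabled : ∀ᶠ u in atTop, ∀ s', (e.cfg u).loc i = some s' → s'.pc j = s.pc j →
      s'.sn j = s.sn j → s'.Enabled i j := by
    filter_upwards [eventually_ge_atTop τ] with u hu s' hs' hpc hsn
    cases hpc' : s.pc j with
    | begin => simp [SimState.Enabled, hpc, hpc']
    | waitMsg => simpa [SimState.Enabled, hpc, hpc'] using hwait u hu s' hs' hsn (hpc.trans hpc')
    | lock | waitValue | reading | waitView | deciding => simp [hpc', PC.rank] at hrank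
  obtain ⟨u, hu, s₁, hs₁, hlater, hmove⟩ := he.exists_move hi hs henabled
  rcases (hlater.threadLE j).sn_le.lt_or_eq with hsn | hsn
  · exact ⟨u, hu, s₁, hs₁, .inl hsn⟩
  · have hrank₁ := (hlater.threadLE j).rank_lt hmove hsn
    obtain ⟨u', hu', s', hs', hdone⟩ := he.exists_proposeDone_of_rank_pos htn hi hs₁
      (Nat.one_le_of_lt hrank₁)
    exact ⟨u', hu.trans hu', s', hs', hsn ▸ hdone⟩

theorem eventually_values_ne_none (he : IsExecution (simulation n A) inp t e)
    (hs : (e.cfg τ).loc i = some s) (hy : (s.sa o).values y ≠ none) (hp : e.Correct p) :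
    ∀ᶠ u in atTop, ∀ s', (e.cfg u).loc p = some s' → (s'.sa o).values y ≠ none := by
  obtain ⟨v, hv⟩ := Option.ne_none_iff_exists'.1 hy
  obtain ⟨a, ha⟩ := (he.consistent hs o).exists_value_mem y v hv
  filter_upwards [he.eventually_value_mem_log hs ha hp hp] with u hu s' hs'
  exact (he.consistent hs' o).values_ne_none _ _ _ (hu s' hs')

theorem eventually_allViews_eq_some (he : IsExecution (simulation n A) inp t e)
    (hs : (e.cfg τ).loc i = some s) {w : Fin n → Option (SAVal n' In M)}
    (hw : (s.sa o).allViews y = some w) (hp : e.Correct p) :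
    ∀ᶠ u in atTop, ∀ s', (e.cfg u).loc p = some s' → (s'.sa o).allViews y = some w := by
  obtain ⟨a, ha⟩ := (he.consistent hs o).exists_view_mem y w hw
  filter_upwards [he.eventually_view_mem_log hs ha hp hp] with u hu s' hs'
  obtain ⟨w', hw'⟩ := Option.ne_none_iff_exists'.1
    ((he.consistent hs' o).allViews_ne_none _ _ _ (hu s' hs'))
  rw [hw', (he.proposedView_of_allViews_eq_some hs' hw').unique he
    (he.proposedView_of_allViews_eq_some hs hw)]

theorem eventually_closed (he : IsExecution (simulation n A) inp t e)
    (hs : (e.cfg τ).loc i = some s) {σ : Finset (Fin n)} (hσ : (s.sa o).Closed σ)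
    (hp : e.Correct p) :
    ∀ᶠ u in atTop, ∀ s', (e.cfg u).loc p = some s' → (s'.sa o).Closed σ := by
  have hmem y (hy : y ∈ σ) : ∀ᶠ u in atTop, ∀ s', (e.cfg u).loc p = some s' →
      (s'.sa o).values y ≠ none ∧
        ∃ w, (s'.sa o).allViews y = some w ∧ ∀ z, w z ≠ none → z ∈ σ := by
    obtain ⟨hvalue, w, hw, hsub⟩ := hσ.2 y hy
    filter_upwards [he.eventually_values_ne_none hs hvalue hp,
      he.eventually_allViews_eq_some hs hw hp] with u hval hview s' hs'
    exact ⟨hval s' hs', w, hview s' hs', hsub⟩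
  filter_upwards [(eventually_all_finset σ).2 hmem] with u hu s' hs'
  exact ⟨hσ.1, fun y hy => hu y hy s' hs'⟩

theorem eq_input_or_eq_msg_of_proposed (he : IsExecution (simulation n A) inp t e)
    {v : SAVal n' In M} (h : e.Proposed o x v τ) :
    (o.2 = 0 ∧ v = .input (inp x o.1)) ∨ (0 < o.2 ∧ ∃ m, v = .msg m ∧
      ∃ u < τ, ∃ s, (e.cfg u).loc x = some s ∧ s.sn o.1 = o.2 ∧ s.oldest o.1 = some m) := by
  obtain ⟨u, hu, s, hs, hsn, hpc, -⟩ := h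
  rcases (he.threadInv hs o.1).lock v hpc with ⟨hsn', hv⟩ | ⟨hsn', m, hv, hm⟩
  · exact .inl ⟨hsn ▸ hsn', hv⟩
  · exact .inr ⟨hsn ▸ hsn', m, hv, u, hu, s, hs, hsn, hm⟩

theorem accepts_of_proposed (he : IsExecution (simulation n A) inp t e)
    (hs : (e.cfg τ).loc i = some s) {v : SAVal n' In M}
    (hv : e.Proposed (j, s.sn j) x v τ') : s.Accepts j v := by
  rcases he.eq_input_or_eq_msg_of_proposed hv with ⟨-, rfl⟩ | ⟨hpos, m, rfl, -⟩
  · trivial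
  · exact fun h => hpos.ne' ((he.threadInv hs j).state_eq_none.2 h)

theorem exists_sn_lt_of_deciding (he : IsExecution (simulation n A) inp t e)
    (hi : e.Correct i) (hs : (e.cfg τ).loc i = some s) (hj : s.pc j = .deciding)
    {u₀ : ℕ} {s₀ : SimState n n' In Out M S} (hp : (e.cfg u₀).loc p = some s₀)
    {σ : Finset (Fin n)} (hσ : (s₀.sa (j, s.sn j)).Closed σ) :
    ∃ u ≥ τ, ∃ s', (e.cfg u).loc i = some s' ∧ s.sn j < s'.sn j := by
  have henabled : ∀ᶠ u in atTop, ∀ s', (e.cfg u).loc i = some s' → s'.pc j = s.pc j →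
      s'.sn j = s.sn j → s'.Enabled i j := by
    filter_upwards [he.eventually_closed hp hσ hi] with u hu s' hs' hpc hsn
    obtain ⟨r, hr⟩ := Option.ne_none_iff_exists'.1 (SAState.result_ne_none_of_closed (hu s' hs'))
    rw [← hsn] at hr
    obtain ⟨x, hx⟩ := he.exists_proposed_of_result_eq_some hs' hr
    simpa [SimState.Enabled, hpc, hj, hr] using he.accepts_of_proposed hs' hx
  obtain ⟨u, hu, s', hs', hlater, hmove⟩ := he.exists_move hi hs henabled
  refine ⟨u, hu, s', hs', (hlater.threadLE j).sn_le.lt_of_ne fun hsn => ?_⟩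
  have hrank := (hlater.threadLE j).rank_lt hmove hsn
  cases hpc : s'.pc j <;> simp [hj, hpc, PC.rank] at hrank <;> omega

end IsExecution

end Liveness

/-! ### Histories of the simulated processes -/

section History

variable {n' : ℕ} {In Out M S : Type*}

/-- Local history of a simulated process: its state, the messages that it has sent to each process,
the messages that it has received, and its decision. -/
structure History (n' : ℕ) (Out M S : Type*) where
  state : Option S
  outs : Fin n' → List M
  received : List (SimMsg n' M)
  decided : Option Out

/-- The history `h` of `p_j` extended by a transition with result `r`, after which the messages
received by `p_j` are `l`. -/
def History.next (A : Algorithm n' In Out M S) (j : Fin n') (h : History n' Out M S)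
    (r : S × (Fin n' → List M)) (l : List (SimMsg n' M)) : History n' Out M S where
  state := some r.1
  outs := fun x => h.outs x ++ r.2 x
  received := l
  decided := h.decided.or (A.dec j r.1)

/-- The history of `p_j` after `k` transitions, if `d` is the sequence of its input and of the
messages that it receives. -/
def history (A : Algorithm n' In Out M S) (j : Fin n') (d : ℕ → Option (SAVal n' In M)) :
    ℕ → History n' Out M S
  | 0 => ⟨none, fun _ => [], [], none⟩
  | k + 1 =>
    let h := history A j d k
    match d k, h.state with
    | some (.input v), _ => h.next A j (A.δ j (A.init j v) none) h.received
    | some (.msg m), some st => h.next A j (A.δ j st (some (m.1, m.2.2))) (h.received ++ [m])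
    | _, _ => h

variable {A : Algorithm n' In Out M S} {j : Fin n'} {d : ℕ → Option (SAVal n' In M)} {k k' : ℕ}

theorem history_succ_of_input {v : In} (h : d k = some (.input v)) :
    history A j d (k + 1) = (history A j d k).next A j (A.δ j (A.init j v) none)
      (history A j d k).received := by
  simp [history, h]

theorem history_succ_of_msg {m : SimMsg n' M} {st : S} (h : d k = some (.msg m))
    (hst : (history A j d k).state = some st) :
    history A j d (k + 1) = (history A j d k).next A j (A.δ j st (some (m.1, m.2.2)))
      ((history A j d k).received ++ [m]) := by
  simp [history, h, hst]

variable (A j d k) in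
theorem history_succ_eq_or_exists_next :
    history A j d (k + 1) = history A j d k ∨
      ∃ r l, history A j d (k + 1) =
        (history A j d k).next A j r ((history A j d k).received ++ l) := by
  simp only [history]
  split
  · exact .inr ⟨_, [], by rw [List.append_nil]⟩
  · exact .inr ⟨_, _, rfl⟩
  · exact .inl rfl

theorem history_outs_prefix (h : k ≤ k') (x : Fin n') :
    (history A j d k).outs x <+: (history A j d k').outs x := by
  induction h with
  | refl => exact List.prefix_rfl
  | @step l _ ih =>
    refine ih.trans ?_
    rcases history_succ_eq_or_exists_next A j d l with h | ⟨r, _, h⟩ <;> simp [h, History.next]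

theorem history_received_prefix (h : k ≤ k') :
    (history A j d k).received <+: (history A j d k').received := by
  induction h with
  | refl => exact List.prefix_rfl
  | @step l _ ih =>
    refine ih.trans ?_
    rcases history_succ_eq_or_exists_next A j d l with h | ⟨r, _, h⟩ <;> simp [h, History.next]

theorem history_decided_ne_none (h : (history A j d k).state.bind (A.dec j) ≠ none) :
    (history A j d k).decided ≠ none := by
  induction k with
  | zero => simp [history] at h
  | succ k ih =>
    rcases history_succ_eq_or_exists_next A j d k with hnext | ⟨r, l, hnext⟩
    · rw [hnext] at h ⊢
      exact ih h
    · rw [hnext] at h ⊢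
      simp only [History.next, Option.bind_some] at h ⊢
      simp [h]

theorem history_decided_succ :
    (history A j d (k + 1)).decided =
      (history A j d k).decided.or ((history A j d (k + 1)).state.bind (A.dec j)) := by
  rcases history_succ_eq_or_exists_next A j d k with h | ⟨r, l, h⟩
  · rw [h]
    cases hdec : (history A j d k).decided with
    | some v => rfl
    | none =>
      exact (not_not.1 (mt (history_decided_ne_none (A := A) (j := j)) (not_not.2 hdec))).symm
  · simp [h, History.next]

theorem history_bind_dec_eq_none (h : (history A j d k).decided = none) {l : ℕ} (hl : l ≤ k) :
    (history A j d l).state.bind (A.dec j) = none := by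
  induction hl with
  | refl => exact not_not.1 (mt history_decided_ne_none (not_not.2 h))
  | step _ ih => exact ih (Option.or_eq_none_iff.1 (history_decided_succ.symm.trans h)).1

theorem exists_first_of_history_decided {v : Out} (h : (history A j d k).decided = some v) :
    ∃ k' ≤ k, (history A j d k').state.bind (A.dec j) = some v ∧
      ∀ l < k', (history A j d l).state.bind (A.dec j) = none := by
  induction k with
  | zero => simp [history] at h
  | succ k ih =>
    rw [history_decided_succ] at h
    cases hdec : (history A j d k).decided with
    | some v' =>
      rw [hdec, Option.some_or] at h
      obtain ⟨k', hk', hfirst⟩ := ih (hdec.trans h)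
      exact ⟨k', hk'.trans k.le_succ, hfirst⟩
    | none =>
      rw [hdec, Option.none_or] at h
      exact ⟨k + 1, le_rfl, h, fun l hl => history_bind_dec_eq_none hdec (Nat.lt_succ_iff.1 hl)⟩

end History

namespace SimTrace

section Count

variable {n n' : ℕ} {In Out M S : Type*} {e : SimTrace n n' In Out M S} {i : Fin n} {τ : ℕ}
  {s : SimState n n' In Out M S} {j : Fin n'}

/-- The largest number of transitions of `p_j` that some simulator has simulated at time `τ`. -/
def count (e : SimTrace n n' In Out M S) (τ : ℕ) (j : Fin n') : ℕ :=
  Finset.univ.sup fun i => ((e.cfg τ).loc i).elim 0 fun s => s.sn j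

theorem count_le_iff {b : ℕ} :
    e.count τ j ≤ b ↔ ∀ i s, (e.cfg τ).loc i = some s → s.sn j ≤ b := by
  simp only [count, Finset.sup_le_iff, Finset.mem_univ, true_implies]
  refine forall_congr' fun i => ?_
  cases (e.cfg τ).loc i <;> simp

theorem sn_le_count (hs : (e.cfg τ).loc i = some s) (j : Fin n') : s.sn j ≤ e.count τ j :=
  count_le_iff.1 le_rfl i s hs

end Count

section Agreed

variable {n n' : ℕ} {In Out M S : Type*} [LinearOrder (SAVal n' In M)]

open Classical in
/-- The value on which the simulators agree for the safe agreement object `o`, or `none` if no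
simulator ever obtains a value from it. -/
def agreed (e : SimTrace n n' In Out M S) (o : Fin n' × ℕ) : Option (SAVal n' In M) :=
  if h : ∃ v i τ s, (e.cfg τ).loc i = some s ∧ (s.sa o).result = some v then some h.choose else none

/-- The history of `p_j` after `k` simulated transitions. -/
abbrev simulated (A : Algorithm n' In Out M S) (e : SimTrace n n' In Out M S) (j : Fin n')
    (k : ℕ) : History n' Out M S :=
  history A j (fun l => e.agreed (j, l)) k

theorem exists_result_of_agreed_eq_some {e : SimTrace n n' In Out M S} {o : Fin n' × ℕ}
    {v : SAVal n' In M} (h : e.agreed o = some v) :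
    ∃ i τ s, (e.cfg τ).loc i = some s ∧ (s.sa o).result = some v := by
  unfold agreed at h
  split_ifs at h with hex
  rw [← Option.some.inj h]
  exact hex.choose_spec

end Agreed

end SimTrace

theorem filter_append_mapIdx_sender {n' : ℕ} {M : Type*} {l : List (SimMsg n' M)} {ms : List M}
    {a j : Fin n'} {c : ℕ} :
    (l ++ ms.mapIdx fun k m => (j, c + k, m)).filter (fun b => decide (b.1 = a)) =
      l.filter (fun b => decide (b.1 = a)) ++
        if a = j then ms.mapIdx fun k m => (j, c + k, m) else [] := by
  rw [List.filter_append]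
  congr 1
  split_ifs with h
  · rw [List.filter_eq_self]
    intro b hb
    obtain ⟨k, hk, rfl⟩ := List.mem_mapIdx.1 hb
    simp [h]
  · rw [List.filter_eq_nil_iff]
    intro b hb
    obtain ⟨k, hk, rfl⟩ := List.mem_mapIdx.1 hb
    simpa using fun h' => h h'.symm

section Matches

variable {n n' t : ℕ} {In Out M S : Type*} [LinearOrder (SAVal n' In M)]
  {A : Algorithm n' In Out M S} {inp : Fin n → Fin n' → In} {e : SimTrace n n' In Out M S}
  {i : Fin n} {τ τ' : ℕ} {s : SimState n n' In Out M S} {o : Fin n' × ℕ} {j : Fin n'}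
  {v : SAVal n' In M}

/-- What the simulator state `s` records about `p_j` is the history of `p_j`. -/
structure Matches (A : Algorithm n' In Out M S) (e : SimTrace n n' In Out M S)
    (s : SimState n n' In Out M S) (j : Fin n') : Prop where
  state : s.state j = (e.simulated A j (s.sn j)).state
  received : s.received j = (e.simulated A j (s.sn j)).received
  decided : s.decided j = (e.simulated A j (s.sn j)).decided
  sent : ∀ x, (s.sent x).filter (fun a => decide (a.1 = j)) =
    ((e.simulated A j (s.sn j)).outs x).mapIdx fun k m => (j, k, m)

namespace Matches

theorem initial (A : Algorithm n' In Out M S) (e : SimTrace n n' In Out M S) (input : Fin n' → In)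
    (j : Fin n') : Matches A e (SimState.initial input) j := by
  constructor <;> simp [SimState.initial, history]

theorem advance {a : Fin n'} (h : ∀ j, Matches A e s j) {r : S × (Fin n' → List M)}
    {l : List (SimMsg n' M)} {input : Fin n' → In}
    (hnext : e.simulated A j (s.sn j + 1) = (e.simulated A j (s.sn j)).next A j r l) :
    Matches A e ({ s with
      input := input
      received := Function.update s.received j l }.advance A j r) a := by
  rcases eq_or_ne a j with rfl | ha
  · refine ⟨?_, ?_, ?_, fun x => ?_⟩
    · simp [SimState.advance, hnext, History.next]
    · simp [SimState.advance, hnext, History.next, SimState.goto]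
    · simp [SimState.advance, hnext, History.next, (h a).decided]
    · simp only [SimState.advance, Function.update_self, hnext, History.next]
      rw [filter_append_mapIdx_sender, if_pos rfl, (h a).sent x, List.countP_eq_length_filter,
        (h a).sent x, List.mapIdx_append]
      simp only [List.length_mapIdx, Nat.add_comm]
  · refine ⟨?_, ?_, ?_, fun x => ?_⟩
    · simpa [SimState.advance, ha, SimState.goto] using (h a).state
    · simpa [SimState.advance, ha, SimState.goto] using (h a).received
    · simpa [SimState.advance, ha, SimState.goto] using (h a).decided
    · simp only [SimState.advance, ne_eq, ha, not_false_eq_true, Function.update_of_ne]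
      rw [filter_append_mapIdx_sender, if_neg ha, (h a).sent x, List.append_nil]

theorem obtain {a : Fin n'} (h : ∀ j, Matches A e s j) (hv : s.Accepts j v)
    (hagreed : e.agreed (j, s.sn j) = some v) : Matches A e (s.obtain A j v) a := by
  cases v with
  | input v =>
    have hadvance := advance (a := a) (input := Function.update s.input j v) h
      (history_succ_of_input (A := A) (d := fun l => e.agreed (j, l)) hagreed)
    rwa [← (h j).received, Function.update_eq_self] at hadvance
  | msg m =>
    obtain ⟨st, hst⟩ := Option.ne_none_iff_exists'.1 hv
    have hadvance := advance (a := a) (input := s.input) h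
      (history_succ_of_msg (A := A) (d := fun l => e.agreed (j, l)) hagreed
        ((h j).state.symm.trans hst))
    rw [← (h j).received] at hadvance
    simpa only [SimState.obtain, hst] using hadvance

theorem mem_sent_iff {m : SimMsg n' M} (h : Matches A e s m.1) :
    m ∈ s.sent j ↔ ((e.simulated A m.1 (s.sn m.1)).outs j)[m.2.1]? = some m.2.2 := by
  calc m ∈ s.sent j
    _ ↔ m ∈ (s.sent j).filter (fun a => decide (a.1 = m.1)) := by simp
    _ ↔ ∃ (k : ℕ) (hk : k < _), (m.1, k, _) = m := by rw [h.sent, List.mem_mapIdx]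
    _ ↔ _ := by
      rw [List.getElem?_eq_some_iff]
      refine ⟨?_, fun ⟨hk, hm⟩ => ⟨_, hk, by rw [hm]⟩⟩
      rintro ⟨k, hk, heq⟩
      rw [← heq]
      exact ⟨hk, rfl⟩

end Matches

namespace IsExecution

theorem agreed_eq_some (he : IsExecution (simulation n A) inp t e) (hs : (e.cfg τ).loc i = some s)
    (hr : (s.sa o).result = some v) : e.agreed o = some v := by
  have h : ∃ v i τ s, (e.cfg τ).loc i = some s ∧ (s.sa o).result = some v := ⟨v, i, τ, s, hs, hr⟩
  obtain ⟨i', τ', s', hs', hr'⟩ := h.choose_spec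
  rw [SimTrace.agreed, dif_pos h, he.eq_of_result_eq_some hs' hs hr' hr]

theorem matches_simulated (he : IsExecution (simulation n A) inp t e)
    (hs : (e.cfg τ).loc i = some s) (j : Fin n') : Matches A e s j := by
  induction τ generalizing s j with
  | zero => simp [he.init, Config.initial] at hs
  | succ τ ih =>
    rcases he.loc_succ_cases τ i with h | ⟨-, h⟩ | ⟨a, b, out, ha, hb, hstep, -⟩
    · exact ih (h ▸ hs) j
    · obtain rfl : SimState.initial (inp i) = s := by simpa [h] using hs
      exact .initial A e _ j
    · obtain rfl : b = s := by simpa [hb] using hs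
      cases hstep with
      | obtain j' v _ hr hv => exact .obtain (fun j => ih ha j) hv (he.agreed_eq_some ha hr)
      | _ =>
        obtain ⟨hstate, hreceived, hdecided, hsent⟩ := ih ha j
        exact ⟨hstate, hreceived, hdecided, hsent⟩

theorem count_mono (he : IsExecution (simulation n A) inp t e) (h : τ ≤ τ') (j : Fin n') :
    e.count τ j ≤ e.count τ' j := by
  refine SimTrace.count_le_iff.2 fun i s hs => ?_
  obtain ⟨s', hs', hlater⟩ := he.exists_later h hs
  exact (hlater.threadLE j).sn_le.trans (SimTrace.sn_le_count hs' j)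

theorem count_zero (he : IsExecution (simulation n A) inp t e) (j : Fin n') : e.count 0 j = 0 :=
  Nat.le_zero.1 <| SimTrace.count_le_iff.2 fun i s hs => by
    simp [he.init, Config.initial] at hs

theorem count_succ_eq_max (he : IsExecution (simulation n A) inp t e)
    (hs : (e.cfg (τ + 1)).loc i = some s)
    (hother : ∀ i' ≠ i, (e.cfg (τ + 1)).loc i' = (e.cfg τ).loc i') (j : Fin n') :
    e.count (τ + 1) j = max (e.count τ j) (s.sn j) := by
  refine le_antisymm (SimTrace.count_le_iff.2 fun i' s' hs' => ?_)
    (max_le (he.count_mono τ.le_succ j) (SimTrace.sn_le_count hs j))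
  rcases eq_or_ne i' i with rfl | hne
  · obtain rfl : s' = s := by simpa [hs] using hs'.symm
    exact le_max_right _ _
  · exact le_max_of_le_left (SimTrace.sn_le_count (hother i' hne ▸ hs') j)

theorem count_succ_eq_or_update (he : IsExecution (simulation n A) inp t e) (τ : ℕ) :
    e.count (τ + 1) = e.count τ ∨
    ∃ j i s v, (e.cfg τ).loc i = some s ∧ s.sn j = e.count τ j ∧
      (s.sa (j, e.count τ j)).result = some v ∧
      e.count (τ + 1) = Function.update (e.count τ) j (e.count τ j + 1) := by
  by_cases hsame : ∀ i, (e.cfg (τ + 1)).loc i = (e.cfg τ).loc i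
  · exact .inl (funext fun j => by simp only [SimTrace.count, hsame])
  obtain ⟨i, hi⟩ := not_forall.1 hsame
  have hmax {s'} (hs' : (e.cfg (τ + 1)).loc i = some s') :=
    he.count_succ_eq_max hs' fun _ => he.loc_eq_of_ne hi
  rcases he.loc_succ_cases τ i with h | ⟨-, hs'⟩ | ⟨s, s', out, hs, hs', hstep, -⟩
  · exact absurd h hi
  · exact .inl (funext fun j => (hmax hs' j).trans (max_eq_left (Nat.zero_le _)))
  have hle := SimTrace.sn_le_count hs
  cases hstep with
  | obtain j v _ hr hv =>
    rcases (hle j).lt_or_eq with hlt | heq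
    · left
      funext a
      rw [hmax hs', SimState.obtain_sn hv]
      rcases eq_or_ne a j with rfl | ha <;> simp [*]
    · refine .inr ⟨j, i, s, v, hs, heq, heq ▸ hr, funext fun a => ?_⟩
      rw [hmax hs', SimState.obtain_sn hv]
      rcases eq_or_ne a j with rfl | ha <;> simp [*]
  | _ => exact .inl (funext fun j => (hmax hs' j).trans (max_eq_left (hle j)))

end IsExecution

end Matches

/-! ### Blocked processes -/

section Progress

open Filter

variable {n n' t : ℕ} {In Out M S : Type*} {e : SimTrace n n' In Out M S} {i x : Fin n}
  {s : SimState n n' In Out M S} {j : Fin n'}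

theorem SimState.oldest_ne_none {m : SimMsg n' M} (hsent : m ∈ s.sent j)
    (hreceived : m ∉ s.received j) : s.oldest j ≠ none :=
  fun h => List.find?_eq_none.1 h m hsent (by simpa using hreceived)

theorem SimState.Viewed.of_later {s' : SimState n n' In Out M S} {o : Fin n' × ℕ}
    (h : s.Viewed o) (hlater : s.Later s') : s'.Viewed o := by
  have hle := hlater.threadLE o.1
  unfold SimState.Viewed SimState.ThreadLE at *
  grind

theorem exists_waitMsg_of_not_blocked (hb : ¬ Blocked e i j) (τ₀ : ℕ) :
    ∃ τ ≥ τ₀, ∃ s, (e.cfg τ).loc i = some s ∧ s.pc j = .waitMsg := by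
  simp only [Blocked, not_exists, not_forall] at hb
  obtain ⟨τ, hτ, s, hs, h⟩ := hb τ₀
  refine ⟨τ, hτ, s, hs, ?_⟩
  cases hpc : s.pc j <;> simp_all

/-- The simulator `x` crashes while its thread `j` owns the lock. -/
def SimTrace.CrashedIn (e : SimTrace n n' In Out M S) (x : Fin n) (j : Fin n') : Prop :=
  ∃ τ s, x ∈ (e.cfg τ).crashed ∧ (e.cfg τ).loc x = some s ∧ s.queue.head? = some j

variable [LinearOrder (SAVal n' In M)] {A : Algorithm n' In Out M S} {inp : Fin n → Fin n' → In}
  {τ τ' k : ℕ} {s' : SimState n n' In Out M S} {o : Fin n' × ℕ} {v : SAVal n' In M}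

theorem SimTrace.CrashedIn.unique (he : IsExecution (simulation n A) inp t e) {j' : Fin n'}
    (h : e.CrashedIn x j) (h' : e.CrashedIn x j') : j = j' := by
  obtain ⟨τ, s, hcrashed, hs, hhead⟩ := h
  obtain ⟨τ', s', hcrashed', hs', hhead'⟩ := h'
  have heq := he.loc_eq_of_mem_crashed (le_max_left τ τ') hcrashed
  rw [he.loc_eq_of_mem_crashed (le_max_right τ τ') hcrashed', hs, hs'] at heq
  obtain rfl := Option.some.inj heq
  exact Option.some.inj (hhead.symm.trans hhead')

theorem LocalStep.head_eq_or_viewed {inbox : Fin n → Set (NetMsg n n' In M)}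
    {out : Fin n → List (NetMsg n n' In M)} (h : LocalStep A i inbox s s' out)
    (hinv : LockInv s.queue s.pc) (hhead : s.queue.head? = some j) :
    (s'.queue.head? = some j ∧ s'.sn j = s.sn j) ∨ s'.Viewed (j, s.sn j) := by
  obtain ⟨hrank, -⟩ := (hinv.mem_iff j).1 (List.mem_of_head? hhead)
  rcases h.threadLE j with hlt | ⟨hsn, hpc⟩
  · exact .inr (.inl hlt)
  rcases le_or_gt (4 + n) (s'.pc j).rank with hviewed | hviewed
  · exact .inr (.inr ⟨hsn, hviewed⟩)
  have hmem : j ∈ s'.queue :=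
    ((h.lockInv hinv).mem_iff j).2 ⟨by rcases hpc with hpc | hpc <;> grind, hviewed.le⟩
  refine .inl ⟨?_, hsn.symm⟩
  rcases h.head_cases hinv hhead with ⟨⟨l, hl⟩, -⟩ | ⟨hsame, -⟩ | htail
  · simp [← hl, List.head?_append, hhead]
  · rw [hsame, hhead]
  · obtain ⟨l, hl⟩ := List.head?_eq_some_iff.1 hhead
    rw [htail, hl, List.tail_cons] at hmem
    exact absurd hmem (List.nodup_cons.1 (hl ▸ hinv.nodup)).1

namespace IsExecution

theorem eq_input_or_eq_msg_of_result (he : IsExecution (simulation n A) inp t e)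
    (hs : (e.cfg τ).loc i = some s) (hr : (s.sa (j, k)).result = some v) :
    (k = 0 ∧ ∃ x, v = .input (inp x j)) ∨ (0 < k ∧ ∃ m, v = .msg m ∧
      m ∉ (e.simulated A j k).received ∧
      ((e.simulated A m.1 (e.count τ m.1)).outs j)[m.2.1]? = some m.2.2) := by
  obtain ⟨x, hx⟩ := he.exists_proposed_of_result_eq_some hs hr
  rcases he.eq_input_or_eq_msg_of_proposed hx with
    ⟨hk, hv⟩ | ⟨hk, m, hv, u, hu, s', hs', hsn, hold⟩
  · exact .inl ⟨hk, x, hv⟩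
  · refine .inr ⟨hk, m, hv, ?_, ?_⟩
    · have hreceived := SimState.not_mem_received_of_oldest hold
      rwa [(he.matches_simulated hs' j).received, hsn] at hreceived
    · refine getElem?_eq_some_of_isPrefix (history_outs_prefix ?_ j)
        ((he.matches_simulated hs' m.1).mem_sent_iff.1 (SimState.mem_sent_of_oldest hold))
      exact (SimTrace.sn_le_count hs' _).trans (he.count_mono hu.le _)

theorem exists_sn_lt_of_closed (he : IsExecution (simulation n A) inp t e) (htn : 2 * t < n)
    (hi : e.Correct i) (hs : (e.cfg τ).loc i = some s)
    (hwait : ∀ u ≥ τ, ∀ s', (e.cfg u).loc i = some s' → s'.sn j = s.sn j → s'.pc j = .waitMsg →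
      s'.oldest j ≠ none)
    {u₀ : ℕ} {s₀ : SimState n n' In Out M S} (hx : (e.cfg u₀).loc x = some s₀)
    {σ : Finset (Fin n)} (hσ : (s₀.sa (j, s.sn j)).Closed σ) :
    ∃ u ≥ τ, ∃ s', (e.cfg u).loc i = some s' ∧ s.sn j < s'.sn j := by
  obtain ⟨u, hu, s', hs', hlt | ⟨hsn, hdec⟩⟩ := he.exists_proposeDone htn hi hs hwait
  · exact ⟨u, hu, s', hs', hlt⟩
  rw [hsn] at hσ ⊢
  obtain ⟨u', hu', h⟩ := he.exists_sn_lt_of_deciding hi hs' hdec hx hσ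
  exact ⟨u', hu.le.trans hu', h⟩

theorem mem_sent_of_count_le_sn (he : IsExecution (simulation n A) inp t e)
    (hs : (e.cfg τ).loc i = some s) {m : SimMsg n' M}
    (hm : ((e.simulated A m.1 k).outs j)[m.2.1]? = some m.2.2) (hk : k ≤ s.sn m.1) :
    m ∈ s.sent j :=
  (he.matches_simulated hs _).mem_sent_iff.2
    (getElem?_eq_some_of_isPrefix (history_outs_prefix hk j) hm)

theorem exists_count_le_sn (he : IsExecution (simulation n A) inp t e) (htn : 2 * t < n)
    (hi : e.Correct i) (τ : ℕ) (j : Fin n') :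
    ∃ u s, (e.cfg u).loc i = some s ∧ e.count τ j ≤ s.sn j := by
  induction τ generalizing j with
  | zero =>
    obtain ⟨u, s, hs⟩ := (he.eventually_exists_loc hi).exists
    exact ⟨u, s, hs, by simp [he.count_zero]⟩
  | succ τ ih =>
    rcases he.count_succ_eq_or_update τ with h | ⟨a, p, s₀, v, hs₀, -, hr, h⟩
    · rw [h]; exact ih j
    rw [h]
    rcases eq_or_ne j a with rfl | hja
    swap
    · rw [Function.update_of_ne hja]; exact ih j
    rw [Function.update_self]
    obtain ⟨σ, hσ, -⟩ := SAState.returns_of_result_eq_some hr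
    suffices hwait : ∃ u s, (e.cfg u).loc i = some s ∧ e.count τ j ≤ s.sn j ∧
        ∀ u' ≥ u, ∀ s', (e.cfg u').loc i = some s' → s'.sn j = e.count τ j →
          s'.pc j = .waitMsg → s'.oldest j ≠ none by
      obtain ⟨u, s, hs, hle, hwait⟩ := hwait
      rcases hle.lt_or_eq with hlt | heq
      · exact ⟨u, s, hs, hlt⟩
      rw [heq] at hσ hwait ⊢
      obtain ⟨u', -, h⟩ := he.exists_sn_lt_of_closed htn hi hs hwait hs₀ hσ
      exact ⟨u', h⟩
    obtain ⟨u, s, hs, hle⟩ := ih j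
    rcases he.eq_input_or_eq_msg_of_result hs₀ hr with ⟨h0, -⟩ | ⟨-, m, -, hreceived, hm⟩
    · refine ⟨u, s, hs, hle, fun u' _ s' hs' hsn hpc => ?_⟩
      exact absurd ((he.threadInv hs' j).sn_pos hpc) (by omega)
    · obtain ⟨u₁, s₁, hs₁, hle₁⟩ := ih m.1
      obtain ⟨s₂, hs₂, hlater⟩ := he.exists_later (le_max_left u u₁) hs
      refine ⟨_, s₂, hs₂, hle.trans (hlater.threadLE j).sn_le, fun u' hu' s' hs' hsn _ => ?_⟩
      have hlater' := he.later ((le_max_right u u₁).trans hu') hs₁ hs'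
      refine SimState.oldest_ne_none
        (he.mem_sent_of_count_le_sn hs' hm (hle₁.trans (hlater'.threadLE _).sn_le)) ?_
      rwa [(he.matches_simulated hs' j).received, hsn]

theorem head_eq_or_viewed (he : IsExecution (simulation n A) inp t e) (h : τ ≤ τ')
    (hs : (e.cfg τ).loc i = some s) (hhead : s.queue.head? = some j)
    (hs' : (e.cfg τ').loc i = some s') :
    (s'.queue.head? = some j ∧ s'.sn j = s.sn j) ∨ s'.Viewed (j, s.sn j) := by
  induction h generalizing s' with
  | refl =>
    obtain rfl : s = s' := by simpa [hs] using hs'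
    exact .inl ⟨hhead, rfl⟩
  | @step u hu ih =>
    rcases he.loc_succ_cases u i with hloc | ⟨hnone, -⟩ | ⟨a, b, out, ha, hb, hstep, -⟩
    · exact ih (hloc ▸ hs')
    · obtain ⟨a, ha, -⟩ := he.exists_later hu hs
      simp [ha] at hnone
    · obtain rfl : b = s' := by simpa [hb] using hs'
      rcases ih ha with ⟨hhead', hsn⟩ | hviewed
      · exact hsn ▸ hstep.head_eq_or_viewed (he.lockInv ha) hhead'
      · exact .inr (hviewed.of_later (he.later u.le_succ ha hs'))

theorem exists_viewed_of_proposed (he : IsExecution (simulation n A) inp t e) (htn : 2 * t < n)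
    (h : e.Proposed o x v τ) (hx : ¬ e.CrashedIn x o.1) :
    ∃ u s, (e.cfg u).loc x = some s ∧ s.Viewed o := by
  obtain ⟨u, -, s, hs, hsn, hpc, hhead⟩ := h
  obtain ⟨j, k⟩ := o
  obtain rfl : s.sn j = k := hsn
  by_cases hc : e.Correct x
  · have hrank : 1 ≤ (s.pc j).rank := by rw [hpc, PC.rank]
    obtain ⟨u', -, s', hs', hlt | ⟨hk, hdec⟩⟩ :=
      he.exists_proposeDone_of_rank_pos htn hc hs hrank
    · exact ⟨u', s', hs', .inl hlt⟩
    · exact ⟨u', s', hs', .inr ⟨hk, by simp [hdec, PC.rank]⟩⟩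
  · obtain ⟨τ', hcrashed⟩ := not_forall_not.1 hc
    obtain ⟨s', hs', -⟩ := he.exists_later (le_max_left u τ') hs
    refine ⟨_, s', hs', ?_⟩
    refine (he.head_eq_or_viewed (le_max_left u τ') hs hhead hs').resolve_left fun h => hx ?_
    exact ⟨_, s', he.crashed_subset (le_max_right u τ') hcrashed, hs', h.1⟩

theorem exists_waitMsg_of_sn_lt (he : IsExecution (simulation n A) inp t e) (h : τ ≤ τ')
    (hs : (e.cfg τ).loc i = some s) (hs' : (e.cfg τ').loc i = some s') (hsn : s.sn j < s'.sn j) :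
    ∃ u ≥ τ, ∃ s₁, (e.cfg u).loc i = some s₁ ∧ s₁.pc j = .waitMsg := by
  induction h generalizing s' with
  | refl =>
    obtain rfl : s = s' := by simpa [hs] using hs'
    exact absurd hsn (lt_irrefl _)
  | @step u hu ih =>
    rcases he.loc_succ_cases u i with hloc | ⟨hnone, -⟩ | ⟨a, b, out, ha, hb, hstep, -⟩
    · exact ih (hloc ▸ hs') hsn
    · obtain ⟨a, ha, -⟩ := he.exists_later hu hs
      simp [ha] at hnone
    · obtain rfl : b = s' := by simpa [hb] using hs'
      rcases lt_or_ge (s.sn j) (a.sn j) with hlt | hge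
      · exact ih ha hlt
      · exact ⟨u + 1, Nat.le_succ_of_le hu, b, hb, hstep.pc_eq_waitMsg_of_sn_lt (hge.trans_lt hsn)⟩

theorem exists_sn_eq_of_blocked (he : IsExecution (simulation n A) inp t e) (hi : e.Correct i)
    (hb : Blocked e i j) : ∃ τ s, (e.cfg τ).loc i = some s ∧
      ∀ u ≥ τ, ∀ s', (e.cfg u).loc i = some s' → s'.pc j ≠ .waitMsg ∧ s'.sn j = s.sn j := by
  obtain ⟨τ₀, hb⟩ := hb
  have hpc : ∀ τ ≥ τ₀, ∀ s, (e.cfg τ).loc i = some s → s.pc j ≠ .waitMsg :=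
    fun τ hτ s hs hpc => by simpa [hpc] using hb τ hτ s hs
  obtain ⟨τ, ⟨s, hs⟩, hτ⟩ :=
    ((he.eventually_exists_loc hi).and (eventually_ge_atTop τ₀)).exists
  refine ⟨τ, s, hs, fun u hu s' hs' => ⟨hpc u (hτ.trans hu) s' hs', ?_⟩⟩
  refine (((he.later hu hs hs').threadLE j).sn_le.eq_of_not_lt fun hlt => ?_).symm
  obtain ⟨u', hu', s₁, hs₁, hwait⟩ := he.exists_waitMsg_of_sn_lt hu hs hs' hlt
  exact hpc u' (hτ.trans hu') s₁ hs₁ hwait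

theorem exists_count_le_of_blocked (he : IsExecution (simulation n A) inp t e) (htn : 2 * t < n)
    (hi : e.Correct i) (hb : Blocked e i j) : ∃ b, ∀ τ, e.count τ j ≤ b := by
  obtain ⟨τ₀, s₀, -, hstuck⟩ := he.exists_sn_eq_of_blocked hi hb
  refine ⟨s₀.sn j, fun τ => ?_⟩
  obtain ⟨u, s, hs, hle⟩ := he.exists_count_le_sn htn hi τ j
  obtain ⟨s', hs', hlater⟩ := he.exists_later (le_max_left u τ₀) hs
  rw [← (hstuck _ (le_max_right u τ₀) s' hs').2]
  exact hle.trans (hlater.threadLE j).sn_le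

end IsExecution

end Progress

section Blocking

open Filter

variable {n n' t : ℕ} {In Out M S : Type*} [LinearOrder (SAVal n' In M)]
  {A : Algorithm n' In Out M S} {inp : Fin n → Fin n' → In} {e : SimTrace n n' In Out M S}
  {i x y z p : Fin n} {τ : ℕ} {s : SimState n n' In Out M S} {j : Fin n'} {o : Fin n' × ℕ}

namespace IsExecution

theorem eventually_allViews_ne_none (he : IsExecution (simulation n A) inp t e)
    (htn : 2 * t < n) (hs : (e.cfg τ).loc i = some s) (hy : (s.sa o).values y ≠ none)
    (hcrash : ¬ e.CrashedIn y o.1) (hp : e.Correct p) :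
    ∀ᶠ u in atTop, ∀ s', (e.cfg u).loc p = some s' → (s'.sa o).allViews y ≠ none := by
  obtain ⟨v, hv⟩ := Option.ne_none_iff_exists'.1 hy
  obtain ⟨u, s₁, hs₁, hviewed⟩ :=
    he.exists_viewed_of_proposed htn (he.proposed_of_values_eq_some hs hv) hcrash
  obtain ⟨w, hw⟩ := he.exists_view_mem_chan_of_viewed hs₁ hviewed
  filter_upwards [he.eventually_mem_log hp (hw p)] with u' h s' hs'
  exact (he.consistent hs' o).allViews_ne_none _ _ _ (h s' hs')

theorem exists_values_ne_none_of_allViews (he : IsExecution (simulation n A) inp t e)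
    (hs : (e.cfg τ).loc i = some s) {w : Fin n → Option (SAVal n' In M)}
    (hw : (s.sa o).allViews y = some w) (hz : w z ≠ none) (hp : e.Correct p) :
    ∃ u s', (e.cfg u).loc p = some s' ∧ (s'.sa o).values z ≠ none := by
  obtain ⟨u, -, s₁, k, hs₁, hsn, hk, hpc⟩ := he.proposedView_of_allViews_eq_some hs hw
  have hmajority := (he.threadInv hs₁ o.1).reading k w hpc z (z.isLt.trans_le hk)
  obtain ⟨v, hv⟩ := Option.ne_none_iff_exists'.1 hz
  rw [hv, Option.elim_some, hsn] at hmajority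
  obtain ⟨q, hq⟩ := hmajority.exists_mem
  obtain ⟨u', s', hs', hlog⟩ := he.exists_mem_log hp (he.value_mem_chan_of_mem_log hs₁ hq p)
  exact ⟨u', s', hs', (he.consistent hs' o).values_ne_none _ _ _ hlog⟩

theorem exists_closed (he : IsExecution (simulation n A) inp t e) (htn : 2 * t < n)
    (hi : e.Correct i) (hs : (e.cfg τ).loc i = some s) (hx : (s.sa o).values x ≠ none)
    (hcrash : ∀ y, ¬ e.CrashedIn y o.1) :
    ∃ u s' σ, (e.cfg u).loc i = some s' ∧ (s'.sa o).Closed σ := by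
  classical
  let σ : Finset (Fin n) := Finset.univ.filter fun y =>
    ∃ u s, (e.cfg u).loc i = some s ∧ (s.sa o).values y ≠ none
  have hσ {y} : y ∈ σ ↔ ∃ u s, (e.cfg u).loc i = some s ∧ (s.sa o).values y ≠ none := by
    simp [σ]
  have hknown : ∀ᶠ u in atTop, ∀ y ∈ σ, ∀ s', (e.cfg u).loc i = some s' →
      (s'.sa o).values y ≠ none ∧ (s'.sa o).allViews y ≠ none := by
    refine eventually_all.2 fun y => eventually_imp_distrib_left.2 fun hy => ?_
    obtain ⟨u, s₁, hs₁, hy⟩ := hσ.1 hy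
    filter_upwards [he.eventually_values_ne_none hs₁ hy hi,
      he.eventually_allViews_ne_none htn hs₁ hy (hcrash y) hi] with u' hvalue hview s' hs'
    exact ⟨hvalue s' hs', hview s' hs'⟩
  obtain ⟨u, hu, s', hs'⟩ := (hknown.and (he.eventually_exists_loc hi)).exists
  refine ⟨u, s', σ, hs', ⟨x, hσ.2 ⟨τ, s, hs, hx⟩⟩, fun y hy => ?_⟩
  obtain ⟨hvalue, hview⟩ := hu y hy s' hs'
  obtain ⟨w, hw⟩ := Option.ne_none_iff_exists'.1 hview
  exact ⟨hvalue, w, hw, fun z hz => hσ.2 (he.exists_values_ne_none_of_allViews hs' hw hz hi)⟩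

theorem exists_crashedIn_of_blocked (he : IsExecution (simulation n A) inp t e)
    (htn : 2 * t < n) (hi : e.Correct i) (hb : Blocked e i j) : ∃ x, e.CrashedIn x j := by
  by_contra! hcrash
  obtain ⟨τ, s, hs, hstuck⟩ := he.exists_sn_eq_of_blocked hi hb
  obtain ⟨u, hu, s₁, hs₁, hdone⟩ := he.exists_proposeDone htn hi hs
    fun u' hu' s' hs' _ hpc => absurd hpc (hstuck u' hu' s' hs').1
  have hsn := (hstuck u hu s₁ hs₁).2
  have hpc : s₁.pc j = .deciding := by grind [SimState.ProposeDone]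
  obtain ⟨v, hv⟩ := (he.threadInv hs₁ j).value_majority (s₁.sn j)
    (.inr ⟨rfl, by simp only [hpc, PC.rank]; omega⟩)
  obtain ⟨q, hq⟩ := hv.exists_mem
  obtain ⟨u₀, s₀, σ, hs₀, hσ⟩ := he.exists_closed htn hi hs₁
    ((he.consistent hs₁ _).values_ne_none _ _ _ hq) hcrash
  obtain ⟨u', hu', s', hs', hlt⟩ := he.exists_sn_lt_of_deciding hi hs₁ hpc hs₀ hσ
  rw [hsn, (hstuck u' (hu.le.trans hu') s' hs').2] at hlt
  exact lt_irrefl _ hlt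

end IsExecution

end Blocking

/-! ### Steps of the simulated processes -/

section SimulatedStep

open Filter

variable {n n' t : ℕ} {In Out M S : Type*}

theorem SimState.mem_of_oldest_of_isPrefix {s : SimState n n' In Out M S} {j : Fin n'}
    {l : List (SimMsg n' M)} {a m : SimMsg n' M} (hl : l <+: s.sent j) (hm : m ∈ l)
    (hreceived : m ∉ s.received j) (ha : s.oldest j = some a) : a ∈ l := by
  obtain ⟨l', hl'⟩ := hl
  classical
  have hne : (l.find? fun m => decide (m ∉ s.received j)) ≠ none :=
    fun h => List.find?_eq_none.1 h m hm (by simpa using hreceived)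
  obtain ⟨b, hb⟩ := Option.ne_none_iff_exists'.1 hne
  rw [SimState.oldest, ← hl', List.find?_append, hb, Option.some_or] at ha
  exact Option.some.inj ha ▸ List.mem_of_find?_eq_some hb

theorem history_received_subset {A : Algorithm n' In Out M S} {d : ℕ → Option (SAVal n' In M)}
    {j : Fin n'} {k l : ℕ} {a : SimMsg n' M} (ha : a ∈ (history A j d k).received) :
    a ∈ (history A j d l).received ∨ ∃ k' ≥ l, d k' = some (.msg a) := by
  induction k with
  | zero => simp [history] at ha
  | succ k ih =>
    rcases lt_or_ge k l with hkl | hlk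
    · exact .inl ((history_received_prefix hkl).subset ha)
    simp only [history] at ha
    split at ha
    · exact ih ha
    · rcases List.mem_append.1 ha with ha | ha
      · exact ih ha
      · obtain rfl := List.mem_singleton.1 ha
        exact .inr ⟨k, hlk, ‹_›⟩
    · exact ih ha

variable [LinearOrder (SAVal n' In M)] {A : Algorithm n' In Out M S}
  {inp : Fin n → Fin n' → In} {e : SimTrace n n' In Out M S} {i : Fin n} {τ k : ℕ}
  {s : SimState n n' In Out M S} {j : Fin n'} {label : Option (Fin n' × Event n' Empty)}

/-- The step of a simulated process that some simulator simulates between the times `τ` and `τ + 1`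
while no simulator did before, if any; the other simulators only repeat it later. -/
inductive SimulatedStep (A : Algorithm n' In Out M S) (e : SimTrace n n' In Out M S) (τ : ℕ) :
    Option (Fin n' × Event n' Empty) → Prop
  | idle : e.count (τ + 1) = e.count τ → SimulatedStep A e τ none
  | start (j : Fin n') (v : In) : e.count τ j = 0 → e.agreed (j, 0) = some (.input v) →
      e.count (τ + 1) = Function.update (e.count τ) j (e.count τ j + 1) →
      SimulatedStep A e τ (some (j, .start))
  | recv (j : Fin n') (m : SimMsg n' M) (st : S) :
      e.agreed (j, e.count τ j) = some (.msg m) →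
      (e.simulated A j (e.count τ j)).state = some st →
      m ∉ (e.simulated A j (e.count τ j)).received →
      ((e.simulated A m.1 (e.count τ m.1)).outs j)[m.2.1]? = some m.2.2 →
      e.count (τ + 1) = Function.update (e.count τ) j (e.count τ j + 1) →
      SimulatedStep A e τ (some (j, .recv m.1 m.2.1))

namespace SimulatedStep

theorem count_succ_le (h : SimulatedStep A e τ label) (j : Fin n') :
    e.count (τ + 1) j ≤ e.count τ j + 1 := by
  cases h with
  | idle hcount => simp [hcount]
  | start a _ _ _ hcount | recv a _ _ _ _ _ _ hcount =>
    rw [hcount]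
    rcases eq_or_ne j a with rfl | hj <;> simp [*]

theorem received_eq_or (h : SimulatedStep A e τ label) (j : Fin n') :
    ((e.simulated A j (e.count (τ + 1) j)).received =
        (e.simulated A j (e.count τ j)).received ∧ ∀ q r, label ≠ some (j, .recv q r)) ∨
      ∃ m : SimMsg n' M, label = some (j, .recv m.1 m.2.1) ∧
        m ∉ (e.simulated A j (e.count τ j)).received ∧
        ((e.simulated A m.1 (e.count τ m.1)).outs j)[m.2.1]? = some m.2.2 ∧
        (e.simulated A j (e.count (τ + 1) j)).received =
          (e.simulated A j (e.count τ j)).received ++ [m] := by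
  cases h with
  | idle hcount => simp [hcount]
  | start a v hzero hv hcount =>
    refine .inl ⟨?_, by simp⟩
    rcases eq_or_ne j a with rfl | hj
    · rw [hcount, Function.update_self, hzero, SimTrace.simulated, history_succ_of_input hv]
      rfl
    · rw [hcount, Function.update_of_ne hj]
  | recv a m st hm hst hnew hsent hcount =>
    rcases eq_or_ne j a with rfl | hj
    · refine .inr ⟨m, rfl, hnew, hsent, ?_⟩
      rw [hcount, Function.update_self, SimTrace.simulated, history_succ_of_msg hm hst]
      rfl
    · refine .inl ⟨by rw [hcount, Function.update_of_ne hj], fun q r h => hj ?_⟩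
      exact (Prod.mk.inj (Option.some.inj h)).1.symm

theorem length_received_succ (h : SimulatedStep A e τ label)
    (hlen : (e.simulated A j (e.count τ j)).received.length = e.count τ j - 1) :
    (e.simulated A j (e.count (τ + 1) j)).received.length = e.count (τ + 1) j - 1 := by
  cases h with
  | idle hcount => rw [hcount, hlen]
  | start a v hzero hv hcount =>
    rcases eq_or_ne j a with rfl | hj
    · rw [hcount, Function.update_self, hzero, SimTrace.simulated, history_succ_of_input hv]
      rfl
    · rw [hcount, Function.update_of_ne hj, hlen]
  | recv a m st hm hst hnew hsent hcount =>
    rcases eq_or_ne j a with rfl | hj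
    · have hpos : e.count τ j ≠ 0 := fun h => by simp [h, history] at hst
      rw [hcount, Function.update_self, SimTrace.simulated, history_succ_of_msg hm hst]
      simp only [History.next, List.length_append, hlen, List.length_singleton]
      omega
    · rw [hcount, Function.update_of_ne hj, hlen]

end SimulatedStep

namespace IsExecution

theorem exists_simulatedStep (he : IsExecution (simulation n A) inp t e) (τ : ℕ) :
    ∃ label, SimulatedStep A e τ label := by
  rcases he.count_succ_eq_or_update τ with hcount | ⟨j, i, s, v, hs, hsn, hr, hcount⟩
  · exact ⟨_, .idle hcount⟩
  have hv := he.agreed_eq_some hs hr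
  rcases he.eq_input_or_eq_msg_of_result hs hr with ⟨hzero, x, rfl⟩ | ⟨hpos, m, rfl, hnew, hsent⟩
  · exact ⟨_, .start j _ hzero (hzero ▸ hv) hcount⟩
  · have hstate : (e.simulated A j (e.count τ j)).state ≠ none := by
      rw [← hsn, ← (he.matches_simulated hs j).state]
      exact mt (he.threadInv hs j).state_eq_none.2 (hsn ▸ hpos.ne')
    obtain ⟨st, hst⟩ := Option.ne_none_iff_exists'.1 hstate
    exact ⟨_, .recv j m st hv hst hnew hsent hcount⟩

theorem outs_getElem?_of_mem_received (he : IsExecution (simulation n A) inp t e)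
    {m : SimMsg n' M} (hm : m ∈ (e.simulated A j (e.count τ j)).received) :
    ((e.simulated A m.1 (e.count τ m.1)).outs j)[m.2.1]? = some m.2.2 := by
  induction τ with
  | zero => simp [he.count_zero, history] at hm
  | succ τ ih =>
    refine getElem?_eq_some_of_isPrefix (history_outs_prefix (he.count_mono τ.le_succ m.1) j) ?_
    obtain ⟨label, hlabel⟩ := he.exists_simulatedStep τ
    rcases hlabel.received_eq_or j with ⟨heq, -⟩ | ⟨m', -, -, hsent, heq⟩ <;> rw [heq] at hm
    · exact ih hm
    · rcases List.mem_append.1 hm with hm | hm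
      · exact ih hm
      · exact List.mem_singleton.1 hm ▸ hsent

theorem nodup_received (he : IsExecution (simulation n A) inp t e) (j : Fin n') (τ : ℕ) :
    (e.simulated A j (e.count τ j)).received.Nodup := by
  induction τ with
  | zero => simp [he.count_zero, history]
  | succ τ ih =>
    obtain ⟨label, hlabel⟩ := he.exists_simulatedStep τ
    rcases hlabel.received_eq_or j with ⟨heq, -⟩ | ⟨m, -, hnew, -, heq⟩ <;> rw [heq]
    · exact ih
    · exact List.concat_eq_append ▸ ih.concat hnew

theorem length_received (he : IsExecution (simulation n A) inp t e) (j : Fin n') (τ : ℕ) :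
    (e.simulated A j (e.count τ j)).received.length = e.count τ j - 1 := by
  induction τ with
  | zero => simp [he.count_zero, history]
  | succ τ ih =>
    obtain ⟨label, hlabel⟩ := he.exists_simulatedStep τ
    exact hlabel.length_received_succ ih

theorem exists_sn_lt_of_not_blocked (he : IsExecution (simulation n A) inp t e) (htn : 2 * t < n)
    (hi : e.Correct i) (hb : ¬ Blocked e i j) (hs : (e.cfg τ).loc i = some s)
    (hwait : ∀ u ≥ τ, ∀ s', (e.cfg u).loc i = some s' → s'.oldest j ≠ none) :
    ∃ u ≥ τ, ∃ s', (e.cfg u).loc i = some s' ∧ s.sn j < s'.sn j := by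
  obtain ⟨u, hu, s', hs', hlt | ⟨hsn, hdec⟩⟩ :=
    he.exists_proposeDone htn hi hs fun u hu s' hs' _ _ => hwait u hu s' hs'
  · exact ⟨u, hu, s', hs', hlt⟩
  obtain ⟨u', hu', s'', hs'', hpc⟩ := exists_waitMsg_of_not_blocked hb u
  refine ⟨u', hu.le.trans hu', s'', hs'', ?_⟩
  rcases (he.later hu' hs' hs'').threadLE j with hlt | ⟨-, heq | hrank⟩
  · exact hsn ▸ hlt
  · simp [hpc, hdec] at heq
  · simp [hpc, PC.rank] at hrank

theorem eventually_mem_sent_or_mem_crashed (he : IsExecution (simulation n A) inp t e)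
    (htn : 2 * t < n) {m : SimMsg n' M}
    (hm : ((e.simulated A m.1 (e.count τ m.1)).outs j)[m.2.1]? = some m.2.2) :
    ∀ᶠ T in atTop, ∀ z, z ∈ (e.cfg T).crashed ∨ ∃ s, (e.cfg T).loc z = some s ∧ m ∈ s.sent j := by
  refine eventually_all.2 fun z => ?_
  by_cases hz : e.Correct z
  · obtain ⟨u, s, hs, hsn⟩ := he.exists_count_le_sn htn hz τ m.1
    filter_upwards [eventually_ge_atTop u] with T hT
    obtain ⟨s', hs', hlater⟩ := he.exists_later hT hs
    exact .inr ⟨s', hs', he.mem_sent_of_count_le_sn hs' hm (hsn.trans (hlater.threadLE _).sn_le)⟩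
  · obtain ⟨u, hu⟩ := not_forall_not.1 hz
    filter_upwards [eventually_ge_atTop u] with T hT
    exact .inl (he.crashed_subset hT hu)

theorem exists_mem_sent_of_agreed (he : IsExecution (simulation n A) inp t e) {T : ℕ}
    {a m : SimMsg n' M} (hk : e.count T j < k) (ha : e.agreed (j, k) = some (.msg a))
    (hm : ∀ z, z ∈ (e.cfg T).crashed ∨ ∃ s, (e.cfg T).loc z = some s ∧ m ∈ s.sent j)
    (hnot : m ∉ (e.simulated A j k).received) :
    ∃ z s, (e.cfg T).loc z = some s ∧ a ∈ s.sent j := by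
  obtain ⟨i, τ, s, hs, hr⟩ := SimTrace.exists_result_of_agreed_eq_some ha
  obtain ⟨z, hz⟩ := he.exists_proposed_of_result_eq_some hs hr
  rcases he.eq_input_or_eq_msg_of_proposed hz with ⟨-, hv⟩ | ⟨-, a', hv, u, -, s', hs', hsn, hold⟩
  · cases hv
  obtain rfl : a = a' := by cases hv; rfl
  obtain rfl : s'.sn j = k := hsn
  have hTu : T ≤ u := by
    by_contra! hlt
    exact ((SimTrace.sn_le_count hs' j).trans (he.count_mono hlt.le j)).not_gt hk
  rcases hm z with hcrashed | ⟨s₀, hs₀, hm⟩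
  · rw [he.loc_eq_of_mem_crashed hTu hcrashed] at hs'
    exact absurd (SimTrace.sn_le_count hs' j) hk.not_ge
  · refine ⟨z, s₀, hs₀, ?_⟩
    refine SimState.mem_of_oldest_of_isPrefix ((he.later hTu hs₀ hs').sent j) hm ?_ hold
    rwa [(he.matches_simulated hs' j).received]

theorem exists_le_count_of_not_blocked (he : IsExecution (simulation n A) inp t e)
    (htn : 2 * t < n) (hi : e.Correct i) (hb : ¬ Blocked e i j) {T : ℕ} {m : SimMsg n' M}
    (hs : (e.cfg T).loc i = some s) (hm : m ∈ s.sent j)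
    (hnot : ∀ u, m ∉ (e.simulated A j (e.count u j)).received) (k : ℕ) :
    ∃ u, k ≤ e.count u j := by
  suffices h : ∃ u ≥ T, ∃ s, (e.cfg u).loc i = some s ∧ k ≤ s.sn j by
    obtain ⟨u, -, s, hs, hk⟩ := h
    exact ⟨u, hk.trans (SimTrace.sn_le_count hs j)⟩
  induction k with
  | zero => exact ⟨T, le_rfl, s, hs, Nat.zero_le _⟩
  | succ k ih =>
    obtain ⟨u, hu, s₁, hs₁, hk⟩ := ih
    obtain ⟨u', hu', s₂, hs₂, hlt⟩ := he.exists_sn_lt_of_not_blocked htn hi hb hs₁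
      fun u' hu' s' hs' => SimState.oldest_ne_none
        (((he.later (hu.le.trans hu') hs hs').sent j).subset hm) fun h => hnot u' <|
          (history_received_prefix (SimTrace.sn_le_count hs' j)).subset
            ((he.matches_simulated hs' j).received ▸ h)
    exact ⟨u', hu.le.trans hu', s₂, hs₂, hk.trans_lt hlt⟩

/- Once `m` is in `sent[j]` at every simulator that is still alive, a simulator only proposes for
`p_j` messages that are not newer than `m` in its own `sent[j]`. There are finitely many of them,
and none is received twice. -/
theorem exists_mem_received (he : IsExecution (simulation n A) inp t e) (htn : 2 * t < n)
    (hb : ∀ i, e.Correct i → ¬ Blocked e i j) {m : SimMsg n' M}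
    (hm : ((e.simulated A m.1 (e.count τ m.1)).outs j)[m.2.1]? = some m.2.2) :
    ∃ u, m ∈ (e.simulated A j (e.count u j)).received := by
  classical
  by_contra! hnot
  obtain ⟨T, hT⟩ := (he.eventually_mem_sent_or_mem_crashed htn hm).exists
  obtain ⟨i, hi⟩ := he.exists_correct (by omega)
  obtain ⟨s, hs, hms⟩ := (hT i).resolve_left (hi T)
  have hunbounded := he.exists_le_count_of_not_blocked htn hi (hb i hi) hs hms hnot
  let F : Finset (SimMsg n' M) := (e.simulated A j (e.count T j + 1)).received.toFinset ∪
    Finset.univ.biUnion fun z => ((e.cfg T).loc z).elim ∅ fun s => (s.sent j).toFinset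
  have hF {u a} (ha : a ∈ (e.simulated A j (e.count u j)).received) : a ∈ F := by
    rcases history_received_subset (l := e.count T j + 1) ha with ha | ⟨k, hk, ha⟩
    · exact Finset.mem_union_left _ (List.mem_toFinset.2 ha)
    · obtain ⟨u', hu'⟩ := hunbounded k
      obtain ⟨z, s', hs', ha⟩ := he.exists_mem_sent_of_agreed hk ha hT fun h =>
        hnot u' ((history_received_prefix hu').subset h)
      refine Finset.mem_union_right _ (Finset.mem_biUnion.2 ⟨z, Finset.mem_univ z, ?_⟩)
      simpa [hs'] using ha
  obtain ⟨u, hu⟩ := hunbounded (F.card + 2)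
  have hcard := Finset.card_le_card fun a ha => hF (u := u) (List.mem_toFinset.1 ha)
  rw [List.toFinset_card_of_nodup (he.nodup_received j u), he.length_received] at hcard
  omega

end IsExecution

end SimulatedStep

/-! ### The simulated execution -/

section Trace

variable {n : ℕ} {M S Thr : Type*} {e : Trace n M S Thr} {p q : Fin n} {τ k : ℕ}

theorem Trace.received_succ_of_recv {m : M} (h : e.act τ = some (p, .recv q k))
    (hm : ((e.cfg τ).chan q p)[k]? = some m) :
    e.received p (τ + 1) = e.received p τ ++ [(q, k, m)] := by
  simp [Trace.received, List.range_succ, h, hm]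

theorem Trace.received_succ_of_ne_recv (h : ∀ q k, e.act τ ≠ some (p, .recv q k)) :
    e.received p (τ + 1) = e.received p τ := by
  rcases hact : e.act τ with - | ⟨p', - | ⟨q, k⟩ | θ⟩
  case some.recv =>
    have hp : p' ≠ p := fun hp => h q k (hp ▸ hact)
    simp [Trace.received, List.range_succ, hact, hp]
  all_goals simp [Trace.received, List.range_succ, hact]

end Trace

theorem exists_eq_of_le_of_succ_le {f : ℕ → ℕ} (hzero : f 0 = 0)
    (hsucc : ∀ u, f (u + 1) ≤ f u + 1) {k u : ℕ} (hk : k ≤ f u) : ∃ u', f u' = k := by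
  induction u with
  | zero => exact ⟨0, by omega⟩
  | succ u ih =>
    rcases hk.lt_or_eq with hlt | heq
    · exact ih (Nat.lt_succ_iff.1 (hlt.trans_le (hsucc u)))
    · exact ⟨u + 1, heq.symm⟩

section SimulatedTrace

variable {n n' t : ℕ} {In Out M S : Type*} [LinearOrder (SAVal n' In M)]

/-- The configuration of the simulated processes when, for each of them, the steps that some
simulator has simulated before the time `σ` of `e` are executed, and those in `X` are crashed. -/
def simulatedConfig (A : Algorithm n' In Out M S) (e : SimTrace n n' In Out M S)
    (X : Set (Fin n')) (σ : ℕ) : Config n' M S where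
  loc j := (e.simulated A j (e.count σ j)).state
  chan a b := (e.simulated A a (e.count σ a)).outs b
  got a b := {r | ∃ c, (a, r, c) ∈ (e.simulated A b (e.count σ b)).received}
  crashed := X

/-- The simulated processes whose simulation is blocked at some correct simulator. -/
def blockedSet (e : SimTrace n n' In Out M S) : Set (Fin n') :=
  {j | ∃ i, e.Correct i ∧ Blocked e i j}

/-- The simulated execution with the steps `label`. It executes the step `label σ` at the even time
`2 * σ`; the odd times are used for the crashes of the blocked processes: if `p_j` is blocked, it
crashes at the time `2 * (T + j) + 1`, where `T` is to be chosen such that `p_j` executes no step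
`label σ` with `T ≤ σ`. -/
def simulatedTrace (A : Algorithm n' In Out M S) (e : SimTrace n n' In Out M S)
    (label : ℕ → Option (Fin n' × Event n' Empty)) (T : ℕ) : Trace n' M S Empty where
  cfg τ := simulatedConfig A e {j | j ∈ blockedSet e ∧ T + j < τ / 2} ((τ + 1) / 2)
  act τ := if Even τ then label (τ / 2) else none

variable {A : Algorithm n' In Out M S} {inp : Fin n → Fin n' → In} {e : SimTrace n n' In Out M S}
  {I : Fin n' → In} {X : Set (Fin n')} {label : ℕ → Option (Fin n' × Event n' Empty)}
  {σ τ T : ℕ} {j : Fin n'}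

theorem simulatedConfig_succ_of_next {r : S × (Fin n' → List M)} {l : List (SimMsg n' M)}
    (hcount : e.count (σ + 1) = Function.update (e.count σ) j (e.count σ j + 1))
    (hnext : e.simulated A j (e.count σ j + 1) =
      (e.simulated A j (e.count σ j)).next A j r l) :
    simulatedConfig A e X (σ + 1) =
      { (simulatedConfig A e X σ).send j r.2 with
        loc := Function.update (simulatedConfig A e X σ).loc j (some r.1)
        got := fun a b => if b = j then {k | ∃ c, (a, k, c) ∈ l}
          else (simulatedConfig A e X σ).got a b } := by
  simp only [simulatedConfig, Config.send, Config.mk.injEq, and_true]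
  refine ⟨funext fun a => ?_, funext₂ fun a b => ?_, funext₂ fun a b => ?_⟩
  · rcases eq_or_ne a j with rfl | ha
    · simp [hcount, hnext, History.next]
    · simp [hcount, ha]
  · rcases eq_or_ne a j with rfl | ha
    · simp [hcount, hnext, History.next]
    · simp [hcount, ha]
  · rcases eq_or_ne b j with rfl | hb
    · simp [hcount, hnext, History.next]
    · simp [hcount, hb]

theorem simulatedConfig_step_start (hzero : e.count σ j = 0)
    (hv : e.agreed (j, 0) = some (.input (I j)))
    (hcount : e.count (σ + 1) = Function.update (e.count σ) j (e.count σ j + 1)) (hX : j ∉ X) :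
    Step A.toProtocol I (simulatedConfig A e X σ) (some (j, .start))
      (simulatedConfig A e X (σ + 1)) := by
  have hnext : e.simulated A j (e.count σ j + 1) = (e.simulated A j (e.count σ j)).next A j
      (A.δ j (A.init j (I j)) none) (e.simulated A j (e.count σ j)).received := by
    rw [hzero]
    exact history_succ_of_input hv
  convert Step.run (simulatedConfig A e X σ) j .start (A.δ j (A.init j (I j)) none).1
    (A.δ j (A.init j (I j)) none).2 hX ?_ using 1
  · rw [simulatedConfig_succ_of_next hcount hnext]
    simp only [Config.mark, Config.send, Config.mk.injEq, true_and, and_true]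
    refine funext₂ fun a b => ite_eq_right_iff.2 ?_
    rintro rfl
    rfl
  · rw [Protocol.effect_start_eq_some]
    exact ⟨by simp [simulatedConfig, hzero, SimTrace.simulated, history], rfl⟩

theorem simulatedConfig_step_recv (he : IsExecution (simulation n A) inp t e) {m : SimMsg n' M}
    {st : S} (hm : e.agreed (j, e.count σ j) = some (.msg m))
    (hst : (e.simulated A j (e.count σ j)).state = some st)
    (hnew : m ∉ (e.simulated A j (e.count σ j)).received)
    (hsent : ((e.simulated A m.1 (e.count σ m.1)).outs j)[m.2.1]? = some m.2.2)
    (hcount : e.count (σ + 1) = Function.update (e.count σ) j (e.count σ j + 1)) (hX : j ∉ X) :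
    Step A.toProtocol I (simulatedConfig A e X σ) (some (j, .recv m.1 m.2.1))
      (simulatedConfig A e X (σ + 1)) := by
  have hnext : e.simulated A j (e.count σ j + 1) = (e.simulated A j (e.count σ j)).next A j
      (A.δ j st (some (m.1, m.2.2))) ((e.simulated A j (e.count σ j)).received ++ [m]) :=
    history_succ_of_msg hm hst
  convert Step.run (simulatedConfig A e X σ) j (.recv m.1 m.2.1)
    (A.δ j st (some (m.1, m.2.2))).1 (A.δ j st (some (m.1, m.2.2))).2 hX ?_ using 1
  · rw [simulatedConfig_succ_of_next hcount hnext]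
    simp only [Config.mark, Config.send, Config.mk.injEq, true_and, and_true]
    refine funext₂ fun a b => ?_
    rcases eq_or_ne b j with rfl | hb
    · rcases eq_or_ne a m.1 with rfl | ha
      · ext k
        simp [simulatedConfig, Prod.ext_iff, exists_or, or_comm]
      · simp [simulatedConfig, Prod.ext_iff, ha]
    · simp [hb]
  · refine Protocol.effect_recv_eq_some.2 ⟨?_, st, m.2.2, hst, hsent, rfl⟩
    rintro ⟨c, hc⟩
    obtain rfl : c = m.2.2 := Option.some.inj
      ((he.outs_getElem?_of_mem_received hc).symm.trans hsent)
    exact hnew hc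

theorem simulatedConfig_step (he : IsExecution (simulation n A) inp t e)
    {label : Option (Fin n' × Event n' Empty)} (hlabel : SimulatedStep A e σ label)
    (hI : ∀ j v, e.agreed (j, 0) = some (.input v) → I j = v)
    (hX : ∀ j, e.count (σ + 1) j ≠ e.count σ j → j ∉ X) :
    Step A.toProtocol I (simulatedConfig A e X σ) label (simulatedConfig A e X (σ + 1)) := by
  cases hlabel with
  | idle hcount =>
    have hsame : simulatedConfig A e X (σ + 1) = simulatedConfig A e X σ := by
      simp only [simulatedConfig, hcount]
    exact hsame ▸ .idle _
  | start j v hzero hv hcount =>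
    exact simulatedConfig_step_start hzero (hI j v hv ▸ hv) hcount (hX j (by simp [hcount]))
  | recv j m st hm hst hnew hsent hcount =>
    exact simulatedConfig_step_recv he hm hst hnew hsent hcount (hX j (by simp [hcount]))

theorem simulatedTrace_cfg_two_mul (u : ℕ) : (simulatedTrace A e label T).cfg (2 * u) =
    simulatedConfig A e {j | j ∈ blockedSet e ∧ T + j < u} u := by
  simp only [simulatedTrace, show (2 * u + 1) / 2 = u by omega, show 2 * u / 2 = u by omega]

theorem simulatedTrace_cfg_two_mul_add_one (u : ℕ) :
    (simulatedTrace A e label T).cfg (2 * u + 1) =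
      simulatedConfig A e {j | j ∈ blockedSet e ∧ T + j < u} (u + 1) := by
  simp only [simulatedTrace, show (2 * u + 1) / 2 = u by omega,
    show (2 * u + 1 + 1) / 2 = u + 1 by omega]

theorem simulatedTrace_loc_two_mul (u : ℕ) : ((simulatedTrace A e label T).cfg (2 * u)).loc j =
    (e.simulated A j (e.count u j)).state := by
  rw [simulatedTrace_cfg_two_mul, simulatedConfig]

theorem simulatedTrace_act_two_mul (u : ℕ) :
    (simulatedTrace A e label T).act (2 * u) = label u := by
  simp [simulatedTrace]

theorem simulatedTrace_act_two_mul_add_one (u : ℕ) :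
    (simulatedTrace A e label T).act (2 * u + 1) = none := by
  simp [simulatedTrace]

theorem simulatedTrace_correct_iff :
    (simulatedTrace A e label T).Correct j ↔ j ∉ blockedSet e := by
  refine ⟨fun h hj => h (2 * (T + j + 1)) ?_, fun h _ hτ => h hτ.1⟩
  rw [simulatedTrace_cfg_two_mul]
  exact ⟨hj, Nat.lt_succ_self _⟩

theorem simulatedTrace_received (he : IsExecution (simulation n A) inp t e)
    (hlabel : ∀ σ, SimulatedStep A e σ (label σ)) (j : Fin n') (τ : ℕ) :
    (simulatedTrace A e label T).received j τ =
      (e.simulated A j (e.count ((τ + 1) / 2) j)).received := by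
  induction τ with
  | zero => simp [Trace.received, he.count_zero, SimTrace.simulated, history]
  | succ τ ih =>
    obtain ⟨u, rfl | rfl⟩ := τ.even_or_odd'
    · have hact := simulatedTrace_act_two_mul (A := A) (e := e) (label := label) (T := T) u
      rw [show (2 * u + 1) / 2 = u by omega] at ih
      rw [show (2 * u + 1 + 1) / 2 = u + 1 by omega]
      rcases (hlabel u).received_eq_or j with ⟨heq, hne⟩ | ⟨m, hm, -, hsent, heq⟩
      · rw [Trace.received_succ_of_ne_recv (by rwa [hact]), ih, heq]
      · rw [Trace.received_succ_of_recv (m := m.2.2) (hact.trans hm)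
          (by rwa [simulatedTrace_cfg_two_mul]), ih, heq]
    · rw [show (2 * u + 1 + 1 + 1) / 2 = (2 * u + 1 + 1) / 2 by omega, ← ih,
        Trace.received_succ_of_ne_recv (by simp [simulatedTrace_act_two_mul_add_one])]

theorem simulatedConfig_step_crash (u : ℕ) :
    Step A.toProtocol I (simulatedConfig A e {j | j ∈ blockedSet e ∧ T + j < u} σ) none
      (simulatedConfig A e {j | j ∈ blockedSet e ∧ T + j < u + 1} σ) := by
  by_cases hj : ∃ j : Fin n', j ∈ blockedSet e ∧ T + j = u
  · obtain ⟨j, hj, rfl⟩ := hj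
    have hinsert : {a | a ∈ blockedSet e ∧ T + a < T + j + 1} =
        insert j {a | a ∈ blockedSet e ∧ T + a < T + j} := by
      ext a
      rcases eq_or_ne a j with rfl | ha
      · simp [hj]
      · have hne : (a : ℕ) ≠ j := Fin.val_ne_of_ne ha
        simp only [Set.mem_ofPred_eq, Set.mem_insert_iff, ha, false_or]
        exact and_congr_right fun _ => by omega
    rw [hinsert]
    exact .crash (simulatedConfig A e _ σ) j fun h => lt_irrefl _ h.2
  · have hcrashed : {j | j ∈ blockedSet e ∧ T + j < u + 1} =
        {j | j ∈ blockedSet e ∧ T + j < u} :=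
      Set.ext fun a => and_congr_right fun ha => by
        have hne : T + a ≠ u := fun h => hj ⟨a, ha, h⟩
        omega
    rw [hcrashed]
    exact .idle _

theorem simulatedTrace_step (he : IsExecution (simulation n A) inp t e)
    (hlabel : ∀ σ, SimulatedStep A e σ (label σ))
    (hI : ∀ j v, e.agreed (j, 0) = some (.input v) → I j = v)
    (hT : ∀ σ ≥ T, ∀ j ∈ blockedSet e, e.count (σ + 1) j = e.count σ j) (τ : ℕ) :
    Step A.toProtocol I ((simulatedTrace A e label T).cfg τ) ((simulatedTrace A e label T).act τ)
      ((simulatedTrace A e label T).cfg (τ + 1)) := by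
  obtain ⟨u, rfl | rfl⟩ := τ.even_or_odd'
  · rw [simulatedTrace_cfg_two_mul, simulatedTrace_act_two_mul, simulatedTrace_cfg_two_mul_add_one]
    refine simulatedConfig_step he (hlabel u) hI fun j hj ⟨hblocked, hlt⟩ => hj ?_
    exact hT u ((Nat.le_add_right T j).trans hlt.le) j hblocked
  · rw [show 2 * u + 1 + 1 = 2 * (u + 1) by omega, simulatedTrace_cfg_two_mul_add_one,
      simulatedTrace_act_two_mul_add_one, simulatedTrace_cfg_two_mul]
    exact simulatedConfig_step_crash u

namespace IsExecution

theorem exists_inputs (he : IsExecution (simulation n A) inp t e) (i₀ : Fin n) :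
    ∃ I : Fin n' → In, (∀ j, ∃ i, I j = inp i j) ∧
      ∀ j v, e.agreed (j, 0) = some (.input v) → I j = v := by
  suffices h : ∀ j, ∃ x, (∃ i, x = inp i j) ∧ ∀ v, e.agreed (j, 0) = some (.input v) → x = v by
    choose I hI using h
    exact ⟨I, fun j => (hI j).1, fun j => (hI j).2⟩
  intro j
  by_cases hagreed : ∃ v, e.agreed (j, 0) = some (.input v)
  · obtain ⟨v, hv⟩ := hagreed
    obtain ⟨i, τ, s, hs, hr⟩ := SimTrace.exists_result_of_agreed_eq_some hv
    rcases he.eq_input_or_eq_msg_of_result hs hr with ⟨-, x, hx⟩ | ⟨hpos, -⟩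
    · cases hx
      refine ⟨_, ⟨x, rfl⟩, fun v' hv' => ?_⟩
      cases hv.symm.trans hv'
      rfl
    · exact absurd hpos (lt_irrefl 0)
  · exact ⟨inp i₀ j, ⟨i₀, rfl⟩, fun v hv => absurd ⟨v, hv⟩ hagreed⟩

theorem exists_count_eq (he : IsExecution (simulation n A) inp t e) {k : ℕ}
    (hk : k ≤ e.count σ j) : ∃ u, e.count u j = k := by
  refine exists_eq_of_le_of_succ_le (f := fun u => e.count u j) (he.count_zero j) (fun u => ?_) hk
  obtain ⟨label, hlabel⟩ := he.exists_simulatedStep u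
  exact hlabel.count_succ_le j

theorem exists_sn_eq (he : IsExecution (simulation n A) inp t e) (htn : 2 * t < n) {i : Fin n}
    (hi : e.Correct i) (σ : ℕ) (j : Fin n') :
    ∃ u s, (e.cfg u).loc i = some s ∧ s.sn j = e.count σ j := by
  obtain ⟨u, s, hs, hle⟩ := he.exists_count_le_sn htn hi σ j
  obtain ⟨u', hu'⟩ := exists_eq_of_le_of_succ_le (u := u) (k := e.count σ j + 1)
    (f := fun u => ((e.cfg u).loc i).elim 0 fun s => s.sn j + 1)
    (by simp [he.init, Config.initial])
    (fun u => by
      rcases he.loc_succ_cases u i with h | ⟨h, h'⟩ | ⟨a, b, out, ha, hb, hstep, -⟩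
      · simp [h]
      · simp [h, h', SimState.initial]
      · simpa [ha, hb] using hstep.sn_le_succ j)
    (by simpa [hs] using hle)
  cases hloc : (e.cfg u').loc i with
  | none => simp [hloc] at hu'
  | some s' => exact ⟨u', s', hloc, by simpa [hloc] using hu'⟩

theorem exists_count_eq_of_blocked (he : IsExecution (simulation n A) inp t e)
    (htn : 2 * t < n) :
    ∃ T, ∀ σ ≥ T, ∀ j ∈ blockedSet e, e.count (σ + 1) j = e.count σ j := by
  refine Filter.eventually_atTop.1 (Filter.eventually_all.2 fun j => ?_)
  by_cases hj : j ∈ blockedSet e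
  · obtain ⟨i, hi, hb⟩ := hj
    obtain ⟨b, hb⟩ := he.exists_count_le_of_blocked htn hi hb
    obtain ⟨c, T, hT⟩ := converges_of_monotone_of_bounded (f := fun σ => e.count σ j)
      (fun _ _ h => he.count_mono h j) hb
    filter_upwards [Filter.eventually_ge_atTop T] with σ hσ _
    rw [hT (σ + 1) (hσ.trans σ.le_succ), hT σ hσ]
  · exact .of_forall fun _ h => absurd h hj

theorem exists_blocking (he : IsExecution (simulation n A) inp t e) (htn : 2 * t < n)
    (hn' : 0 < n') :
    ∃ f : Fin n → Fin n', ∀ i j, e.Correct i → Blocked e i j → ∃ k, ¬ e.Correct k ∧ f k = j := by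
  have hex (x : Fin n) : ∃ j₀, ∀ j, e.CrashedIn x j → j₀ = j := by
    by_cases h : ∃ j, e.CrashedIn x j
    · exact ⟨h.choose, fun j hj => h.choose_spec.unique he hj⟩
    · exact ⟨⟨0, hn'⟩, fun j hj => absurd ⟨j, hj⟩ h⟩
  choose f hf using hex
  refine ⟨f, fun i j hi hb => ?_⟩
  obtain ⟨x, hx⟩ := he.exists_crashedIn_of_blocked htn hi hb
  obtain ⟨τ, s, hcrashed, -⟩ := id hx
  exact ⟨x, fun hc => hc τ hcrashed, hf x j hx⟩

theorem ncard_blockedSet_le (he : IsExecution (simulation n A) inp t e) (htn : 2 * t < n) :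
    (blockedSet e).ncard ≤ t := by
  rcases n'.eq_zero_or_pos with rfl | hn'
  · simp [Set.eq_empty_of_isEmpty (blockedSet e)]
  obtain ⟨f, hf⟩ := he.exists_blocking htn hn'
  have hsub : blockedSet e ⊆ f '' {k | ¬ e.Correct k} := fun j ⟨i, hi, hb⟩ => hf i j hi hb
  calc (blockedSet e).ncard ≤ (f '' {k | ¬ e.Correct k}).ncard := Set.ncard_le_ncard hsub
    _ ≤ {k | ¬ e.Correct k}.ncard := Set.ncard_image_le
    _ ≤ t := he.resilient

theorem isExecution_simulatedTrace (he : IsExecution (simulation n A) inp t e) (htn : 2 * t < n)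
    (hlabel : ∀ σ, SimulatedStep A e σ (label σ))
    (hI : ∀ j v, e.agreed (j, 0) = some (.input v) → I j = v)
    (hT : ∀ σ ≥ T, ∀ j ∈ blockedSet e, e.count (σ + 1) j = e.count σ j) :
    IsExecution A.toProtocol I t (simulatedTrace A e label T) where
  init := by
    simp [simulatedTrace, simulatedConfig, Config.initial, he.count_zero, SimTrace.simulated,
      history]
  step := simulatedTrace_step he hlabel hI hT
  resilient := by
    simpa only [simulatedTrace_correct_iff, not_not, Set.ofPred_mem_eq] using
      he.ncard_blockedSet_le htn
  starts j hj := by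
    rw [simulatedTrace_correct_iff] at hj
    obtain ⟨i, hi⟩ := he.exists_correct (by omega)
    obtain ⟨τ, -, s, hs, hpc⟩ := exists_waitMsg_of_not_blocked (fun hb => hj ⟨i, hi, hb⟩) 0
    obtain ⟨u, hu⟩ := he.exists_count_eq (SimTrace.sn_le_count hs j)
    refine ⟨2 * u, ?_⟩
    rw [simulatedTrace_loc_two_mul, hu, ← (he.matches_simulated hs j).state]
    exact mt (he.threadInv hs j).state_eq_none.2 ((he.threadInv hs j).sn_pos hpc).ne'
  delivers j hj q τ r hr := by
    rw [simulatedTrace_correct_iff] at hj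
    obtain ⟨u, hu⟩ := he.exists_mem_received (m := (q, r, _)) htn
      (fun i hi hb => hj ⟨i, hi, hb⟩) (List.getElem?_eq_getElem hr)
    refine ⟨2 * u, ?_⟩
    rw [simulatedTrace_cfg_two_mul]
    exact ⟨_, hu⟩
  fair _ _ θ := θ.elim

end IsExecution

theorem simulatedTrace_decides (he : IsExecution (simulation n A) inp t e) {i : Fin n} {v : Out}
    (h : Computes e i j v) : A.Decides (simulatedTrace A e label T) j v := by
  obtain ⟨s, ⟨τ, hs⟩, hv⟩ := h
  rw [(he.matches_simulated hs j).decided] at hv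
  obtain ⟨k, hk, hdec, hfirst⟩ := exists_first_of_history_decided hv
  obtain ⟨u, hu⟩ := he.exists_count_eq (hk.trans (SimTrace.sn_le_count hs j))
  have hex : ∃ τ, e.count ((τ + 1) / 2) j = k := ⟨2 * u, by rw [← hu]; congr 1; omega⟩
  classical
  refine ⟨Nat.find hex, ?_, fun τ' hτ' => hfirst _ (lt_of_le_of_ne ?_ (Nat.find_min hex hτ'))⟩
  · simpa only [simulatedTrace, simulatedConfig, Nat.find_spec hex] using hdec
  · calc e.count ((τ' + 1) / 2) j ≤ e.count ((Nat.find hex + 1) / 2) j := he.count_mono (by omega) j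
      _ = k := Nat.find_spec hex

theorem IsExecution.simulates_simulatedTrace (he : IsExecution (simulation n A) inp t e)
    (htn : 2 * t < n) (hlabel : ∀ σ, SimulatedStep A e σ (label σ))
    (hinput : ∀ j, ∃ i, I j = inp i j)
    (hI : ∀ j v, e.agreed (j, 0) = some (.input v) → I j = v)
    (hT : ∀ σ ≥ T, ∀ j ∈ blockedSet e, e.count (σ + 1) j = e.count σ j) :
    Simulates A t inp e I (simulatedTrace A e label T) where
  input := hinput
  execution := he.isExecution_simulatedTrace htn hlabel hI hT
  sound := by
    rintro i s ⟨τ, hs⟩ j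
    obtain ⟨u, hu⟩ := he.exists_count_eq (SimTrace.sn_le_count hs j)
    refine ⟨2 * u, ?_, ?_⟩
    · rw [simulatedTrace_loc_two_mul, hu, (he.matches_simulated hs j).state]
    · rw [simulatedTrace_received he hlabel, show (2 * u + 1) / 2 = u by omega, hu,
        (he.matches_simulated hs j).received]
  complete i hi j τ := by
    obtain ⟨u, s, hs, hsn⟩ := he.exists_sn_eq htn hi ((τ + 1) / 2) j
    refine ⟨s, ⟨u, hs⟩, ?_, ?_⟩
    · rw [(he.matches_simulated hs j).state, hsn]
      rfl
    · rw [simulatedTrace_received he hlabel, (he.matches_simulated hs j).received, hsn]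
  crash j := by
    rw [simulatedTrace_correct_iff, not_not]
    rfl
  decision _ _ _ := simulatedTrace_decides he

theorem IsExecution.exists_simulates (he : IsExecution (simulation n A) inp t e)
    (htn : 2 * t < n) : ∃ I e', Simulates A t inp e I e' := by
  choose label hlabel using he.exists_simulatedStep
  obtain ⟨I, hinput, hI⟩ := he.exists_inputs ⟨t, by omega⟩
  obtain ⟨T, hT⟩ := he.exists_count_eq_of_blocked htn
  exact ⟨I, _, he.simulates_simulatedTrace htn hlabel hinput hI hT⟩

theorem IsExecution.eq_of_received_getElem? (he : IsExecution (simulation n A) inp t e)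
    {i₁ i₂ : Fin n} {s₁ s₂ : SimState n n' In Out M S} (h₁ : Reaches e i₁ s₁)
    (h₂ : Reaches e i₂ s₂) {k : ℕ} {m₁ m₂ : SimMsg n' M} (hm₁ : (s₁.received j)[k]? = some m₁)
    (hm₂ : (s₂.received j)[k]? = some m₂) : m₁ = m₂ := by
  obtain ⟨τ₁, hs₁⟩ := h₁
  obtain ⟨τ₂, hs₂⟩ := h₂
  rw [(he.matches_simulated hs₁ j).received] at hm₁
  rw [(he.matches_simulated hs₂ j).received] at hm₂
  exact eq_of_getElem?_of_isPrefix (history_received_prefix (le_max_left (s₁.sn j) (s₂.sn j)))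
    (history_received_prefix (le_max_right _ _)) hm₁ hm₂

theorem IsExecution.exists_computes_of_decides (he : IsExecution (simulation n A) inp t e)
    {e' : Trace n' M S Empty} (hsim : Simulates A t inp e I e') {i : Fin n} (hi : e.Correct i)
    {v : Out} (hv : A.Decides e' j v) : ∃ v', Computes e i j v' := by
  obtain ⟨τ, hv, -⟩ := hv
  obtain ⟨s, ⟨u, hs⟩, hstate, -⟩ := hsim.complete i hi j τ
  rw [← hstate, (he.matches_simulated hs j).state] at hv
  obtain ⟨v', hv'⟩ := Option.ne_none_iff_exists'.1
    (history_decided_ne_none (hv ▸ Option.some_ne_none v))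
  exact ⟨v', s, ⟨u, hs⟩, (he.matches_simulated hs j).decided.trans hv'⟩

theorem IsExecution.sub_le_ncard_computes (he : IsExecution (simulation n A) inp t e)
    {e' : Trace n' M S Empty} (hsim : Simulates A t inp e I e')
    (hdec : ∀ j, e'.Correct j → ∃ v, A.Decides e' j v) {i : Fin n} (hi : e.Correct i) :
    n' - t ≤ {j | ∃ v, Computes e i j v}.ncard := by
  have hsub : {j | ¬ e'.Correct j}ᶜ ⊆ {j | ∃ v, Computes e i j v} := fun j hj =>
    let ⟨_, hv⟩ := hdec j (not_not.1 hj)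
    he.exists_computes_of_decides hsim hi hv
  have hle := Set.ncard_le_ncard hsub
  have hsum := Set.ncard_add_ncard_compl {j | ¬ e'.Correct j}
  have hcrash := hsim.execution.resilient
  rw [Nat.card_fin] at hsum
  omega

end SimulatedTrace

end BG

end

theorem mainTheorem3_general {n n' t : ℕ} {In Out M S : Type*} [LinearOrder (BG.SAVal n' In M)]
    (htn : 2 * t < n) (hn' : 0 < n')
    (T : BG.Task n' In Out) (A : BG.Algorithm n' In Out M S) (hA : A.Solves T t)
    (inp : Fin n → Fin n' → In)
    (hinp : ∀ I : Fin n' → In, (∀ j, ∃ i, I j = inp i j) → I ∈ T.inputs)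
    (e : BG.SimTrace n n' In Out M S)
    (he : BG.IsExecution (BG.simulation n A) inp t e) :
    (∃ I e', BG.Simulates A t inp e I e' ∧
      ∃ O, T.rel I O ∧ ∀ i j v, BG.Computes e i j v → O j = v) ∧
    (∃ f : Fin n → Fin n', ∀ i j, e.Correct i → BG.Blocked e i j →
      ∃ k, ¬ e.Correct k ∧ f k = j) ∧
    (∀ i₁ i₂ s₁ s₂, BG.Reaches e i₁ s₁ → BG.Reaches e i₂ s₂ → ∀ (j : Fin n') (k : ℕ) m₁ m₂,
      (s₁.received j)[k]? = some m₁ → (s₂.received j)[k]? = some m₂ → m₁ = m₂) ∧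
    (∀ i, e.Correct i → n' - t ≤ {j | ∃ v, BG.Computes e i j v}.ncard) := by
  obtain ⟨I, e', hsim⟩ := he.exists_simulates htn
  obtain ⟨hdec, O, hO, hOv⟩ := hA I (hinp I hsim.input) e' hsim.execution
  exact ⟨⟨I, e', hsim, O, hO, fun i j v h => hOv j v (hsim.decision i j v h)⟩,
    he.exists_blocking htn hn',
    fun _ _ _ _ h₁ h₂ _ _ _ _ => he.eq_of_received_getElem? h₁ h₂,
    fun _ => he.sub_le_ncard_computes hsim hdec⟩

theorem mainTheorem3 {n n' t : ℕ} {In Out M S : Type*} [LinearOrder (BG.SAVal n' In M)]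
    (htn : 2 * t < n) (htn' : t < n')
    (T : BG.Task n' In Out) (A : BG.Algorithm n' In Out M S) (hA : A.Solves T t)
    (inp : Fin n → Fin n' → In)
    (hinp : ∀ I : Fin n' → In, (∀ j, ∃ i, I j = inp i j) → I ∈ T.inputs)
    (e : BG.SimTrace n n' In Out M S)
    (he : BG.IsExecution (BG.simulation n A) inp t e) :
    -- the simulators simulate an execution of `A` with at most `t` crashes
    (∃ I e', BG.Simulates A t inp e I e' ∧
      ∃ O, T.rel I O ∧ ∀ i j v, BG.Computes e i j v → O j = v) ∧
    -- the crash of a simulator blocks at most one simulated process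
    (∃ f : Fin n → Fin n', ∀ i j, e.Correct i → BG.Blocked e i j →
      ∃ k, ¬ e.Correct k ∧ f k = j) ∧
    -- all simulators see the same sequences of received messages
    (∀ i₁ i₂ s₁ s₂, BG.Reaches e i₁ s₁ → BG.Reaches e i₂ s₂ → ∀ (j : Fin n') (k : ℕ) m₁ m₂,
      (s₁.received j)[k]? = some m₁ → (s₂.received j)[k]? = some m₂ → m₁ = m₂) ∧
    -- each correct simulator computes the decisions of at least `n' - t` simulated processes
    (∀ i, e.Correct i → n' - t ≤ {j | ∃ v, BG.Computes e i j v}.ncard) :=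
  mainTheorem3_general htn (t.zero_le.trans_lt htn') T A hA inp hinp e he
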